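/- Let $d\ge 0$ be a constant. The treedepth of a finite graph $H$ is the least height (maximum number of vertices on a root-to-vertex path) of a rooted forest on $V(H)$ such that the endpoints of every edge of $H$ are in ancestor–descendant relation. A modulator to treedepth $d$ of a finite simple graph $G$ is a set $S\subseteq V(G)$ such that $G-S$ has treedepth at most $d$. Longest Path parameterized by the size of a modulator to treedepth $d$ is the problem whose instances are triples $(G,S,\ell)$ with $S$ a modulator to treedepth $d$ of $G$ and $\ell$ a positive integer; its parameter is $k=|S|$, and the question is whether $G$ contains a simple path of length (number of edges) at least $\ell$. Define $g$ on pairs of non-negative integers by $$g(0,k)=k,\qquad g(i,k)=g\big(i-1,(k+1)^3\big)\quad(i\ge 1).$$ Theorem. We have $g(d,k)=O(k^{3^d})$ as $k\to\infty$. Moreover, there is an algorithm (depending on $d$) that, given an instance $(G,S,\ell)$ with $|S|=k$, outputs an instance $(G',S',\ell')$ of the same problem such that $G$ has a path of length at least $\ell$ if and only if $G'$ has a path of length at least $\ell'$, $|V(G')|\le g(d,k)$, and $\ell'\le |V(G')|+1$. The algorithm runs in $O(k^2\cdot|V(G)|)$ steps if $k\ge 1$, and in $O(\max(|V(G)|,1))$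 steps if $k=0$, where the constants depend only on $d$. Thus Longest Path has a polynomial kernel with at most $g(d,k)=O(k^{3^d})$ vertices. Here graphs are given by adjacency lists with vertices $0,\dots,|V(G)|-1$, and the steps are those of a word RAM whose words have at least $c\cdot\log_2(|V(G)|+\ell+2)$ bits, for a constant $c$ depending only on $d$. -/

import Mathlib

namespace LPKernel

/-! ### Treedepth and the problem Longest Path -/

/-- A rooted forest with vertex set `V`, given by its parent map (`none` at the roots).
For finite `V`, well-foundedness of the parent relation says that there are no cycles. -/
structure RootedForest (V : Type) where
  parent : V → Option V
  wf : WellFounded fun p v : V => parent v = some p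

/-- `x` is a proper ancestor of `y`. -/
def RootedForest.Ancestor {V : Type} (F : RootedForest V) (x y : V) : Prop :=
  Relation.TransGen (fun p v => F.parent v = some p) x y

/-- The number of vertices on the path from the root of the tree of `v` to `v`. -/
noncomputable def RootedForest.depth {V : Type} (F : RootedForest V) (v : V) : ℕ :=
  Set.ncard {u | u = v ∨ F.Ancestor u v}

/-- `F` is a treedepth decomposition of `G`: every edge of `G` is an edge of the closure of `F`. -/
def RootedForest.Decomposes {V : Type} (F : RootedForest V) (G : SimpleGraph V) : Prop :=
  ∀ x y, G.Adj x y → F.Ancestor x y ∨ F.Ancestor y x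

/-- The least height of a treedepth decomposition of the finite graph `G`. -/
noncomputable def treedepth {V : Type} (G : SimpleGraph V) : ℕ :=
  sInf {h | ∃ F : RootedForest V, F.Decomposes G ∧ ∀ v, F.depth v ≤ h}

/-- `S` is a modulator of `G` to treedepth `d`: the graph `G - S` has treedepth at most `d`. -/
def IsModulator {n : ℕ} (G : SimpleGraph (Fin n)) (S : Finset (Fin n)) (d : ℕ) : Prop :=
  treedepth (G.induce {v | v ∉ S}) ≤ d

/-- An instance of Longest Path, together with a modulator to treedepth `d`. -/
structure Instance (d : ℕ) where
  n : ℕ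
  G : SimpleGraph (Fin n)
  S : Finset (Fin n)
  ℓ : ℕ
  ℓ_pos : 0 < ℓ
  modulator : IsModulator G S d

/-- The parameter: the size of the modulator. -/
def Instance.k {d : ℕ} (I : Instance d) : ℕ := I.S.card

/-- The graph contains a simple path of length (number of edges) at least `ℓ`. -/
def Instance.Yes {d : ℕ} (I : Instance d) : Prop :=
  ∃ (u v : Fin I.n) (p : I.G.Walk u v), p.IsPath ∧ I.ℓ ≤ p.length

/-- The sequence of words `x` is an encoding of the instance by adjacency lists: the numbers
`n`, `k`, `ℓ`, then the `k` vertices of the modulator in some order, then for each of the vertices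
`0, …, n - 1` its degree, followed by its neighbours in some order. -/
def Instance.EncodedBy {d : ℕ} (I : Instance d) (x : List ℕ) : Prop :=
  ∃ (mods : List (Fin I.n)) (adj : Fin I.n → List (Fin I.n)),
    (mods.Nodup ∧ ∀ v, v ∈ mods ↔ v ∈ I.S) ∧
    (∀ u, (adj u).Nodup ∧ ∀ v, v ∈ adj u ↔ I.G.Adj u v) ∧
    x = [I.n, I.k, I.ℓ] ++ mods.map Fin.val ++
      (List.finRange I.n).flatMap fun u => (adj u).length :: (adj u).map Fin.val

/-- The size bound of the kernel. -/
def g : ℕ → ℕ → ℕ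
  | 0, k => k
  | i + 1, k => g i ((k + 1) ^ 3)

/-! ### The word RAM

Programs are structured programs over registers and random access arrays, both indexed by `ℕ`
(a program names only finitely many of them). With word length `w`, registers and array cells hold
numbers below `2 ^ w`, and the result of every operation is taken modulo `2 ^ w`. -/

/-- The arithmetic operations and tests on words; tests return `1` or `0`. -/
inductive Op
  | add | sub | mul | div | mod | lt | eq

/-- Subtraction is truncated at `0`, and division by `0` gives `0`. -/
def Op.apply : Op → ℕ → ℕ → ℕ
  | .add, a, b => a + b
  | .sub, a, b => a - b
  | .mul, a, b => a * b
  | .div, a, b => a / b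
  | .mod, a, b => a % b
  | .lt, a, b => if a < b then 1 else 0
  | .eq, a, b => if a = b then 1 else 0

/-- Expressions: constants, registers, the cell of array `a` at a computed index, operations. -/
inductive Term
  | const (c : ℕ)
  | reg (r : ℕ)
  | cell (a : ℕ) (i : Term)
  | op (o : Op) (e f : Term)

/-- The contents of the registers and of the arrays (`mem a i` is cell `i` of array `a`). -/
structure State where
  reg : ℕ → ℕ
  mem : ℕ → ℕ → ℕ

/-- The value of an expression, with word length `w`. -/
def Term.eval (w : ℕ) (σ : State) : Term → ℕ
  | .const c => c % 2 ^ w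
  | .reg r => σ.reg r
  | .cell a i => σ.mem a (i.eval w σ)
  | .op o e f => o.apply (e.eval w σ) (f.eval w σ) % 2 ^ w

/-- The number of steps that the evaluation of an expression takes. -/
def Term.cost : Term → ℕ
  | .const _ => 1
  | .reg _ => 1
  | .cell _ i => i.cost + 1
  | .op _ e f => e.cost + f.cost + 1

/-- Programs. A test succeeds if its value is not `0`. -/
inductive Program
  | skip
  | assign (r : ℕ) (e : Term)
  | store (a : ℕ) (i e : Term)
  | seq (p q : Program)
  | ite (e : Term) (p q : Program)
  | loop (e : Term) (p : Program)

/-- Replace the content of register `r` by `x`. -/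
def State.setReg (σ : State) (r x : ℕ) : State :=
  { σ with reg := Function.update σ.reg r x }

/-- Replace the content of cell `i` of array `a` by `x`. -/
def State.setMem (σ : State) (a i x : ℕ) : State :=
  { σ with mem := Function.update σ.mem a (Function.update (σ.mem a) i x) }

/-- `Exec w p σ τ t`: with word length `w`, the program `p`, started in the state `σ`, halts in the
state `τ` after `t` steps. (`loop e p` repeats `p` as long as the test `e` succeeds.) -/
inductive Exec (w : ℕ) : Program → State → State → ℕ → Prop
  | skip (σ : State) : Exec w .skip σ σ 1
  | assign (r : ℕ) (e : Term) (σ : State) :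
      Exec w (.assign r e) σ (σ.setReg r (e.eval w σ)) (e.cost + 1)
  | store (a : ℕ) (i e : Term) (σ : State) :
      Exec w (.store a i e) σ (σ.setMem a (i.eval w σ) (e.eval w σ)) (i.cost + e.cost + 1)
  | seq {p q : Program} {σ τ υ : State} {s t : ℕ} :
      Exec w p σ τ s → Exec w q τ υ t → Exec w (.seq p q) σ υ (s + t)
  | ite_true {e : Term} {p q : Program} {σ τ : State} {t : ℕ} :
      e.eval w σ ≠ 0 → Exec w p σ τ t → Exec w (.ite e p q) σ τ (e.cost + 1 + t)
  | ite_false {e : Term} {p q : Program} {σ τ : State} {t : ℕ} :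
      e.eval w σ = 0 → Exec w q σ τ t → Exec w (.ite e p q) σ τ (e.cost + 1 + t)
  | loop_true {e : Term} {p : Program} {σ τ υ : State} {s t : ℕ} :
      e.eval w σ ≠ 0 → Exec w p σ τ s → Exec w (.loop e p) τ υ t →
        Exec w (.loop e p) σ υ (e.cost + 1 + s + t)
  | loop_false {e : Term} {p : Program} {σ : State} :
      e.eval w σ = 0 → Exec w (.loop e p) σ σ (e.cost + 1)

/-- The initial state: the input is in array `0`; everything else is `0`. -/
def State.init (x : List ℕ) : State where
  reg _ := 0
  mem a i := if a = 0 then x.getD i 0 else 0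

/-- The word sequence `y` is found in array `1`, from cell `0` on. -/
def State.Outputs (σ : State) (y : List ℕ) : Prop :=
  ∀ i (h : i < y.length), σ.mem 1 i = y[i]

end LPKernel

/-!
# A polynomial kernel for Longest Path parameterized by a modulator to bounded treedepth

A path that avoids the modulator `S` has at most `H = 2 ^ d - 1` vertices
(`LPKernel.IsModulator.length_lt`), because its vertices lie in a tree of height `d`. No treedepth
decomposition of `G - S` has to be computed: every depth-first search forest decomposes the graph
that it spans, and its root-to-vertex paths are paths of the graph, so it has height at most `H`
(`LPKernel.DfsInv.exists_forested`).

A path of `G` meets the subtree of a forest vertex `c` in segments. The ends of a segment are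
continued by vertices of `S` or by ancestors of `c`, or they are ends of the whole path; this gives
`k + H + 1` possible attachments for each end. In a forest of bounded height there are, up to
equivalence, boundedly many kinds of subtrees with two labels that record the vertices with a given
attachment: colour refinement that counts children only up to a constant distinguishes them, and
subtrees of the same colour contain the same segments (`LPKernel.Forested.IsSeg.transfer`). So the
largest size of a segment with given attachments, the score of the subtree, is a function of the
colour. It takes boundedly many values, and the program contains the table of this function, so that
no further search is necessary.

For each pair of attachments and each parent, `k + H` children of the best scores are marked. A path
meets the subtrees of at most `k + H` siblings, since it passes through `S` or a common ancestor
between two of them (`LPKernel.Forested.card_hits_le`). A segment in the subtree of an unmarked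
child can therefore be replaced by one that is not shorter in the subtree of a marked sibling that
the path does not meet (`LPKernel.Forested.exists_replacement`). Exchanges of this kind, from the
roots downwards, move any path into the set of vertices all of whose ancestors are marked
(`LPKernel.Forested.exists_kept_path`), and the kernel is the subgraph induced by these vertices and
`S`. All of its vertices serve as the modulator, and the length is lowered to the number of vertices
plus one if it is larger than the number of vertices.

A parent has at most `q = (k + H) (k + H + 1) (k + H + 2) / 2` marked children, and the kernel has
at most `k + q + ⋯ + q ^ H` vertices. If `k` is at least a constant that depends on `d`, then
`q ≤ (2 / 3) k ^ 3`, and the sum is at most `k ^ (3 ^ d)`, hence at most `g d k`, because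
`3 * H ≤ 3 ^ d` (`LPKernel.add_sum_markBound_le`). If `k` is smaller, all paths of `G` have bounded
length (`LPKernel.length_lt_of_avoiding`), the search runs on all of `G`, and the colours of the
roots decide the instance (`LPKernel.Forested.exists_path_iff`). The answer is then written as a
constant instance; the one for yes has two vertices, and a path with an edge exists only if
`2 ≤ g d k` (`LPKernel.Instance.Yes.two_le`).

For the running time, the graph has at most `(d + k) n` edges
(`LPKernel.IsModulator.sum_degree_le`), so reading, searching and writing take `O((k + 1) n)` steps.
For each of the `O((k + 1) ^ 2)` pairs of attachments, the labels, colours and scores are found in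
`O(n)` steps: adjacency to a given vertex is looked up in a matrix whose other cells are zero
initially, and the number of colours is constant. The programs are verified with Hoare-style rules
for the predicate `LPKernel.Runs`, which bounds the number of steps; the bounds are multiples of a
constant `LPKernel.Program.rate` of the program.
-/

namespace LPKernel

/-! ### Reasoning about programs -/

/-- The program assigns to the register `s`. -/
def Program.WritesReg : Program → ℕ → Prop
  | .skip, _ => False
  | .assign r _, s => s = r
  | .store _ _ _, _ => False
  | .seq p q, s => p.WritesReg s ∨ q.WritesReg s
  | .ite _ p q, s => p.WritesReg s ∨ q.WritesReg s
  | .loop _ p, s => p.WritesReg s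

/-- The program stores into the array `b`. -/
def Program.WritesMem : Program → ℕ → Prop
  | .skip, _ => False
  | .assign _ _, _ => False
  | .store a _ _, b => b = a
  | .seq p q, b => p.WritesMem b ∨ q.WritesMem b
  | .ite _ p q, b => p.WritesMem b ∨ q.WritesMem b
  | .loop _ p, b => p.WritesMem b

/-- The states agree on everything that the program does not write. -/
structure Frame (p : Program) (σ τ : State) : Prop where
  reg : ∀ r, ¬ p.WritesReg r → τ.reg r = σ.reg r
  mem : ∀ a, ¬ p.WritesMem a → τ.mem a = σ.mem a

theorem Frame.refl (p : Program) (σ : State) : Frame p σ σ := ⟨fun _ _ => rfl, fun _ _ => rfl⟩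

theorem Frame.trans {p : Program} {σ τ υ : State} (h : Frame p σ τ) (h' : Frame p τ υ) :
    Frame p σ υ :=
  ⟨fun r hr => (h'.reg r hr).trans (h.reg r hr), fun a ha => (h'.mem a ha).trans (h.mem a ha)⟩

theorem Frame.mono {p q : Program} {σ τ : State} (h : Frame p σ τ)
    (hr : ∀ r, p.WritesReg r → q.WritesReg r) (hm : ∀ a, p.WritesMem a → q.WritesMem a) :
    Frame q σ τ :=
  ⟨fun r h' => h.reg r (mt (hr r) h'), fun a h' => h.mem a (mt (hm a) h')⟩

@[simp] theorem State.setReg_mem (σ : State) (r x : ℕ) : (σ.setReg r x).mem = σ.mem := rfl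
@[simp] theorem State.setMem_reg (σ : State) (a i x : ℕ) : (σ.setMem a i x).reg = σ.reg := rfl
@[simp] theorem State.setReg_reg (σ : State) (r x s : ℕ) :
    (σ.setReg r x).reg s = if s = r then x else σ.reg s := by
  simp [State.setReg, Function.update_apply]
@[simp] theorem State.setMem_mem (σ : State) (a i x b : ℕ) :
    (σ.setMem a i x).mem b = if b = a then Function.update (σ.mem a) i x else σ.mem b := by
  simp [State.setMem, Function.update_apply]

theorem Exec.frame {w : ℕ} {p : Program} {σ τ : State} {t : ℕ} (h : Exec w p σ τ t) :
    Frame p σ τ := by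
  induction h with
  | skip σ => exact Frame.refl _ _
  | assign r e σ => exact ⟨fun s hs => by simp [if_neg (show ¬ s = r from hs)], fun _ _ => rfl⟩
  | store a i e σ => exact ⟨fun _ _ => rfl, fun b hb => by simp [if_neg (show ¬ b = a from hb)]⟩
  | seq _ _ h1 h2 =>
    exact (h1.mono (fun _ => Or.inl) (fun _ => Or.inl)).trans
      (h2.mono (fun _ => Or.inr) (fun _ => Or.inr))
  | ite_true _ _ h => exact h.mono (fun _ => Or.inl) (fun _ => Or.inl)
  | ite_false _ _ h => exact h.mono (fun _ => Or.inr) (fun _ => Or.inr)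
  | loop_true _ _ _ h1 h2 => exact Frame.trans ⟨h1.reg, h1.mem⟩ h2
  | loop_false _ => exact Frame.refl _ _

/-- Started in `σ`, the program halts after at most `T` steps in a state that satisfies `Q`. -/
def Runs (w : ℕ) (p : Program) (σ : State) (T : ℕ) (Q : State → Prop) : Prop :=
  ∃ τ t, Exec w p σ τ t ∧ t ≤ T ∧ Q τ

section Rules
variable {w : ℕ} {p q : Program} {σ : State} {T T' : ℕ} {Q R : State → Prop}

/-- The rule of consequence; the weakened postcondition may use what the program leaves unchanged. -/
theorem Runs.mono (h : Runs w p σ T Q) (hT : T ≤ T') (hQ : ∀ τ, Frame p σ τ → Q τ → R τ) :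
    Runs w p σ T' R := by
  obtain ⟨τ, t, h1, h2, h3⟩ := h
  exact ⟨τ, t, h1, h2.trans hT, hQ τ h1.frame h3⟩

theorem Runs.skip (h : Q σ) : Runs w .skip σ 1 Q := ⟨σ, 1, .skip σ, le_rfl, h⟩

theorem Runs.assign {r : ℕ} {e : Term} {v : ℕ} (he : e.eval w σ = v) (h : Q (σ.setReg r v)) :
    Runs w (.assign r e) σ (e.cost + 1) Q :=
  ⟨_, _, .assign r e σ, le_rfl, he ▸ h⟩

theorem Runs.store {a : ℕ} {i e : Term} {u v : ℕ} (hi : i.eval w σ = u) (he : e.eval w σ = v)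
    (h : Q (σ.setMem a u v)) : Runs w (.store a i e) σ (i.cost + e.cost + 1) Q :=
  ⟨_, _, .store a i e σ, le_rfl, hi ▸ he ▸ h⟩

theorem Runs.seq (hp : Runs w p σ T R) (hq : ∀ τ, Frame p σ τ → R τ → Runs w q τ T' Q) :
    Runs w (.seq p q) σ (T + T') Q := by
  obtain ⟨τ, t, h1, h2, h3⟩ := hp
  obtain ⟨υ, s, h4, h5, h6⟩ := hq τ h1.frame h3
  exact ⟨υ, t + s, .seq h1 h4, Nat.add_le_add h2 h5, h6⟩

theorem Runs.ite {e : Term} (h1 : e.eval w σ ≠ 0 → Runs w p σ T Q)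
    (h2 : e.eval w σ = 0 → Runs w q σ T Q) : Runs w (.ite e p q) σ (e.cost + 1 + T) Q := by
  by_cases h : e.eval w σ = 0
  · obtain ⟨τ, t, h3, h4, h5⟩ := h2 h
    exact ⟨τ, _, .ite_false h h3, by omega, h5⟩
  · obtain ⟨τ, t, h3, h4, h5⟩ := h1 h
    exact ⟨τ, _, .ite_true h h3, by omega, h5⟩

/-- A loop with a variant `f` that decreases in every round. -/
theorem Runs.loop {e : Term} (Inv : ℕ → State → Prop)
    (hbody : ∀ f τ, Frame (.loop e p) σ τ → Inv f τ → e.eval w τ ≠ 0 →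
      Runs w p τ T fun υ => ∃ f' < f, Inv f' υ) {f : ℕ} (h : Inv f σ) :
    Runs w (.loop e p) σ (f * (T + e.cost + 1) + (e.cost + 1))
      fun τ => (∃ f' ≤ f, Inv f' τ) ∧ e.eval w τ = 0 := by
  suffices H : ∀ f τ, Frame (.loop e p) σ τ → Inv f τ →
      Runs w (.loop e p) τ (f * (T + e.cost + 1) + (e.cost + 1))
        fun υ => (∃ f' ≤ f, Inv f' υ) ∧ e.eval w υ = 0 from H f σ (Frame.refl _ _) h
  clear h f
  intro f
  induction f using Nat.strong_induction_on with
  | _ f ih =>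
    intro τ hF hI
    by_cases h : e.eval w τ = 0
    · exact ⟨τ, _, .loop_false h, by omega, ⟨f, le_rfl, hI⟩, h⟩
    · obtain ⟨υ, t, h1, h2, f', hf', h3⟩ := hbody f τ hF hI h
      have hF' : Frame (.loop e p) σ υ := hF.trans (h1.frame.mono (fun _ h => h) (fun _ h => h))
      obtain ⟨ρ, s, h4, h5, ⟨f'', hf'', h6⟩, h7⟩ := ih f' hf' υ hF' h3
      refine ⟨ρ, _, .loop_true h h1 h4, ?_, ⟨f'', by omega, h6⟩, h7⟩
      have : (f' + 1) * (T + e.cost + 1) ≤ f * (T + e.cost + 1) := Nat.mul_le_mul_right _ hf'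
      rw [add_mul, one_mul] at this
      omega

end Rules

instance : Add Term := ⟨.op .add⟩
instance : Sub Term := ⟨.op .sub⟩
instance : Mul Term := ⟨.op .mul⟩

section Eval
variable {w : ℕ} {σ : State}

theorem Term.eval_const (c : ℕ) (h : c < 2 ^ w) : (Term.const c).eval w σ = c := Nat.mod_eq_of_lt h

@[simp] theorem Term.eval_reg (r : ℕ) : (Term.reg r).eval w σ = σ.reg r := rfl

@[simp] theorem Term.eval_cell (a : ℕ) (i : Term) :
    (Term.cell a i).eval w σ = σ.mem a (i.eval w σ) := rfl

theorem Term.eval_add (e f : Term) (h : e.eval w σ + f.eval w σ < 2 ^ w) :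
    (e + f).eval w σ = e.eval w σ + f.eval w σ := Nat.mod_eq_of_lt h

theorem Term.eval_sub (e f : Term) (h : e.eval w σ < 2 ^ w) :
    (e - f).eval w σ = e.eval w σ - f.eval w σ :=
  Nat.mod_eq_of_lt ((Nat.sub_le _ _).trans_lt h)

theorem Term.eval_mul (e f : Term) (h : e.eval w σ * f.eval w σ < 2 ^ w) :
    (e * f).eval w σ = e.eval w σ * f.eval w σ := Nat.mod_eq_of_lt h

theorem Term.eval_lt (e f : Term) (h : 1 < 2 ^ w) :
    (Term.op .lt e f).eval w σ = if e.eval w σ < f.eval w σ then 1 else 0 :=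
  Nat.mod_eq_of_lt (by simp only [Op.apply]; split <;> omega)

theorem Term.eval_eq (e f : Term) (h : 1 < 2 ^ w) :
    (Term.op .eq e f).eval w σ = if e.eval w σ = f.eval w σ then 1 else 0 :=
  Nat.mod_eq_of_lt (by simp only [Op.apply]; split <;> omega)

section
variable {e f : Term} {a b : ℕ}

theorem Term.const_eq {c : ℕ} (h : c < 2 ^ w) : (Term.const c).eval w σ = c := eval_const c h

theorem Term.cell_eq {i : Term} {j : ℕ} (m : ℕ) (h : i.eval w σ = j) :
    (Term.cell m i).eval w σ = σ.mem m j := by rw [eval_cell, h]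

theorem Term.add_eq (he : e.eval w σ = a) (hf : f.eval w σ = b) (h : a + b < 2 ^ w) :
    (e + f).eval w σ = a + b := by subst he hf; exact eval_add e f h

theorem Term.sub_eq (he : e.eval w σ = a) (hf : f.eval w σ = b) (h : a < 2 ^ w) :
    (e - f).eval w σ = a - b := by subst he hf; exact eval_sub e f h

theorem Term.mul_eq (he : e.eval w σ = a) (hf : f.eval w σ = b) (h : a * b < 2 ^ w) :
    (e * f).eval w σ = a * b := by subst he hf; exact eval_mul e f h

theorem Term.lt_eq (he : e.eval w σ = a) (hf : f.eval w σ = b) (h : 1 < 2 ^ w) :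
    (Term.op .lt e f).eval w σ = if a < b then 1 else 0 := by subst he hf; exact eval_lt e f h

theorem Term.eq_eq (he : e.eval w σ = a) (hf : f.eval w σ = b) (h : 1 < 2 ^ w) :
    (Term.op .eq e f).eval w σ = if a = b then 1 else 0 := by subst he hf; exact eval_eq e f h

end

/-- The sum of a list of expressions. -/
def Term.sum : List Term → Term
  | [] => .const 0
  | e :: l => e + Term.sum l

theorem Term.eval_sum (l : List Term) (h : (l.map (Term.eval w σ)).sum < 2 ^ w) :
    (Term.sum l).eval w σ = (l.map (Term.eval w σ)).sum := by
  induction l with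
  | nil => exact Term.eval_const 0 (by positivity)
  | cons e l ih =>
    rw [List.map_cons, List.sum_cons] at h ⊢
    rw [Term.sum, Term.eval_add _ _ (by rw [ih (by omega)]; exact h), ih (by omega)]

/-- The number with the given digits in base `b`, the least significant first. -/
def Term.ofDigits (b : ℕ) : List Term → Term
  | [] => .const 0
  | e :: l => e + .const b * Term.ofDigits b l

theorem Term.eval_ofDigits {b : ℕ} (hb : 1 < b) (hbw : b < 2 ^ w) (l : List Term)
    (h : b ^ l.length ≤ 2 ^ w) (hl : ∀ e ∈ l, e.eval w σ < b) :
    (Term.ofDigits b l).eval w σ = Nat.ofDigits b (l.map (Term.eval w σ)) := by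
  induction l with
  | nil => exact Term.eval_const 0 (by positivity)
  | cons e l ih =>
    have h0 : b ^ l.length ≤ 2 ^ w := (Nat.pow_le_pow_right (by omega) (by simp)).trans h
    have ih := ih h0 fun e he => hl e (List.mem_cons_of_mem _ he)
    have hlt : Nat.ofDigits b ((e :: l).map (Term.eval w σ)) < 2 ^ w := by
      refine (Nat.ofDigits_lt_base_pow_length hb ?_).trans_le ?_
      · intro x hx
        obtain ⟨e', he', rfl⟩ := List.mem_map.1 hx
        exact hl e' he'
      · rwa [List.length_map]
    rw [List.map_cons, Nat.ofDigits_cons] at hlt ⊢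
    have hm : (Term.const b * Term.ofDigits b l).eval w σ =
        b * Nat.ofDigits b (l.map (Term.eval w σ)) := by
      rw [Term.eval_mul _ _ (by rw [Term.eval_const b hbw, ih]; omega), Term.eval_const b hbw, ih]
    rw [Term.ofDigits, Term.eval_add _ _ (by rw [hm]; exact hlt), hm]

/-- The value at `e` of a function given by its finite table for arguments below `m`. -/
def Term.lookup (m : ℕ) (f : ℕ → ℕ) (e : Term) : Term :=
  Term.sum ((List.range m).map fun κ => .op .eq e (.const κ) * .const (f κ))

theorem Term.eval_lookup {m : ℕ} {f : ℕ → ℕ} {e : Term} (hm : m ≤ 2 ^ w)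
    (hf : ∀ κ < m, f κ < 2 ^ w) (hw : 1 < 2 ^ w) (he : e.eval w σ < m) :
    (Term.lookup m f e).eval w σ = f (e.eval w σ) := by
  have h1 : ((List.range m).map fun κ => Term.op .eq e (.const κ) * Term.const (f κ)).map
      (Term.eval w σ) = (List.range m).map fun κ => if e.eval w σ = κ then f κ else 0 := by
    rw [List.map_map]
    refine List.map_congr_left fun κ hκ => ?_
    have hκ := List.mem_range.1 hκ
    have h2 : (Term.op .eq e (.const κ)).eval w σ = if e.eval w σ = κ then 1 else 0 := by
      rw [Term.eval_eq _ _ hw, Term.eval_const κ (by omega)]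
    have h3 := Term.eval_const (σ := σ) (f κ) (hf κ hκ)
    have := hf κ hκ
    rw [Function.comp_apply, Term.eval_mul, h2, h3]
    · split <;> simp
    · rw [h2, h3]; split <;> omega
  have h2 : ((List.range m).map fun κ => if e.eval w σ = κ then f κ else 0).sum =
      f (e.eval w σ) := by
    rw [← List.sum_toFinset _ List.nodup_range, List.toFinset_range]
    rw [Finset.sum_ite_eq, if_pos (Finset.mem_range.2 he)]
  rw [Term.lookup, Term.eval_sum _ (by rw [h1, h2]; exact hf _ he), h1, h2]

end Eval

/-- Execute the body for the values `0, …, m - 1` of the register `r`, where `m` is the value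
of `bound`. -/
def Program.forLoop (r : ℕ) (bound : Term) (body : Program) : Program :=
  .seq (.assign r (.const 0))
    (.loop (.op .lt (.reg r) bound) (.seq body (.assign r (.reg r + .const 1))))

/-- The programs of a list, one after the other. -/
def Program.seqs : List Program → Program
  | [] => .skip
  | p :: l => .seq p (Program.seqs l)

@[simp] theorem Program.writesReg_forLoop {r : ℕ} {bound : Term} {body : Program} {s : ℕ} :
    (Program.forLoop r bound body).WritesReg s ↔ s = r ∨ body.WritesReg s := by
  simp only [Program.forLoop, Program.WritesReg]; tauto

@[simp] theorem Program.writesMem_forLoop {r : ℕ} {bound : Term} {body : Program} {b : ℕ} :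
    (Program.forLoop r bound body).WritesMem b ↔ body.WritesMem b := by
  simp only [Program.forLoop, Program.WritesMem]; tauto

@[simp] theorem Program.writesReg_seqs {l : List Program} {s : ℕ} :
    (Program.seqs l).WritesReg s ↔ ∃ p ∈ l, p.WritesReg s := by
  induction l with
  | nil => simp [Program.seqs, Program.WritesReg]
  | cons p l ih => simp [Program.seqs, Program.WritesReg, ih]

@[simp] theorem Program.writesMem_seqs {l : List Program} {b : ℕ} :
    (Program.seqs l).WritesMem b ↔ ∃ p ∈ l, p.WritesMem b := by
  induction l with
  | nil => simp [Program.seqs, Program.WritesMem]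
  | cons p l ih => simp [Program.seqs, Program.WritesMem, ih]

/-- The rule for `forLoop`, with an invariant that depends on the number of completed rounds. -/
theorem Runs.forLoop {w : ℕ} {r : ℕ} {bound : Term} {body : Program} {σ : State} {m : ℕ}
    (T : ℕ → ℕ) (Inv : ℕ → State → Prop) (hm : m < 2 ^ w) (hw : 1 < 2 ^ w)
    (hr : ¬ body.WritesReg r) (h0 : Inv 0 σ)
    (hset : ∀ i τ x, Inv i τ → Inv i (τ.setReg r x))
    (hb : ∀ τ, Frame (.forLoop r bound body) σ τ → bound.eval w τ = m)
    (hbody : ∀ i < m, ∀ τ, Frame (.forLoop r bound body) σ τ → τ.reg r = i → Inv i τ →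
      Runs w body τ (T i) (Inv (i + 1))) :
    Runs w (.forLoop r bound body) σ
      (∑ i ∈ Finset.range m, (T i + bound.cost + 7) + bound.cost + 5) (Inv m) := by
  have hframe : ∀ τ x, Frame (.forLoop r bound body) τ (τ.setReg r x) := fun τ x =>
    ⟨fun s hs => by
      rw [Program.writesReg_forLoop, not_or] at hs
      simp [hs.1], fun _ _ => rfl⟩
  have hone : ∀ τ : State, (Term.const 1).eval w τ = 1 := fun τ => Term.eval_const 1 hw
  suffices H : ∀ j i τ, i + j = m → Frame (.forLoop r bound body) σ τ → τ.reg r = i → Inv i τ →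
      Runs w (.loop (.op .lt (.reg r) bound) (.seq body (.assign r (.reg r + .const 1)))) τ
        (∑ i ∈ Finset.Ico i m, (T i + bound.cost + 7) + bound.cost + 3) (Inv m) by
    have h1 : Runs w (.assign r (.const 0)) σ 2 fun τ => τ = σ.setReg r 0 :=
      Runs.assign (Term.eval_const 0 (by omega)) rfl
    refine (h1.seq (T' := ∑ i ∈ Finset.range m, (T i + bound.cost + 7) + bound.cost + 3)
      fun τ _ hτ => ?_).mono (by omega) fun _ _ h => h
    subst hτ
    rw [Finset.range_eq_Ico]
    exact H m 0 _ (zero_add m) (hframe σ 0) (by simp) (hset _ _ _ h0)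
  intro j
  induction j with
  | zero =>
    intro i τ hij hF hri hI
    obtain rfl : i = m := hij
    refine ⟨τ, _, .loop_false ?_, ?_, hI⟩
    · rw [Term.eval_lt _ _ hw, hb τ hF, Term.eval_reg, hri, if_neg (lt_irrefl _)]
    · simp only [Term.cost]; omega
  | succ j ih =>
    intro i τ hij hF hri hI
    have him : i < m := by omega
    obtain ⟨υ, t, h1, h2, h3⟩ := hbody i him τ hF hri hI
    have hυr : υ.reg r = i := (h1.frame.reg r hr).trans hri
    have hFυ : Frame (.forLoop r bound body) σ υ := hF.trans
      (h1.frame.mono (fun _ h => Program.writesReg_forLoop.2 (Or.inr h))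
        fun _ h => Program.writesMem_forLoop.2 h)
    have hev : (Term.reg r + Term.const 1).eval w υ = i + 1 := by
      have : (Term.reg r).eval w υ + (Term.const 1).eval w υ = i + 1 := by
        rw [hone, Term.eval_reg, hυr]
      rw [Term.eval_add _ _ (by omega), this]
    have h4 := Exec.assign (w := w) r (.reg r + .const 1) υ
    rw [hev] at h4
    obtain ⟨ρ, s, h5, h6, h7⟩ := ih (i + 1) (υ.setReg r (i + 1)) (by omega)
      (hFυ.trans (hframe _ _)) (by simp) (hset _ _ _ h3)
    refine ⟨ρ, _, .loop_true ?_ (.seq h1 h4) h5, ?_, h7⟩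
    · rw [Term.eval_lt _ _ hw, hb τ hF, Term.eval_reg, hri, if_pos him]
      exact one_ne_zero
    · rw [Finset.sum_eq_sum_Ico_succ_bot him]
      simp only [Term.cost]
      omega

/-- The number of steps of a program if each of its loops runs once; the actual number of steps is
proportional to it for programs without nested loops. -/
def Program.rate : Program → ℕ
  | .skip => 1
  | .assign _ e => e.cost + 1
  | .store _ i e => i.cost + e.cost + 1
  | .seq p q => p.rate + q.rate
  | .ite e p q => e.cost + 1 + (p.rate + q.rate)
  | .loop e p => p.rate + e.cost + 1

/-- The rule for `forLoop` with a uniform bound for the rounds. -/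
theorem Runs.forLoop_const {w : ℕ} {r : ℕ} {bound : Term} {body : Program} {σ : State} {m : ℕ}
    {c N : ℕ} (hN : m + 1 ≤ N) (Inv : ℕ → State → Prop) (hm : m < 2 ^ w)
    (hw : 1 < 2 ^ w) (hr : ¬ body.WritesReg r) (h0 : Inv 0 σ)
    (hset : ∀ i τ x, Inv i τ → Inv i (τ.setReg r x))
    (hb : ∀ τ, Frame (.forLoop r bound body) σ τ → bound.eval w τ = m)
    (hbody : ∀ i < m, ∀ τ, Frame (.forLoop r bound body) σ τ → τ.reg r = i → Inv i τ →
      Runs w body τ (body.rate * c) (Inv (i + 1))) (hc : 1 ≤ c) :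
    Runs w (.forLoop r bound body) σ ((Program.forLoop r bound body).rate * (c * N)) (Inv m) := by
  refine (Runs.forLoop (fun _ => body.rate * c) Inv hm hw hr h0 hset hb hbody).mono ?_
    fun _ _ h => h
  rw [Finset.sum_const, Finset.card_range, smul_eq_mul]
  have h1 : (Program.forLoop r bound body).rate = body.rate + bound.cost + 9 := by
    simp only [Program.forLoop, Program.rate, Term.cost]
    omega
  rw [h1]
  have h2 : bound.cost + 7 ≤ (bound.cost + 9) * c :=
    le_trans (by omega) (Nat.le_mul_of_pos_right _ hc)
  calc _ ≤ (m + 1) * (body.rate * c + bound.cost + 7) := by rw [add_one_mul]; omega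
    _ ≤ N * ((body.rate + bound.cost + 9) * c) := by
        refine Nat.mul_le_mul hN ?_
        rw [add_assoc body.rate, add_mul]; omega
    _ = _ := by ring

/-- The rule for `forLoop` with a straight-line body. -/
theorem Runs.forLoop_rate {w : ℕ} {r : ℕ} {bound : Term} {body : Program} {σ : State} {m : ℕ}
    {N : ℕ} (hN : m + 1 ≤ N) (Inv : ℕ → State → Prop) (hm : m < 2 ^ w)
    (hw : 1 < 2 ^ w) (hr : ¬ body.WritesReg r) (h0 : Inv 0 σ)
    (hset : ∀ i τ x, Inv i τ → Inv i (τ.setReg r x))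
    (hb : ∀ τ, Frame (.forLoop r bound body) σ τ → bound.eval w τ = m)
    (hbody : ∀ i < m, ∀ τ, Frame (.forLoop r bound body) σ τ → τ.reg r = i → Inv i τ →
      Runs w body τ body.rate (Inv (i + 1))) :
    Runs w (.forLoop r bound body) σ ((Program.forLoop r bound body).rate * N) (Inv m) := by
  have := Runs.forLoop_const (c := 1) hN Inv hm hw hr h0 hset hb
    (by simpa only [mul_one] using hbody) le_rfl
  rwa [one_mul] at this

/-- Running times that are multiples of `Program.rate` by a common factor compose. -/
theorem Runs.seq_rate {w : ℕ} {p q : Program} {σ : State} {N : ℕ} {Q R : State → Prop}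
    (hp : Runs w p σ (p.rate * N) R)
    (hq : ∀ τ, Frame p σ τ → R τ → Runs w q τ (q.rate * N) Q) :
    Runs w (.seq p q) σ ((Program.seq p q).rate * N) Q := by
  rw [Program.rate, add_mul]; exact hp.seq hq

theorem Runs.ite_rate {w : ℕ} {p q : Program} {σ : State} {N : ℕ} {Q : State → Prop} {e : Term}
    (hN : 1 ≤ N) (h1 : e.eval w σ ≠ 0 → Runs w p σ (p.rate * N) Q)
    (h2 : e.eval w σ = 0 → Runs w q σ (q.rate * N) Q) :
    Runs w (.ite e p q) σ ((Program.ite e p q).rate * N) Q := by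
  refine (Runs.ite (T := (p.rate + q.rate) * N) (fun h => (h1 h).mono ?_ fun _ _ h => h)
    (fun h => (h2 h).mono ?_ fun _ _ h => h)).mono ?_ fun _ _ h => h
  · exact Nat.mul_le_mul_right _ (by omega)
  · exact Nat.mul_le_mul_right _ (by omega)
  · rw [Program.rate, add_mul (e.cost + 1)]
    have := Nat.le_mul_of_pos_right (e.cost + 1) hN
    omega

theorem Runs.rate_mul {w : ℕ} {p : Program} {σ : State} {N : ℕ} {Q : State → Prop} (hN : 1 ≤ N)
    (hp : Runs w p σ p.rate Q) : Runs w p σ (p.rate * N) Q :=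
  hp.mono (Nat.le_mul_of_pos_right _ hN) fun _ _ h => h

/-- The rule for `seqs`, with an invariant that depends on the number of completed programs. -/
theorem Runs.seqs {w : ℕ} {f : ℕ → Program} {N : ℕ} (hN : 1 ≤ N) (Inv : ℕ → State → Prop) (m : ℕ)
    {σ : State} (h0 : Inv 0 σ)
    (hstep : ∀ i < m, ∀ τ, Frame (.seqs ((List.range m).map f)) σ τ → Inv i τ →
      Runs w (f i) τ ((f i).rate * N) (Inv (i + 1))) :
    Runs w (.seqs ((List.range m).map f)) σ
      ((Program.seqs ((List.range m).map f)).rate * N) (Inv m) := by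
  suffices H : ∀ j i τ, i + j = m → Frame (.seqs ((List.range m).map f)) σ τ → Inv i τ →
      Runs w (.seqs ((List.range' i j).map f)) τ
        ((Program.seqs ((List.range' i j).map f)).rate * N) (Inv m) by
    have := H m 0 σ (zero_add m) (Frame.refl _ _) h0
    rwa [← List.range_eq_range'] at this
  intro j
  induction j with
  | zero =>
    intro i τ hij _ hI
    obtain rfl : i = m := hij
    exact Runs.rate_mul hN (Runs.skip hI)
  | succ j ih =>
    intro i τ hij hF hI
    rw [List.range'_succ, List.map_cons, Program.seqs]
    refine (hstep i (by omega) τ hF hI).seq_rate fun υ hυ hI' => ih (i + 1) υ (by omega) ?_ hI'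
    have hmem : f i ∈ (List.range m).map f := List.mem_map_of_mem (List.mem_range.2 (by omega))
    exact hF.trans (hυ.mono (fun _ h => Program.writesReg_seqs.2 ⟨_, hmem, h⟩)
      fun _ h => Program.writesMem_seqs.2 ⟨_, hmem, h⟩)

end LPKernel

namespace LPKernel

/-! ### Paths and edges of graphs of bounded treedepth -/

namespace RootedForest
variable {V : Type} (F : RootedForest V)

theorem ancestor_irrefl (x : V) : ¬ F.Ancestor x x :=
  F.wf.transGen.irrefl.irrefl x

/-- The ancestors of a vertex form a chain. -/
theorem ancestor_total {x y z : V} (hx : F.Ancestor x z) (hy : F.Ancestor y z) :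
    x = y ∨ F.Ancestor x y ∨ F.Ancestor y x := by
  have step : ∀ {p v y : V}, F.parent v = some p → F.Ancestor y v →
      y = p ∨ F.Ancestor y p := by
    intro p v y hp hy
    rcases Relation.TransGen.tail'_iff.1 hy with ⟨q, hq, hqv⟩
    obtain rfl : q = p := Option.some_inj.1 (hqv.symm.trans hp)
    rcases Relation.reflTransGen_iff_eq_or_transGen.1 hq with h | h
    · exact Or.inl h.symm
    · exact Or.inr h
  induction hx generalizing y with
  | single h =>
    rcases step h hy with h' | h'
    · exact Or.inl h'.symm
    · exact Or.inr (Or.inr h')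
  | tail _ h ih =>
    rcases step h hy with h' | h'
    · subst h'; exact Or.inr (Or.inl (by assumption))
    · exact ih h'

theorem depth_pos [Finite V] (v : V) : 1 ≤ F.depth v :=
  (Set.ncard_pos (Set.toFinite _)).2 ⟨v, Or.inl rfl⟩

theorem depth_lt [Finite V] {x y : V} (h : F.Ancestor x y) : F.depth x < F.depth y := by
  refine Set.ncard_lt_ncard ⟨?_, fun hsub => ?_⟩ (Set.toFinite _)
  · rintro u (rfl | hu)
    · exact Or.inr h
    · exact Or.inr (hu.trans h)
  · rcases hsub (Or.inl rfl : y ∈ {u | u = y ∨ F.Ancestor u y}) with rfl | h'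
    · exact F.ancestor_irrefl _ h
    · exact F.ancestor_irrefl _ (h.trans h')

/-- A path has a vertex that is an ancestor of all others. -/
theorem exists_root : ∀ L : List V, L ≠ [] →
    L.IsChain (fun x y => F.Ancestor x y ∨ F.Ancestor y x) →
    ∃ r ∈ L, ∀ v ∈ L, v = r ∨ F.Ancestor r v := by
  intro L
  induction L with
  | nil => simp
  | cons a L ih =>
    intro _ hL
    cases L with
    | nil => exact ⟨a, by simp, by simp⟩
    | cons b L =>
      obtain ⟨r, hr, hrL⟩ := ih (by simp) hL.tail
      have hab := hL.rel_head? (y := b) rfl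
      by_cases hra : a = r ∨ F.Ancestor r a
      · refine ⟨r, List.mem_cons_of_mem _ hr, fun v hv => ?_⟩
        rcases List.mem_cons.1 hv with rfl | hv
        · exact hra
        · exact hrL v hv
      · push Not at hra
        have har : F.Ancestor a r := by
          rcases hrL b (by simp) with rfl | h
          · rcases hab with h | h
            · exact h
            · exact absurd h hra.2
          · rcases hab with h' | h'
            · rcases F.ancestor_total h h' with h'' | h'' | h''
              · exact absurd h''.symm hra.1
              · exact absurd h'' hra.2
              · exact h''
            · exact absurd (h.trans h') hra.2
        refine ⟨a, by simp, fun v hv => ?_⟩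
        rcases List.mem_cons.1 hv with rfl | hv
        · exact Or.inl rfl
        · rcases hrL v hv with rfl | h
          · exact Or.inr har
          · exact Or.inr (har.trans h)

/-- A path in the closure of a forest of height `D` has fewer than `2 ^ D` vertices. For vertices of
depth above `D - e` there is a bound `2 ^ e`, by induction on `e`: a connected set of vertices has a
root, which is an ancestor of all others, and splits the path into two parts of larger depth. -/
theorem length_lt [Finite V] {D : ℕ} (hD : ∀ v, F.depth v ≤ D) (e : ℕ) : ∀ L : List V, L.Nodup →
    L.IsChain (fun x y => F.Ancestor x y ∨ F.Ancestor y x) → (∀ v ∈ L, D + 1 ≤ F.depth v + e) →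
    L.length < 2 ^ e := by
  induction e with
  | zero =>
    intro L _ _ h
    cases L with
    | nil => simp
    | cons a L => have := h a (by simp); have := hD a; omega
  | succ e ih =>
    intro L hnd hL h
    by_cases hne : L = []
    · subst hne; simp
    obtain ⟨r, hr, hrL⟩ := F.exists_root L hne hL
    obtain ⟨L₁, L₂, rfl⟩ := List.append_of_mem hr
    have hrn : r ∉ L₁ ∧ r ∉ L₂ := by
      have := List.nodup_middle.1 hnd
      rw [List.nodup_cons, List.mem_append] at this
      exact not_or.1 this.1
    have hd : ∀ v ∈ L₁ ++ r :: L₂, v ≠ r → D + 1 ≤ F.depth v + e := by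
      intro v hv hvr
      have h1 := F.depth_lt ((hrL v hv).resolve_left hvr)
      have h2 := h r hr
      omega
    have h1 := ih L₁ (List.nodup_append.1 hnd).1 hL.left_of_append
      fun v hv => hd v (by simp [hv]) (by rintro rfl; exact hrn.1 hv)
    have h2 := ih L₂ (List.nodup_cons.1 (List.nodup_append.1 hnd).2.1).2
      hL.right_of_append.tail fun v hv => hd v (by simp [hv]) (by rintro rfl; exact hrn.2 hv)
    rw [List.length_append, List.length_cons, pow_succ]
    omega

/-- The forest that consists of a single path through all vertices. -/
noncomputable def path {m : ℕ} (e : V ≃ Fin m) : RootedForest V where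
  parent v := if (e v).val = 0 then none else some (e.symm ⟨(e v).val - 1, by omega⟩)
  wf := Subrelation.wf (r := InvImage (· < ·) fun v => (e v).val) (by
    intro p v h
    split at h
    · simp at h
    · obtain rfl := Option.some_inj.1 h
      simp only [InvImage, Equiv.apply_symm_apply]; omega) (InvImage.wf _ Nat.lt_wfRel.wf)

theorem path_ancestor {m : ℕ} (e : V ≃ Fin m) {x y : V} (h : (e x).val < (e y).val) :
    (path e).Ancestor x y := by
  obtain ⟨j, hj⟩ := Nat.exists_eq_add_of_lt h
  induction j generalizing y with
  | zero =>
    refine Relation.TransGen.single ?_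
    simp only [path]
    rw [if_neg (by omega), Option.some_inj, Equiv.symm_apply_eq]
    ext; simp only; omega
  | succ j ih =>
    have hy := (e y).isLt
    refine Relation.TransGen.tail (b := e.symm ⟨(e y).val - 1, by omega⟩) (ih ?_ ?_) ?_
    · rw [Equiv.apply_symm_apply]; simp only; omega
    · rw [Equiv.apply_symm_apply]; simp only; omega
    · simp only [path]
      rw [if_neg (by omega)]

end RootedForest

/-- The treedepth of a finite graph is attained, since a linear order of the vertices is a
decomposition. -/
theorem exists_decomposition {V : Type} [Finite V] (G : SimpleGraph V) :
    ∃ F : RootedForest V, F.Decomposes G ∧ ∀ v, F.depth v ≤ treedepth G := by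
  refine Nat.sInf_mem (s := {h | ∃ F : RootedForest V, F.Decomposes G ∧ ∀ v, F.depth v ≤ h}) ?_
  refine ⟨Nat.card V, RootedForest.path (Finite.equivFin V), fun x y hxy => ?_, fun v => ?_⟩
  · rcases lt_trichotomy (Finite.equivFin V x).val (Finite.equivFin V y).val with h | h | h
    · exact Or.inl (RootedForest.path_ancestor _ h)
    · exact absurd ((Finite.equivFin V).injective (Fin.ext h)) hxy.ne
    · exact Or.inr (RootedForest.path_ancestor _ h)
  · exact Set.ncard_le_card _

theorem IsModulator.exists_forest {n d : ℕ} {G : SimpleGraph (Fin n)} {S : Finset (Fin n)}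
    (h : IsModulator G S d) : ∃ F : RootedForest {v : Fin n | v ∉ S},
      F.Decomposes (G.induce {v | v ∉ S}) ∧ ∀ v, F.depth v ≤ d := by
  obtain ⟨F, h1, h2⟩ := exists_decomposition (G.induce {v | v ∉ S})
  exact ⟨F, h1, fun v => (h2 v).trans h⟩

/-- Paths that avoid a modulator to treedepth `d` have fewer than `2 ^ d` vertices. -/
theorem IsModulator.length_lt {n d : ℕ} {G : SimpleGraph (Fin n)} {S : Finset (Fin n)}
    (h : IsModulator G S d) {L : List (Fin n)} (hnd : L.Nodup) (hL : L.IsChain G.Adj)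
    (hS : ∀ v ∈ L, v ∉ S) : L.length < 2 ^ d := by
  obtain ⟨F, h1, h2⟩ := h.exists_forest
  have h3 := F.length_lt h2 d (L.attachWith (fun v => v ∈ {v : Fin n | v ∉ S}) hS)
    (List.Nodup.of_map Subtype.val (by rwa [List.attachWith_map_subtype_val]))
    (by
      have : ((L.attachWith (fun v => v ∈ {v : Fin n | v ∉ S}) hS).map Subtype.val).IsChain G.Adj := by
        rwa [List.attachWith_map_subtype_val]
      rw [List.isChain_map] at this
      exact this.imp fun x y hxy => h1 x y hxy)
    (fun v _ => by have := F.depth_pos v; omega)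
  rwa [List.length_attachWith] at h3

/-- If paths that avoid a finite set have bounded length, so have all paths. -/
theorem length_lt_of_avoiding {α : Type} {R : α → α → Prop} {B : ℕ} (A : Finset α) :
    ∀ C : Set α, (∀ L : List α, L.Nodup → L.IsChain R → (∀ v ∈ L, v ∉ C ∧ v ∉ A) → L.length < B) →
      ∀ L : List α, L.Nodup → L.IsChain R → (∀ v ∈ L, v ∉ C) → L.length < B * 2 ^ A.card := by
  classical
  induction A using Finset.induction_on with
  | empty => intro C h L h1 h2 h3; simpa using h L h1 h2 (fun v hv => ⟨h3 v hv, by simp⟩)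
  | insert a A ha ih =>
    intro C h L hnd hL hC
    have key := ih (insert a C) (fun L h1 h2 h3 => h L h1 h2 fun v hv => by
      have := h3 v hv
      rw [Set.mem_insert_iff, not_or] at this
      exact ⟨this.1.2, by rw [Finset.mem_insert, not_or]; exact ⟨this.1.1, this.2⟩⟩)
    rw [Finset.card_insert_of_notMem ha, pow_succ, ← mul_assoc]
    by_cases haL : a ∈ L
    · obtain ⟨L₁, L₂, rfl⟩ := List.append_of_mem haL
      have hrn : a ∉ L₁ ∧ a ∉ L₂ := by
        have := List.nodup_middle.1 hnd
        rw [List.nodup_cons, List.mem_append] at this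
        exact not_or.1 this.1
      have h1 := key L₁ (List.nodup_append.1 hnd).1 hL.left_of_append fun v hv => by
        rw [Set.mem_insert_iff, not_or]
        exact ⟨by rintro rfl; exact hrn.1 hv, hC v (by simp [hv])⟩
      have h2 := key L₂ (List.nodup_cons.1 (List.nodup_append.1 hnd).2.1).2
        hL.right_of_append.tail fun v hv => by
          rw [Set.mem_insert_iff, not_or]
          exact ⟨by rintro rfl; exact hrn.2 hv, hC v (by simp [hv])⟩
      rw [List.length_append, List.length_cons]
      omega
    · have := key L hnd hL fun v hv => by
        rw [Set.mem_insert_iff, not_or]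
        exact ⟨by rintro rfl; exact haL hv, hC v hv⟩
      omega

open Classical in
/-- A graph with a modulator of size `k` to treedepth `d` has at most `(d + k) * n` edges. -/
theorem IsModulator.sum_degree_le {n d : ℕ} {G : SimpleGraph (Fin n)} {S : Finset (Fin n)}
    (h : IsModulator G S d) :
    ∑ u, (Finset.univ.filter (G.Adj u)).card ≤ 2 * (d + S.card) * n := by
  obtain ⟨F, h1, h2⟩ := h.exists_forest
  let anc : Fin n → Finset (Fin n) := fun v =>
    Finset.univ.filter fun u => ∃ (hu : u ∉ S) (hv : v ∉ S), F.Ancestor ⟨u, hu⟩ ⟨v, hv⟩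
  have hanc : ∀ v, (anc v).card ≤ d := by
    intro v
    by_cases hv : v ∉ S
    · refine le_trans ?_ (h2 ⟨v, hv⟩)
      unfold RootedForest.depth
      rw [← Set.ncard_coe_finset, ← Set.ncard_image_of_injective _ Subtype.val_injective]
      refine Set.ncard_le_ncard ?_ (Set.toFinite _)
      intro u hu
      obtain ⟨hu, hv', h⟩ := (Finset.mem_filter.1 (Finset.mem_coe.1 hu)).2
      exact ⟨⟨u, hu⟩, Or.inr h, rfl⟩
    · have : anc v = ∅ := Finset.filter_eq_empty_iff.2 fun u _ ⟨_, hv', _⟩ => hv hv'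
      rw [this]; simp
  have hsplit : ∀ u, (Finset.univ.filter (G.Adj u)).card ≤
      (S.card + (if u ∈ S then n else 0)) + ((anc u).card +
        (Finset.univ.filter fun v => u ∈ anc v).card) := by
    intro u
    have hsub : Finset.univ.filter (G.Adj u) ⊆ (S ∪ (if u ∈ S then Finset.univ else ∅)) ∪
        (anc u ∪ Finset.univ.filter fun v => u ∈ anc v) := by
      intro v hv
      have hadj := (Finset.mem_filter.1 hv).2
      simp only [Finset.mem_union, Finset.mem_filter, Finset.mem_univ, true_and]
      by_cases hvS : v ∈ S
      · exact Or.inl (Or.inl hvS)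
      by_cases huS : u ∈ S
      · left; right; rw [if_pos huS]; exact Finset.mem_univ _
      rcases h1 ⟨u, huS⟩ ⟨v, hvS⟩ hadj with h | h
      · exact Or.inr (Or.inr (Finset.mem_filter.2 ⟨Finset.mem_univ _, huS, hvS, h⟩))
      · exact Or.inr (Or.inl (Finset.mem_filter.2 ⟨Finset.mem_univ _, hvS, huS, h⟩))
    refine (Finset.card_le_card hsub).trans ((Finset.card_union_le _ _).trans
      (Nat.add_le_add ((Finset.card_union_le _ _).trans (Nat.add_le_add_left ?_ _))
        (Finset.card_union_le _ _)))
    split <;> simp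
  refine (Finset.sum_le_sum fun u _ => hsplit u).trans ?_
  rw [Finset.sum_add_distrib, Finset.sum_add_distrib, Finset.sum_add_distrib, Finset.sum_ite_mem]
  have e1 : ∑ u : Fin n, (anc u).card ≤ n * d := by
    simpa using Finset.sum_le_card_nsmul Finset.univ (fun u => (anc u).card) d fun u _ => hanc u
  have e2 : ∑ u : Fin n, (Finset.univ.filter fun v => u ∈ anc v).card = ∑ v, (anc v).card := by
    simp only [Finset.card_filter]
    rw [Finset.sum_comm]
    refine Finset.sum_congr rfl fun v _ => ?_
    rw [← Finset.card_filter]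
    congr 1; ext u; simp
  rw [e2]
  simp only [Finset.sum_const, Finset.card_univ, Fintype.card_fin, smul_eq_mul, Finset.univ_inter]
  nlinarith

/-- Paths as vertex sequences. -/
theorem Instance.yes_iff {d : ℕ} (I : Instance d) :
    I.Yes ↔ ∃ L : List (Fin I.n), L.Nodup ∧ L.IsChain I.G.Adj ∧ I.ℓ + 1 ≤ L.length := by
  constructor
  · rintro ⟨u, v, p, hp, hl⟩
    exact ⟨p.support, hp.support_nodup, p.isChain_adj_support, by
      rw [SimpleGraph.Walk.length_support]; omega⟩
  · rintro ⟨L, h1, h2, h3⟩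
    have hne : L ≠ [] := by rintro rfl; simp at h3
    refine ⟨_, _, SimpleGraph.Walk.ofSupport L hne h2, ?_, ?_⟩
    · rw [SimpleGraph.Walk.isPath_def, SimpleGraph.Walk.support_ofSupport]; exact h1
    · have := SimpleGraph.Walk.length_support (SimpleGraph.Walk.ofSupport L hne h2)
      rw [SimpleGraph.Walk.support_ofSupport] at this
      omega

end LPKernel

namespace LPKernel

/-! ### Forests of bounded height and colour refinement -/

/-- A graph on the vertices `0, …, n - 1`, with a rooted forest of height at most `H` on the set `W`
of its vertices that is a treedepth decomposition of the subgraph induced by `W`. The forest is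
given by the parent map `par`: the parent of a root is the sentinel `n`, and the vertices outside of
`W` are their own parents. `dep u` is the number of vertices on the path from the root to `u`. -/
structure Forested (H : ℕ) where
  n : ℕ
  Adj : ℕ → ℕ → Prop
  W : ℕ → Prop
  par : ℕ → ℕ
  dep : ℕ → ℕ
  symm : ∀ {u v}, Adj u v → Adj v u
  irrefl : ∀ u, ¬ Adj u u
  adj_lt : ∀ {u v}, Adj u v → u < n
  W_lt : ∀ {u}, W u → u < n
  par_top : par n = n
  par_W : ∀ {u}, W u → W (par u) ∨ par u = n
  par_of_not : ∀ {u}, u < n → ¬ W u → par u = u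
  dep_top : dep n = 0
  dep_W : ∀ {u}, W u → dep u = dep (par u) + 1
  dep_le : ∀ {u}, W u → dep u ≤ H
  comp : ∀ {u v}, W u → W v → Adj u v → (∃ r, par^[r] u = v) ∨ ∃ r, par^[r] v = u

open Classical in
/-- The truth value of a proposition, as a number. -/
noncomputable def bit (p : Prop) : ℕ := if p then 1 else 0

theorem bit_le_one (p : Prop) : bit p ≤ 1 := by
  unfold bit; split <;> simp

theorem bit_eq_one {p : Prop} : bit p = 1 ↔ p := by
  unfold bit; split <;> simp_all

theorem bit_inj {p q : Prop} (h : bit p = bit q) : p ↔ q := by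
  rw [← bit_eq_one (p := p), h, bit_eq_one]

/-- The threshold up to which colour refinement counts children. -/
def cap (H : ℕ) : ℕ := H * H + 1

/-- The number of colours after `h` rounds of colour refinement. -/
def numColors (H : ℕ) : ℕ → ℕ
  | 0 => 1
  | h + 1 => (cap H + 1) ^ (H + 2 + numColors H h)

namespace Forested

variable {H : ℕ} (F : Forested H)

/-- The adjacencies of `u` to its ancestors, followed by two further labels. -/
noncomputable def label (lx ly : ℕ → ℕ) (u : ℕ) : List ℕ :=
  (List.range H).map (fun j => bit (F.Adj u (F.par^[j + 1] u))) ++ [lx u, ly u]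

/-- The colour of `u` after `h` rounds of colour refinement: in each round, a vertex sees its label
and, for each colour, the number of its children of that colour up to the threshold `cap H`. -/
noncomputable def color (lx ly : ℕ → ℕ) : ℕ → ℕ → ℕ
  | 0, _ => 0
  | h + 1, u => Nat.ofDigits (cap H + 1) (F.label lx ly u ++ (List.range (numColors H h)).map
      fun κ => min ((Finset.range F.n).filter fun c => F.par c = u ∧ color lx ly h c = κ).card
        (cap H))

theorem length_label (lx ly : ℕ → ℕ) (u : ℕ) : (F.label lx ly u).length = H + 2 := by
  simp [label]

/-- The digits of which a colour is composed. -/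
noncomputable def digits (lx ly : ℕ → ℕ) (h u : ℕ) : List ℕ :=
  F.label lx ly u ++ (List.range (numColors H h)).map
    fun κ => min ((Finset.range F.n).filter fun c => F.par c = u ∧ F.color lx ly h c = κ).card (cap H)

theorem color_succ (lx ly : ℕ → ℕ) (h u : ℕ) :
    F.color lx ly (h + 1) u = Nat.ofDigits (cap H + 1) (F.digits lx ly h u) := rfl

theorem length_digits (lx ly : ℕ → ℕ) (h u : ℕ) :
    (F.digits lx ly h u).length = H + 2 + numColors H h := by
  simp [digits, length_label]

variable {F} in
theorem digits_lt {lx ly : ℕ → ℕ} (hx : ∀ u, lx u ≤ 1) (hy : ∀ u, ly u ≤ 1) (h u : ℕ) :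
    ∀ x ∈ F.digits lx ly h u, x < cap H + 1 := by
  intro x hm
  have h1 : 1 ≤ cap H := by simp [cap]
  simp only [digits, label, List.mem_append, List.mem_map, List.mem_range, List.mem_cons,
    List.not_mem_nil, or_false] at hm
  rcases hm with (⟨j, _, rfl⟩ | rfl | rfl) | ⟨κ, _, rfl⟩
  · have := bit_le_one (F.Adj u (F.par^[j + 1] u)); omega
  · have := hx u; omega
  · have := hy u; omega
  · omega

variable {F} in
theorem color_lt {lx ly : ℕ → ℕ} (hx : ∀ u, lx u ≤ 1) (hy : ∀ u, ly u ≤ 1) (h u : ℕ) :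
    F.color lx ly h u < numColors H h := by
  cases h with
  | zero => simp [color, numColors]
  | succ h =>
    rw [color_succ, numColors, ← F.length_digits lx ly h u]
    exact Nat.ofDigits_lt_base_pow_length (by simp [cap]) (digits_lt hx hy h u)

/-- `x` lies in the subtree with root `c`. -/
def Below (x c : ℕ) : Prop := ∃ r, F.par^[r] x = c

variable {F}

theorem W_ne_top {u : ℕ} (h : F.W u) : u ≠ F.n := (F.W_lt h).ne

theorem not_W_top : ¬ F.W F.n := fun h => absurd (F.W_lt h) (lt_irrefl _)

theorem W_of_par {c p : ℕ} (hc : c < F.n) (h : F.par c = p) (hp : F.W p) : F.W c := by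
  by_contra hn
  rw [F.par_of_not hc hn] at h
  exact hn (h ▸ hp)

theorem W_of_par_top {c : ℕ} (hc : c < F.n) (h : F.par c = F.n) : F.W c := by
  by_contra hn
  rw [F.par_of_not hc hn] at h
  omega

theorem iterate_top (r : ℕ) : F.par^[r] F.n = F.n := Function.iterate_fixed F.par_top r

theorem dep_pos {u : ℕ} (h : F.W u) : 1 ≤ F.dep u := by rw [F.dep_W h]; omega

/-- Going up `r` steps from a vertex of `W` within the forest. -/
theorem iterate_W {u : ℕ} (h : F.W u) : ∀ {r : ℕ}, r < F.dep u →
    F.W (F.par^[r] u) ∧ F.dep (F.par^[r] u) + r = F.dep u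
  | 0, _ => ⟨h, rfl⟩
  | r + 1, hr => by
    obtain ⟨h1, h2⟩ := iterate_W h (r := r) (by omega)
    rw [Function.iterate_succ_apply']
    have h3 := F.dep_W h1
    rcases F.par_W h1 with h4 | h4
    · exact ⟨h4, by omega⟩
    · rw [h4, F.dep_top] at h3; omega

theorem iterate_dep {u : ℕ} (h : F.W u) : F.par^[F.dep u] u = F.n := by
  have hp := dep_pos h
  obtain ⟨h1, h2⟩ := iterate_W h (r := F.dep u - 1) (by omega)
  have h3 : F.dep u = (F.dep u - 1) + 1 := by omega
  rw [h3, Function.iterate_succ_apply']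
  rcases F.par_W h1 with h4 | h4
  · have := F.dep_W h1; have := dep_pos h4; omega
  · exact h4

theorem iterate_of_dep_le {u r : ℕ} (h : F.W u) (hr : F.dep u ≤ r) : F.par^[r] u = F.n := by
  obtain ⟨s, rfl⟩ := Nat.exists_eq_add_of_le' hr
  rw [Function.iterate_add_apply, iterate_dep h, iterate_top]

/-- If going up from a vertex of `W` ends in `W`, the number of steps is the difference of depths. -/
theorem dep_of_iterate {u c r : ℕ} (h : F.W u) (hc : F.W c) (hr : F.par^[r] u = c) :
    F.dep c + r = F.dep u := by
  by_cases hlt : r < F.dep u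
  · rw [← hr]; exact (iterate_W h hlt).2
  · rw [iterate_of_dep_le h (by omega)] at hr
    exact absurd hr.symm (W_ne_top hc)

theorem Below.refl (u : ℕ) : F.Below u u := ⟨0, rfl⟩

theorem Below.trans {x y z : ℕ} (h : F.Below x y) (h' : F.Below y z) : F.Below x z := by
  obtain ⟨r, rfl⟩ := h; obtain ⟨s, rfl⟩ := h'
  exact ⟨s + r, Function.iterate_add_apply _ _ _ _⟩

theorem Below.dep_le {x c : ℕ} (hx : F.W x) (hc : F.W c) (h : F.Below x c) :
    F.dep c ≤ F.dep x := by
  obtain ⟨r, hr⟩ := h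
  have := dep_of_iterate hx hc hr; omega

theorem Below.iterate_eq {x c : ℕ} (hx : F.W x) (hc : F.W c) (h : F.Below x c) :
    F.par^[F.dep x - F.dep c] x = c := by
  obtain ⟨r, hr⟩ := h
  have := dep_of_iterate hx hc hr
  rwa [← this, Nat.add_sub_cancel_left]

/-- Ancestors of the same vertex are comparable. -/
theorem Below.below_of_dep_le {x c e : ℕ} (hx : F.W x) (hc : F.W c) (he : F.W e)
    (h : F.Below x c) (h' : F.Below x e) (hd : F.dep e ≤ F.dep c) : F.Below c e := by
  obtain ⟨r, hr⟩ := h; obtain ⟨s, hs⟩ := h'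
  have h1 := dep_of_iterate hx hc hr
  have h2 := dep_of_iterate hx he hs
  refine ⟨s - r, ?_⟩
  rw [← hr, ← Function.iterate_add_apply, Nat.sub_add_cancel (by omega), hs]

theorem Below.eq_of_dep_eq {x c e : ℕ} (hx : F.W x) (hc : F.W c) (he : F.W e)
    (h : F.Below x c) (h' : F.Below x e) (hd : F.dep c = F.dep e) : c = e := by
  rw [← h.iterate_eq hx hc, ← h'.iterate_eq hx he, hd]

theorem Below.par_below {x c : ℕ} (h : F.Below x c) (hne : x ≠ c) : F.Below (F.par x) c := by
  obtain ⟨r, hr⟩ := h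
  cases r with
  | zero => exact absurd hr hne
  | succ r => exact ⟨r, by rwa [Function.iterate_succ_apply] at hr⟩

/-! ### Subtrees of the same colour contain the same paths -/

theorem color_eq_iff {F' : Forested H} {lx ly lx' ly' : ℕ → ℕ} (hx : ∀ u, lx u ≤ 1)
    (hy : ∀ u, ly u ≤ 1) (hx' : ∀ u, lx' u ≤ 1) (hy' : ∀ u, ly' u ≤ 1) {h u u' : ℕ}
    (heq : F.color lx ly (h + 1) u = F'.color lx' ly' (h + 1) u') :
    F.label lx ly u = F'.label lx' ly' u' ∧ ∀ κ < numColors H h,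
      min ((Finset.range F.n).filter fun c => F.par c = u ∧ F.color lx ly h c = κ).card (cap H) =
      min ((Finset.range F'.n).filter fun c => F'.par c = u' ∧ F'.color lx' ly' h c = κ).card
        (cap H) := by
  rw [color_succ, color_succ] at heq
  have h1 := Nat.ofDigits_inj_of_len_eq (by simp [cap])
    (by rw [length_digits, length_digits]) (digits_lt hx hy h u) (digits_lt hx' hy' h u') heq
  have h2 := List.append_inj h1 (by rw [length_label, length_label])
  refine ⟨h2.1, fun κ hκ => ?_⟩
  exact List.map_inj_left.1 h2.2 κ (List.mem_range.2 hκ)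

/-- A small set of vertices of the subtree of `u` that is closed under taking parents embeds into
the subtree of a vertex `u'` of the same colour. The embedding is built top-down: the children of a
vertex in the set are fewer than the threshold up to which the colours count, so there is always an
unused child of the right colour. -/
theorem exists_embedding {F F' : Forested H} {lx ly lx' ly' : ℕ → ℕ} (hx : ∀ u, lx u ≤ 1)
    (hy : ∀ u, ly u ≤ 1) (hx' : ∀ u, lx' u ≤ 1) (hy' : ∀ u, ly' u ≤ 1) {u u' : ℕ} (hu : F.W u)
    (hu' : F'.W u') (hcol : F.color lx ly H u = F'.color lx' ly' H u') (m : ℕ) :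
    ∀ X : Finset ℕ, X.card = m → u ∈ X → X.card ≤ cap H →
      (∀ z ∈ X, F.W z ∧ F.dep u ≤ F.dep z ∧ (z ≠ u → F.par z ∈ X)) →
      ∃ φ : ℕ → ℕ, φ u = u' ∧ Set.InjOn φ X ∧ ∀ z ∈ X, F'.W (φ z) ∧
        F'.dep (φ z) + F.dep u = F'.dep u' + F.dep z ∧
        F.color lx ly (H + F.dep u - F.dep z) z =
          F'.color lx' ly' (H + F.dep u - F.dep z) (φ z) ∧
        (z ≠ u → F'.par (φ z) = φ (F.par z)) := by
  induction m with
  | zero => intro X h0 hX; simp_all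
  | succ m ih =>
    intro X hm huX hcap hX
    obtain ⟨z, hz, hmax⟩ := X.exists_max_image F.dep ⟨u, huX⟩
    by_cases hzu : z = u
    · -- all vertices have the depth of `u`, and so have no parent in the set
      subst hzu
      have hall : ∀ x ∈ X, x = z := by
        intro x hxX
        by_contra hne
        obtain ⟨h1, h2, h3⟩ := hX x hxX
        have h4 := hX _ (h3 hne)
        have h5 := hmax x hxX
        have := F.dep_W h1
        omega
      refine ⟨fun _ => u', rfl, ?_, ?_⟩
      · intro a ha b hb _; rw [hall a ha, hall b hb]
      · intro x hxX
        obtain rfl := hall x hxX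
        refine ⟨hu', rfl, ?_, fun h => absurd rfl h⟩
        rw [Nat.add_sub_cancel]; exact hcol
    · obtain ⟨hzW, hzd, hzp⟩ := hX z hz
      have hpX := hzp hzu
      obtain ⟨hpW, hpd, -⟩ := hX _ hpX
      have hzdep := F.dep_W hzW
      have hpz : F.par z ≠ z := fun h => by rw [h] at hzdep; omega
      have hzH := F.dep_le hzW
      have hpne : ∀ x ∈ X.erase z, F.par x ≠ z := by
        intro x hxX hxe
        obtain ⟨hne, hxX⟩ := Finset.mem_erase.1 hxX
        have h1 := F.dep_W (hX x hxX).1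
        have h2 := hmax x hxX
        rw [hxe] at h1; omega
      obtain ⟨φ, hφu, hinj, hφ⟩ := ih (X.erase z)
        (by rw [Finset.card_erase_of_mem hz]; omega)
        (Finset.mem_erase.2 ⟨Ne.symm hzu, huX⟩)
        ((Finset.card_le_card (Finset.erase_subset _ _)).trans hcap)
        (fun x hxX => ⟨(hX x (Finset.mem_of_mem_erase hxX)).1,
          (hX x (Finset.mem_of_mem_erase hxX)).2.1, fun hne => Finset.mem_erase.2
            ⟨hpne x hxX, (hX x (Finset.mem_of_mem_erase hxX)).2.2 hne⟩⟩)
      set p := F.par z with hp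
      have hpE : p ∈ X.erase z := Finset.mem_erase.2 ⟨hpz, hpX⟩
      obtain ⟨hφpW, hφpd, hφpc, -⟩ := hφ p hpE
      obtain ⟨h, hh⟩ : ∃ h, H + F.dep u - F.dep z = h := ⟨_, rfl⟩
      have hh' : H + F.dep u - F.dep p = h + 1 := by omega
      rw [hh'] at hφpc
      obtain ⟨-, hcount⟩ := color_eq_iff hx hy hx' hy' hφpc
      have hκ := color_lt (F := F) hx hy h z
      have hc := hcount _ hκ
      set κ := F.color lx ly h z with hκdef
      set A := (Finset.range F.n).filter fun c => F.par c = p ∧ F.color lx ly h c = κ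
      set B := (Finset.range F'.n).filter fun c => F'.par c = φ p ∧ F'.color lx' ly' h c = κ
      set Y := (X.erase z).filter fun c => F.par c = p ∧ F.color lx ly h c = κ with hY
      have hYA : Y.card + 1 ≤ A.card := by
        rw [← Finset.card_insert_of_notMem (s := Y) (a := z) (by simp [hY])]
        apply Finset.card_le_card
        intro x hxm
        rcases Finset.mem_insert.1 hxm with rfl | hxm
        · exact Finset.mem_filter.2 ⟨Finset.mem_range.2 (F.W_lt hzW), rfl, rfl⟩
        · obtain ⟨h1, h2⟩ := Finset.mem_filter.1 hxm
          exact Finset.mem_filter.2 ⟨Finset.mem_range.2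
            (F.W_lt (hX x (Finset.mem_of_mem_erase h1)).1), h2⟩
      have hYX : Y.card + 1 ≤ cap H := by
        have h1 : Y.card ≤ (X.erase z).card := Finset.card_filter_le _ _
        rw [Finset.card_erase_of_mem hz] at h1
        have : 1 ≤ X.card := Finset.card_pos.2 ⟨u, huX⟩
        omega
      have hYB : (Y.image φ).card < B.card := by
        have h1 : (Y.image φ).card ≤ Y.card := Finset.card_image_le
        have : Y.card + 1 ≤ min A.card (cap H) := le_min hYA hYX
        rw [hc] at this
        have := this.trans (min_le_left _ _)
        omega
      obtain ⟨b, hbB, hbY⟩ := Finset.exists_mem_notMem_of_card_lt_card hYB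
      obtain ⟨hbn, hbp, hbc⟩ := Finset.mem_filter.1 hbB
      have hbW : F'.W b := F'.W_of_par (Finset.mem_range.1 hbn) hbp hφpW
      have hbd := F'.dep_W hbW
      rw [hbp] at hbd
      have hfresh : ∀ x ∈ X.erase z, φ x ≠ b := by
        intro x hxE hxb
        obtain ⟨h1, h2, h3, h4⟩ := hφ x hxE
        have hxX := Finset.mem_of_mem_erase hxE
        have hxu : x ≠ u := by
          rintro rfl
          rw [hxb] at h2; omega
        have hpar := h4 hxu
        have hpx : F.par x ∈ X.erase z :=
          Finset.mem_erase.2 ⟨hpne x hxE, (hX x hxX).2.2 hxu⟩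
        rw [hxb, hbp] at hpar
        have hxp : F.par x = p := (hinj hpE hpx hpar).symm
        have hxd := F.dep_W (hX x hxX).1
        rw [hxp] at hxd
        have : H + F.dep u - F.dep x = h := by omega
        rw [this, hxb, hbc] at h3
        exact hbY (Finset.mem_image.2 ⟨x, Finset.mem_filter.2 ⟨hxE, hxp, h3⟩, hxb⟩)
      have hold : ∀ x ∈ X, x ≠ z → x ∈ X.erase z := fun x h1 h2 => Finset.mem_erase.2 ⟨h2, h1⟩
      refine ⟨Function.update φ z b, ?_, ?_, ?_⟩
      · rw [Function.update_of_ne (Ne.symm hzu), hφu]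
      · intro x hxX y hyX hxy
        by_cases h1 : x = z <;> by_cases h2 : y = z
        · rw [h1, h2]
        · subst h1
          rw [Function.update_self, Function.update_of_ne h2] at hxy
          exact absurd hxy.symm (hfresh y (hold y hyX h2))
        · subst h2
          rw [Function.update_self, Function.update_of_ne h1] at hxy
          exact absurd hxy (hfresh x (hold x hxX h1))
        · rw [Function.update_of_ne h1, Function.update_of_ne h2] at hxy
          exact hinj (hold x hxX h1) (hold y hyX h2) hxy
      · intro x hxX
        by_cases h1 : x = z
        · subst h1
          rw [Function.update_self, hh]
          refine ⟨hbW, by omega, hbc.symm, fun _ => ?_⟩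
          rw [hbp, Function.update_of_ne hpz]
        · rw [Function.update_of_ne h1]
          obtain ⟨h2, h3, h4, h5⟩ := hφ x (hold x hxX h1)
          refine ⟨h2, h3, h4, fun hne => ?_⟩
          rw [Function.update_of_ne (hpne x (hold x hxX h1)), h5 hne]

end Forested

end LPKernel

namespace LPKernel
namespace Forested
variable {H : ℕ} {F : Forested H}

variable (F) in
/-- `L` is a path in the subtree with root `u` from a vertex with label `lx` to a vertex with
label `ly`. -/
structure IsSeg (lx ly : ℕ → ℕ) (u : ℕ) (L : List ℕ) : Prop where
  ne_nil : L ≠ []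
  nodup : L.Nodup
  chain : L.IsChain F.Adj
  below : ∀ z ∈ L, F.W z ∧ F.Below z u
  head : ∀ z ∈ L.head?, lx z = 1
  last : ∀ z ∈ L.getLast?, ly z = 1

theorem IsSeg.reverse {lx ly : ℕ → ℕ} {u : ℕ} {L : List ℕ} (h : F.IsSeg lx ly u L) :
    F.IsSeg ly lx u L.reverse where
  ne_nil := by simpa using h.ne_nil
  nodup := List.nodup_reverse.2 h.nodup
  chain := List.isChain_reverse.2 (h.chain.imp fun _ _ hab => F.symm hab)
  below z hz := h.below z (List.mem_reverse.1 hz)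
  head z hz := h.last z (by rwa [List.head?_reverse] at hz)
  last z hz := h.head z (by rwa [List.getLast?_reverse] at hz)

theorem label_eq {F' : Forested H} {lx ly lx' ly' : ℕ → ℕ} {u u' : ℕ}
    (h : F.label lx ly u = F'.label lx' ly' u') :
    (∀ j < H, F.Adj u (F.par^[j + 1] u) ↔ F'.Adj u' (F'.par^[j + 1] u')) ∧
      lx u = lx' u' ∧ ly u = ly' u' := by
  have h2 := List.append_inj h (by simp)
  refine ⟨fun j hj => ?_, ?_, ?_⟩
  · exact bit_inj (List.map_inj_left.1 h2.1 j (List.mem_range.2 hj))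
  · simpa using congrArg List.head? h2.2
  · simpa using congrArg List.getLast? h2.2

/-- A path in the subtree of `u` has a copy in the subtree of any vertex of the same colour. -/
theorem IsSeg.transfer {F' : Forested H} {lx ly lx' ly' : ℕ → ℕ} (hx : ∀ u, lx u ≤ 1)
    (hy : ∀ u, ly u ≤ 1) (hx' : ∀ u, lx' u ≤ 1) (hy' : ∀ u, ly' u ≤ 1) {u u' : ℕ} (hu : F.W u)
    (hu' : F'.W u') (hcol : F.color lx ly H u = F'.color lx' ly' H u') {L : List ℕ}
    (hL : F.IsSeg lx ly u L) (hlen : L.length ≤ H) :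
    ∃ L' : List ℕ, L'.length = L.length ∧ F'.IsSeg lx' ly' u' L' := by
  classical
  -- the upward closure of the path within the subtree
  let X : Finset ℕ := (Finset.range F.n).filter fun x => F.W x ∧ F.Below x u ∧ ∃ z ∈ L, F.Below z x
  have hLX : ∀ z ∈ L, z ∈ X := fun z hz => Finset.mem_filter.2
    ⟨Finset.mem_range.2 (F.W_lt (hL.below z hz).1), (hL.below z hz).1, (hL.below z hz).2, z, hz,
      Below.refl z⟩
  obtain ⟨z₀, hz₀⟩ := List.exists_mem_of_ne_nil _ hL.ne_nil
  have huX : u ∈ X := Finset.mem_filter.2 ⟨Finset.mem_range.2 (F.W_lt hu), hu, Below.refl u, z₀, hz₀,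
    (hL.below _ hz₀).2⟩
  have hXW : ∀ x ∈ X, F.W x ∧ F.Below x u := fun x hx =>
    ⟨(Finset.mem_filter.1 hx).2.1, (Finset.mem_filter.1 hx).2.2.1⟩
  have hXcard : X.card ≤ cap H := by
    have hsub : X ⊆ (L.toFinset ×ˢ Finset.range H).image fun q => F.par^[q.2] q.1 := by
      intro x hxX
      obtain ⟨-, hxW, -, z, hz, r, hr⟩ := Finset.mem_filter.1 hxX
      have h1 := dep_of_iterate (hL.below z hz).1 hxW hr
      have h2 := F.dep_le (hL.below z hz).1
      have h3 := dep_pos hxW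
      exact Finset.mem_image.2 ⟨(z, r), Finset.mem_product.2
        ⟨List.mem_toFinset.2 hz, Finset.mem_range.2 (by omega)⟩, hr⟩
    calc X.card ≤ _ := Finset.card_le_card hsub
      _ ≤ _ := Finset.card_image_le
      _ = L.toFinset.card * H := by rw [Finset.card_product, Finset.card_range]
      _ ≤ H * H := Nat.mul_le_mul_right _ ((List.toFinset_card_le _).trans hlen)
      _ ≤ cap H := Nat.le_succ _
  obtain ⟨φ, hφu, hinj, hφ⟩ := exists_embedding hx hy hx' hy' hu hu' hcol X.card X rfl huX hXcard
    (by
      intro z hz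
      obtain ⟨-, hzW, hzu, y, hy, hyz⟩ := Finset.mem_filter.1 hz
      refine ⟨hzW, hzu.dep_le hzW hu, fun hne => ?_⟩
      have hb := hzu.par_below hne
      have hpW : F.W (F.par z) := by
        rcases F.par_W hzW with h | h
        · exact h
        · obtain ⟨r, hr⟩ := hb
          rw [h, iterate_top] at hr
          exact absurd hr.symm (W_ne_top hu)
      exact Finset.mem_filter.2 ⟨Finset.mem_range.2 (F.W_lt hpW), hpW, hb, y, hy,
        hyz.trans ⟨1, rfl⟩⟩)
  have hiter : ∀ r, ∀ z ∈ X, r + F.dep u ≤ F.dep z →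
      F.par^[r] z ∈ X ∧ F'.par^[r] (φ z) = φ (F.par^[r] z) := by
    intro r
    induction r with
    | zero => intro z hz _; exact ⟨hz, rfl⟩
    | succ r ih =>
      intro z hz hr
      have hne : z ≠ u := by rintro rfl; omega
      obtain ⟨hzW, hzu⟩ := hXW z hz
      have hb := hzu.par_below hne
      have hd := F.dep_W hzW
      have hup := dep_pos hu
      have hpW : F.W (F.par z) := by
        rcases F.par_W hzW with h | h
        · exact h
        · rw [h, F.dep_top] at hd; omega
      obtain ⟨-, -, -, y, hy, hyz⟩ := Finset.mem_filter.1 hz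
      have hpX : F.par z ∈ X := Finset.mem_filter.2 ⟨Finset.mem_range.2 (F.W_lt hpW), hpW, hb, y, hy,
        hyz.trans ⟨1, rfl⟩⟩
      have := ih _ hpX (by omega)
      rw [Function.iterate_succ_apply, Function.iterate_succ_apply, (hφ z hz).2.2.2 hne]
      exact this
  have hlab : ∀ z ∈ X, F.label lx ly z = F'.label lx' ly' (φ z) := by
    intro z hz
    have h1 := (hφ z hz).2.2.1
    have h2 := F.dep_le (hXW z hz).1
    have h3 := dep_pos hu
    obtain ⟨h, hh⟩ : ∃ h, H + F.dep u - F.dep z = h + 1 := ⟨H + F.dep u - F.dep z - 1, by omega⟩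
    rw [hh] at h1
    exact (color_eq_iff hx hy hx' hy' h1).1
  have hadj' : ∀ z ∈ X, ∀ z' ∈ X, F.Adj z z' → (∃ r, F.par^[r] z = z') → F'.Adj (φ z) (φ z') := by
    rintro z hz z' hz' hzz ⟨r, hr⟩
    have h1 := dep_of_iterate (hXW z hz).1 (hXW z' hz').1 hr
    have h2 := F.dep_le (hXW z hz).1
    have h3 := dep_pos (hXW z' hz').1
    have h4 := (hXW z' hz').2.dep_le (hXW z' hz').1 hu
    cases r with
    | zero => exact absurd hzz (hr ▸ F.irrefl z)
    | succ r =>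
      have h5 := (hiter (r + 1) z hz (by omega)).2
      rw [hr] at h5
      rw [← h5, ← (label_eq (hlab z hz)).1 r (by omega), hr]
      exact hzz
  have hadj : ∀ z ∈ X, ∀ z' ∈ X, F.Adj z z' → F'.Adj (φ z) (φ z') := by
    intro z hz z' hz' hzz
    rcases F.comp (hXW z hz).1 (hXW z' hz').1 hzz with h | h
    · exact hadj' z hz z' hz' hzz h
    · exact F'.symm (hadj' z' hz' z hz (F.symm hzz) h)
  refine ⟨L.map φ, List.length_map _, by simpa using hL.ne_nil, ?_, ?_, ?_, ?_, ?_⟩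
  · exact List.Nodup.map_on (fun a ha b hb hab => hinj (hLX a ha) (hLX b hb) hab) hL.nodup
  · rw [List.isChain_map]
    exact hL.chain.imp_of_mem_imp fun a b ha hb hab => hadj a (hLX a ha) b (hLX b hb) hab
  · intro z hz
    obtain ⟨y, hy, rfl⟩ := List.mem_map.1 hz
    refine ⟨(hφ y (hLX y hy)).1, F.dep y - F.dep u, ?_⟩
    have h1 := (hL.below y hy).2.dep_le (hL.below y hy).1 hu
    rw [(hiter _ y (hLX y hy) (by omega)).2, (hL.below y hy).2.iterate_eq (hL.below y hy).1 hu, hφu]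
  · intro z hz
    rw [List.head?_map] at hz
    obtain ⟨y, hy, rfl⟩ := Option.mem_map.1 hz
    rw [← (label_eq (hlab y (hLX y (List.mem_of_mem_head? hy)))).2.1]
    exact hL.head y hy
  · intro z hz
    rw [List.getLast?_map] at hz
    obtain ⟨y, hy, rfl⟩ := Option.mem_map.1 hz
    rw [← (label_eq (hlab y (hLX y (List.mem_of_mem_getLast? hy)))).2.2]
    exact hL.last y hy

/-- Subtrees of colour `κ` contain a path on `p` vertices between vertices with the two labels. -/
def SegColor (H κ p : ℕ) : Prop :=
  ∃ (F : Forested H) (lx ly : ℕ → ℕ) (u : ℕ) (L : List ℕ), (∀ u, lx u ≤ 1) ∧ (∀ u, ly u ≤ 1) ∧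
    F.W u ∧ F.color lx ly H u = κ ∧ F.IsSeg lx ly u L ∧ L.length = p

/-- The largest number (up to `H`) of vertices of a path between vertices with the two labels, in a
subtree of colour `κ`, or `0` if there is none. -/
noncomputable def segLen (H κ : ℕ) : ℕ := @Nat.findGreatest (SegColor H κ) (Classical.decPred _) H

theorem segLen_le (H κ : ℕ) : segLen H κ ≤ H := @Nat.findGreatest_le _ (Classical.decPred _) _

theorem IsSeg.length_le_segLen {lx ly : ℕ → ℕ} (hx : ∀ u, lx u ≤ 1) (hy : ∀ u, ly u ≤ 1) {u : ℕ}
    (hu : F.W u) {L : List ℕ} (hL : F.IsSeg lx ly u L) (hlen : L.length ≤ H) :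
    L.length ≤ segLen H (F.color lx ly H u) :=
  @Nat.le_findGreatest _ _ (Classical.decPred _) _ hlen ⟨F, lx, ly, u, L, hx, hy, hu, rfl, hL, rfl⟩

theorem exists_isSeg {lx ly : ℕ → ℕ} (hx : ∀ u, lx u ≤ 1) (hy : ∀ u, ly u ≤ 1) {u : ℕ}
    (hu : F.W u) (h : 1 ≤ segLen H (F.color lx ly H u)) :
    ∃ L, L.length = segLen H (F.color lx ly H u) ∧ F.IsSeg lx ly u L := by
  obtain ⟨F', lx', ly', u', L, hx', hy', hu', hc, hL, hlen⟩ :=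
    @Nat.findGreatest_of_ne_zero _ _ (Classical.decPred (SegColor H (F.color lx ly H u))) _ rfl
      (show segLen H (F.color lx ly H u) ≠ 0 by omega)
  obtain ⟨L', h1, h2⟩ := hL.transfer hx' hy' hx hy hu' hu hc
    (hlen.trans_le (segLen_le H _))
  exact ⟨L', h1.trans hlen, h2⟩

end Forested
end LPKernel

namespace LPKernel

/-- If consecutive elements have the same label unless one of them is a separator, the number of
labels is at most the number of separators plus one. -/
theorem card_labels_le {A : ℕ → Prop} [DecidablePred A] {κ : ℕ → ℕ} : ∀ l : List ℕ,
    l.IsChain (fun x y => A x ∨ A y ∨ κ x = κ y) →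
    (((l.filter fun x => ¬ A x).map κ).toFinset.card ≤ (l.filter fun x => A x).length + 1) ∧
    ((∀ x ∈ l.head?, A x) →
      ((l.filter fun x => ¬ A x).map κ).toFinset.card ≤ (l.filter fun x => A x).length) := by
  intro l
  induction l with
  | nil => simp
  | cons a l ih =>
    intro hl
    obtain ⟨h1, h2⟩ := ih hl.tail
    by_cases ha : A a
    · have e1 : ((a :: l).filter fun x => ¬ A x) = l.filter fun x => ¬ A x := by simp [ha]
      have e2 : ((a :: l).filter fun x => A x) = a :: l.filter fun x => A x := by simp [ha]
      rw [e1, e2, List.length_cons]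
      exact ⟨h1.trans (Nat.le_succ _), fun _ => h1⟩
    · have e1 : ((a :: l).filter fun x => ¬ A x) = a :: l.filter fun x => ¬ A x := by simp [ha]
      have e2 : ((a :: l).filter fun x => A x) = l.filter fun x => A x := by simp [ha]
      rw [e1, e2]
      refine ⟨?_, fun h => absurd (h a rfl) ha⟩
      rw [List.map_cons, List.toFinset_cons]
      cases l with
      | nil => simp
      | cons b l =>
        by_cases hb : A b
        · refine (Finset.card_insert_le _ _).trans (Nat.succ_le_succ (h2 ?_))
          intro x hx; obtain rfl : b = x := by simpa using hx
          exact hb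
        · have hab : κ a = κ b := by
            rcases hl.rel_head? (y := b) rfl with h | h | h
            · exact absurd h ha
            · exact absurd h hb
            · exact h
          rw [Finset.insert_eq_of_mem]
          · exact h1
          · rw [List.mem_toFinset, hab]
            exact List.mem_map_of_mem (by simp [hb])

namespace Forested
variable {H : ℕ} {F : Forested H}

/-! ### Marking and the exchange argument -/

variable (F) in
/-- The possible attachments of the ends of a path segment in a subtree to the rest of the path,
indexed by `a ≤ k + H`: the vertex `mods a` outside of the forest for `a < k`, nothing (a free end)
for `a = k`, and the ancestor at depth `a - k` for `k < a`. The value is `1` if the attachment is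
possible at the vertex `u`, and `0` otherwise. -/
noncomputable def attach (k : ℕ) (mods : ℕ → ℕ) (a u : ℕ) : ℕ :=
  bit ((a < k ∧ F.Adj u (mods a)) ∨ a = k ∨
    (k < a ∧ ∃ j < H, F.dep (F.par^[j + 1] u) + k = a ∧ F.Adj u (F.par^[j + 1] u)))

variable (F) in
/-- The colour that records all attachments of the two kinds `a` and `b`. -/
noncomputable def pairColor (k : ℕ) (mods : ℕ → ℕ) (a b h u : ℕ) : ℕ :=
  F.color (F.attach k mods a) (F.attach k mods b) h u

variable (F) in
/-- The number of vertices of a longest path in the subtree of `u` with ends attached to `a` and `b`,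
or `0` if there is none. -/
noncomputable def score (k : ℕ) (mods : ℕ → ℕ) (a b u : ℕ) : ℕ :=
  segLen H (F.pairColor k mods a b H u)

variable (F) in
/-- For every pair of attachments, each parent has enough marked children of the best scores. -/
def Selects (k : ℕ) (mods : ℕ → ℕ) (Mk : Finset ℕ) : Prop :=
  ∀ a b, a ≤ b → b ≤ k + H → ∀ c < F.n, 1 ≤ F.score k mods a b c → c ∈ Mk ∨
    k + H ≤ ((Finset.range F.n).filter fun c' => c' ∈ Mk ∧ F.par c' = F.par c ∧
      F.score k mods a b c ≤ F.score k mods a b c').card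

variable (F) in
/-- All ancestors of `z` (including `z`) up to depth `i` are marked. -/
def KeptUpTo (Mk : Finset ℕ) (i z : ℕ) : Prop :=
  ∀ r, F.W (F.par^[r] z) → F.dep (F.par^[r] z) ≤ i → F.par^[r] z ∈ Mk

variable (F) in
/-- All ancestors of `z` (including `z`) are marked. -/
def Kept (Mk : Finset ℕ) (z : ℕ) : Prop := ∀ r, F.W (F.par^[r] z) → F.par^[r] z ∈ Mk

variable (F) in
/-- `P` is the vertex sequence of a path. -/
structure IsPathList (P : List ℕ) : Prop where
  nodup : P.Nodup
  chain : P.IsChain F.Adj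
  lt : ∀ z ∈ P, z < F.n

variable (F) in
/-- `mods` enumerates the vertices outside of the forest. -/
def Enum (k : ℕ) (mods : ℕ → ℕ) : Prop :=
  (∀ s < F.n, ¬ F.W s → ∃ i < k, mods i = s) ∧ ∀ i < k, mods i < F.n ∧ ¬ F.W (mods i)

theorem attach_le_one (k : ℕ) (mods : ℕ → ℕ) (a u : ℕ) : F.attach k mods a u ≤ 1 := bit_le_one _

theorem attach_free (k : ℕ) (mods : ℕ → ℕ) (u : ℕ) : F.attach k mods k u = 1 :=
  bit_eq_one.2 (Or.inr (Or.inl rfl))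

variable (F) in
/-- The vertex `x` is outside of the forest or a proper ancestor of `c`. -/
def Boundary (c x : ℕ) : Prop := ¬ F.W x ∨ F.Below (F.par c) x

theorem Boundary.dep_lt {c x : ℕ} (hc : F.W c) (hx : F.W x) (h : F.Boundary c x) :
    F.dep x < F.dep c := by
  have h := h.resolve_left (not_not_intro hx)
  have h1 := F.dep_W hc
  rcases F.par_W hc with h2 | h2
  · have := h.dep_le h2 hx; omega
  · obtain ⟨r, hr⟩ := h
    rw [h2, iterate_top] at hr
    exact absurd hr.symm (W_ne_top hx)

theorem dep_eq_of_par_eq {c c' : ℕ} (hc : F.W c) (hc' : F.W c') (h : F.par c' = F.par c) :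
    F.dep c' = F.dep c := by rw [F.dep_W hc, F.dep_W hc', h]

/-- Each neighbour of a subtree is recognized by one of the attachments, the same for all siblings. -/
theorem exists_attach {k : ℕ} {mods : ℕ → ℕ} (hmods : F.Enum k mods) {c x : ℕ} (hc : F.W c)
    (hx : x < F.n) (h : F.Boundary c x) : ∃ a ≤ k + H, ∀ c' z, F.par c' = F.par c → F.W c' →
      F.W z → F.Below z c' → (F.attach k mods a z = 1 ↔ F.Adj z x) := by
  by_cases hxW : F.W x
  · have hlt := h.dep_lt hc hxW
    have hb := h.resolve_left (not_not_intro hxW)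
    have hxd := dep_pos hxW
    refine ⟨k + F.dep x, by have := F.dep_le hxW; omega, fun c' z hpar hc' hz hzc' => ?_⟩
    have hdc := dep_eq_of_par_eq hc hc' hpar
    have hzx : F.Below z x := (hzc'.trans ⟨1, hpar⟩).trans hb
    unfold attach
    rw [bit_eq_one]
    constructor
    · rintro (h | h | ⟨-, j, hj, hd, hadj⟩)
      · omega
      · omega
      · by_cases hW : F.W (F.par^[j + 1] z)
        · rwa [Below.eq_of_dep_eq hz hxW hW hzx ⟨j + 1, rfl⟩ (by omega)]
        · by_cases hj' : j + 1 < F.dep z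
          · exact absurd (iterate_W hz hj').1 hW
          · rw [iterate_of_dep_le hz (by omega)] at hadj
            exact absurd (F.adj_lt (F.symm hadj)) (lt_irrefl _)
    · intro hadj
      obtain ⟨r, hr⟩ := hzx
      have h1 := dep_of_iterate hz hxW hr
      have h2 := hzc'.dep_le hz hc'
      have h3 := F.dep_le hz
      refine Or.inr (Or.inr ⟨by omega, r - 1, by omega, ?_⟩)
      rw [Nat.sub_add_cancel (by omega), hr]
      exact ⟨by omega, hadj⟩
  · obtain ⟨i, hi, rfl⟩ := hmods.1 x hx hxW
    refine ⟨i, by omega, fun c' z _ _ _ _ => ?_⟩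
    unfold attach
    rw [bit_eq_one]
    constructor
    · rintro (h | h | h)
      · exact h.2
      · omega
      · omega
    · exact fun h => Or.inl ⟨hi, h⟩

/-- The neighbours of a subtree outside of it belong to its boundary. -/
theorem boundary_of_adj {c x y : ℕ} (hc : F.W c) (hy : F.W y) (hyc : F.Below y c)
    (hx : ¬ (F.W x ∧ F.Below x c)) (hadj : F.Adj x y) : F.Boundary c x := by
  by_cases hxW : F.W x
  · have hxc : ¬ F.Below x c := fun h => hx ⟨hxW, h⟩
    refine Or.inr ?_
    rcases F.comp hxW hy hadj with h | h
    · exact absurd (Below.trans h hyc) hxc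
    · by_cases hd : F.dep x ≤ F.dep c
      · refine (hyc.below_of_dep_le hy hc hxW h hd).par_below ?_
        rintro rfl; exact hxc (Below.refl _)
      · exact absurd (Below.below_of_dep_le hy hxW hc h hyc (by omega)) hxc
  · exact Or.inl hxW

open Classical in
variable (F) in
/-- The sibling of `c` whose subtree contains `x`, or the sentinel if there is none. -/
noncomputable def siblingAbove (c x : ℕ) : ℕ :=
  if F.W x ∧ F.dep c ≤ F.dep x ∧ F.par^[F.dep x - F.dep c + 1] x = F.par c then
    F.par^[F.dep x - F.dep c] x else F.n

theorem siblingAbove_eq {c c' x : ℕ} (hc : F.W c) (hc' : F.W c') (hpar : F.par c' = F.par c)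
    (hx : F.W x) (hxc : F.Below x c') : F.siblingAbove c x = c' := by
  have hd := dep_eq_of_par_eq hc hc' hpar
  have h1 := hxc.iterate_eq hx hc'
  rw [hd] at h1
  unfold siblingAbove
  rw [if_pos ⟨hx, hd ▸ hxc.dep_le hx hc', by rw [Function.iterate_succ_apply', h1, hpar]⟩, h1]

theorem siblingAbove_eq_of_adj {c x y : ℕ} (hadj : F.Adj x y)
    (hx : ¬ F.Boundary c x) (hy : ¬ F.Boundary c y) :
    F.siblingAbove c x = F.siblingAbove c y := by
  have hxW : F.W x := by_contra fun h => hx (Or.inl h)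
  have hyW : F.W y := by_contra fun h => hy (Or.inl h)
  suffices key : ∀ {x y : ℕ}, F.W x → F.W y → ¬ F.Boundary c y → (∃ r, F.par^[r] x = y) →
      F.siblingAbove c x = F.siblingAbove c y by
    rcases F.comp hxW hyW hadj with h | h
    · exact key hxW hyW hy h
    · exact (key hyW hxW hx h).symm
  rintro x y hx hy hny ⟨r, hr⟩
  have h1 := dep_of_iterate hx hy hr
  unfold siblingAbove
  by_cases hle : F.dep c ≤ F.dep y
  · have e1 : F.dep x - F.dep c = (F.dep y - F.dep c) + r := by omega
    have e2 : F.dep x - F.dep c + 1 = (F.dep y - F.dep c + 1) + r := by omega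
    rw [e2, e1, Function.iterate_add_apply, Function.iterate_add_apply _ (F.dep y - F.dep c) r, hr]
    simp only [hx, hy, hle, show F.dep c ≤ F.dep x by omega, true_and]
  · rw [if_neg (show ¬ (F.W y ∧ F.dep c ≤ F.dep y ∧ _) from fun h => hle h.2.1), if_neg]
    rintro ⟨-, h2, h3⟩
    refine hny (Or.inr ?_)
    refine ⟨r - (F.dep x - F.dep c + 1), ?_⟩
    rw [← h3, ← Function.iterate_add_apply, Nat.sub_add_cancel (by omega), hr]

/-- The best segment in the unmarked subtree of `c` can be replaced by one that is at least as long
in the subtree of a marked sibling outside of a given small set. -/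
theorem exists_replacement {k : ℕ} {mods : ℕ → ℕ} {Mk : Finset ℕ} (hsel : F.Selects k mods Mk)
    {a b : ℕ} (ha : a ≤ k + H) (hb : b ≤ k + H) {c : ℕ} (hc : F.W c) (hcM : c ∉ Mk) {L : List ℕ}
    (hL : F.IsSeg (F.attach k mods a) (F.attach k mods b) c L) (hlen : L.length ≤ H)
    {hits : Finset ℕ} (hhits : hits.card ≤ k + H) (hch : c ∈ hits) :
    ∃ c' ∈ Mk, c' < F.n ∧ F.par c' = F.par c ∧ c' ∉ hits ∧ ∃ L' : List ℕ,
      F.IsSeg (F.attach k mods a) (F.attach k mods b) c' L' ∧ L.length ≤ L'.length := by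
  wlog hab : a ≤ b generalizing a b L
  · obtain ⟨c', h1, h2, h3, h4, L', h5, h6⟩ :=
      this hb ha hL.reverse (by rwa [List.length_reverse]) (by omega)
    exact ⟨c', h1, h2, h3, h4, L'.reverse, h5.reverse, by
      rw [List.length_reverse] at h6 ⊢; exact h6⟩
  have hle := hL.length_le_segLen (attach_le_one k mods a) (attach_le_one k mods b) hc hlen
  have hpos : 1 ≤ L.length := List.length_pos_iff.2 hL.ne_nil
  rcases hsel a b hab hb c (F.W_lt hc) (hpos.trans hle) with h | h
  · exact absurd h hcM
  · have hlt : (hits.erase c).card < _ :=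
      lt_of_lt_of_le (by rw [Finset.card_erase_of_mem hch]
                         have := Finset.card_pos.2 ⟨c, hch⟩; omega) h
    obtain ⟨c', hc', hnot⟩ := Finset.exists_mem_notMem_of_card_lt_card hlt
    obtain ⟨h1, h2, h3, h4⟩ := Finset.mem_filter.1 hc'
    have hlt' := Finset.mem_range.1 h1
    have hcW : F.W c' := by
      rcases F.par_W hc with h5 | h5
      · exact F.W_of_par hlt' h3 h5
      · exact F.W_of_par_top hlt' (h3.trans h5)
    obtain ⟨L', h5, h6⟩ := exists_isSeg (attach_le_one k mods a) (attach_le_one k mods b) hcW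
      (hpos.trans (hle.trans h4))
    refine ⟨c', h2, hlt', h3, fun hm => hnot (Finset.mem_erase.2 ⟨?_, hm⟩), L', h6,
      (hle.trans h4).trans h5.ge⟩
    rintro rfl; exact hcM h2

/-- A path meets the subtrees of at most `k + H` siblings: between two of them, it passes through
their common boundary. -/
theorem card_hits_le {k : ℕ} {mods : ℕ → ℕ} (hmods : F.Enum k mods) {c : ℕ} (hc : F.W c)
    {P : List ℕ} (hP : F.IsPathList P) : ∃ hits : Finset ℕ, hits.card ≤ k + H ∧
      ∀ z ∈ P, ∀ c', F.W c' → F.par c' = F.par c → F.W z → F.Below z c' → c' ∈ hits := by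
  classical
  refine ⟨((P.filter fun x => ¬ F.Boundary c x).map (F.siblingAbove c)).toFinset, ?_, ?_⟩
  · have h1 := (card_labels_le (A := F.Boundary c) (κ := F.siblingAbove c) P
      (hP.chain.imp fun x y hxy => by
        by_cases hx : F.Boundary c x
        · exact Or.inl hx
        by_cases hy : F.Boundary c y
        · exact Or.inr (Or.inl hy)
        exact Or.inr (Or.inr (siblingAbove_eq_of_adj hxy hx hy)))).1
    refine h1.trans ?_
    have hd := dep_pos hc
    have hdH := F.dep_le hc
    have h2 : (P.filter fun x => F.Boundary c x).length ≤ k + (H - 1) := by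
      rw [← List.toFinset_card_of_nodup (hP.nodup.filter _)]
      calc _ ≤ ((Finset.range k).image mods ∪
            (Finset.range (H - 1)).image fun j => F.par^[j] (F.par c)).card := by
            apply Finset.card_le_card
            intro x hx
            obtain ⟨hxP, hxA⟩ := List.mem_filter.1 (List.mem_toFinset.1 hx)
            have hxA : F.Boundary c x := by simpa using hxA
            rw [Finset.mem_union, Finset.mem_image, Finset.mem_image]
            by_cases hxW : F.W x
            · right
              have h3 := hxA.dep_lt hc hxW
              obtain ⟨r, hr⟩ := hxA.resolve_left (not_not_intro hxW)
              have h4 := dep_of_iterate (r := r + 1) hc hxW hr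
              have h5 := dep_pos hxW
              exact ⟨r, Finset.mem_range.2 (by omega), hr⟩
            · left
              obtain ⟨i, hi, rfl⟩ := hmods.1 x (hP.lt x hxP) hxW
              exact ⟨i, Finset.mem_range.2 hi, rfl⟩
        _ ≤ _ := Finset.card_union_le _ _
        _ ≤ k + (H - 1) := by
            refine Nat.add_le_add (Finset.card_image_le.trans ?_) (Finset.card_image_le.trans ?_)
            · rw [Finset.card_range]
            · rw [Finset.card_range]
    omega
  · intro z hz c' hc' hpar hzW hzc'
    rw [List.mem_toFinset]
    refine List.mem_map.2 ⟨z, List.mem_filter.2 ⟨hz, ?_⟩, siblingAbove_eq hc hc' hpar hzW hzc'⟩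
    have : ¬ F.Boundary c z := fun h => by
      have h1 := h.dep_lt hc hzW
      have h2 := hzc'.dep_le hzW hc'
      have h3 := dep_eq_of_par_eq hc hc' hpar
      omega
    simpa using this

open Classical in
/-- One exchange: a path through an unmarked subtree is rerouted, so that it has fewer vertices in
unmarked subtrees with roots of the given depth. -/
theorem exists_exchange {k : ℕ} {mods : ℕ → ℕ} {Mk : Finset ℕ} (hmods : F.Enum k mods)
    (hH : ∀ P, F.IsPathList P → (∀ z ∈ P, F.W z) → P.length ≤ H)
    (hsel : F.Selects k mods Mk) {i : ℕ} {P : List ℕ} (hP : F.IsPathList P)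
    (hk : ∀ z ∈ P, F.KeptUpTo Mk i z) (hbad : ∃ z ∈ P, ¬ F.KeptUpTo Mk (i + 1) z) :
    ∃ P', F.IsPathList P' ∧ P.length ≤ P'.length ∧ (∀ z ∈ P', F.KeptUpTo Mk i z) ∧
      (P'.filter fun z => ¬ F.KeptUpTo Mk (i + 1) z).length <
        (P.filter fun z => ¬ F.KeptUpTo Mk (i + 1) z).length := by
  obtain ⟨z₀, hz₀, hz₀b⟩ := hbad
  unfold KeptUpTo at hz₀b
  push Not at hz₀b
  obtain ⟨r₀, hc, hcd, hcM⟩ := hz₀b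
  obtain ⟨c, hcdef⟩ : ∃ c, F.par^[r₀] z₀ = c := ⟨_, rfl⟩
  rw [hcdef] at hc hcd hcM
  have hz₀W : F.W z₀ := by
    by_contra hn
    rw [Function.iterate_fixed (F.par_of_not (hP.lt z₀ hz₀) hn)] at hcdef
    exact hn (hcdef ▸ hc)
  have hci : F.dep c = i + 1 := by
    by_contra hne
    exact hcM (hcdef ▸ hk z₀ hz₀ r₀ (hcdef ▸ hc) (by rw [hcdef]; omega))
  have hz₀c : F.Below z₀ c := ⟨r₀, hcdef⟩
  let T : ℕ → Prop := fun x => F.W x ∧ F.Below x c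
  have hTbad : ∀ z, T z → ¬ F.KeptUpTo Mk (i + 1) z := by
    rintro z ⟨-, r, hr⟩ h
    exact hcM (hr ▸ h r (by rwa [hr]) (by rw [hr]; omega))
  -- the first maximal segment of the path in the subtree
  let L₁ := P.takeWhile fun x => ¬ T x
  let R := P.dropWhile fun x => ¬ T x
  let seg := R.takeWhile fun x => T x
  let L₂ := R.dropWhile fun x => T x
  have hPeq : P = L₁ ++ (seg ++ L₂) := by
    rw [List.takeWhile_append_dropWhile, List.takeWhile_append_dropWhile]
  have hL₁ : ∀ x ∈ L₁, ¬ T x := fun x hx => by simpa using List.mem_takeWhile_imp hx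
  have hseg : ∀ x ∈ seg, T x := fun x hx => by simpa using List.mem_takeWhile_imp hx
  have hRne : R ≠ [] := by
    intro hnil
    have : ∀ x ∈ P, ¬ T x := by simpa using List.dropWhile_eq_nil_iff.1 hnil
    exact this z₀ hz₀ ⟨hz₀W, hz₀c⟩
  have hRT : T (R.head hRne) := by
    have := List.head_dropWhile_not (fun x => decide (¬ T x)) hRne
    exact not_not.1 (of_decide_eq_false this)
  have hsegne : seg ≠ [] := by
    obtain ⟨x, R', hR'⟩ := List.exists_cons_of_ne_nil hRne
    have hx : T x := by simpa [hR'] using hRT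
    simp only [seg, hR']
    rw [List.takeWhile_cons_of_pos (by simpa using hx)]
    simp
  have hL₂ : ∀ x ∈ L₂.head?, ¬ T x := by
    intro x hx
    have hne : L₂ ≠ [] := by rintro h; rw [h] at hx; simp at hx
    have := List.head_dropWhile_not (fun x => decide (T x)) hne
    rw [List.head?_eq_some_head hne] at hx
    obtain rfl : L₂.head hne = x := by simpa using hx
    simpa using this
  have hchain := hP.chain
  have hnodup := hP.nodup
  rw [hPeq] at hchain hnodup
  obtain ⟨hch₁, hch', hj₁⟩ := List.isChain_append.1 hchain
  obtain ⟨hchs, hch₂, hj₂⟩ := List.isChain_append.1 hch'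
  obtain ⟨hnd₁, hnd', hdis₁⟩ := List.nodup_append.1 hnodup
  obtain ⟨hnds, hnd₂, hdis₂⟩ := List.nodup_append.1 hnd'
  have hmem₁ : ∀ x ∈ L₁, x ∈ P := fun x hx => by rw [hPeq]; simp [hx]
  have hmems : ∀ x ∈ seg, x ∈ P := fun x hx => by rw [hPeq]; simp [hx]
  have hmem₂ : ∀ x ∈ L₂, x ∈ P := fun x hx => by rw [hPeq]; simp [hx]
  have hj₁' : ∀ x ∈ L₁.getLast?, ∀ y ∈ seg.head?, F.Adj x y := fun x hx y hy =>
    hj₁ x hx y (by rw [List.head?_append, Option.mem_def.1 hy]; rfl)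
  -- the attachments of the two ends
  obtain ⟨a, ha, ha1, ha2⟩ : ∃ a ≤ k + H, (∀ z ∈ seg.head?, F.attach k mods a z = 1) ∧
      ∀ c' z, F.par c' = F.par c → F.W c' → F.W z → F.Below z c' → F.attach k mods a z = 1 →
        ∀ x ∈ L₁.getLast?, F.Adj x z := by
    rcases hl : L₁.getLast? with _ | x
    · exact ⟨k, by omega, fun z _ => attach_free k mods z, by simp⟩
    · have hxL : x ∈ L₁ := List.mem_of_mem_getLast? hl
      obtain ⟨y, hy⟩ : ∃ y, y ∈ seg.head? := ⟨_, List.head?_eq_some_head hsegne⟩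
      have hyT := hseg y (List.mem_of_mem_head? hy)
      obtain ⟨a, ha, h⟩ := exists_attach hmods hc (hP.lt x (hmem₁ x hxL))
        (boundary_of_adj hc hyT.1 hyT.2 (hL₁ x hxL) (hj₁' x hl y hy))
      refine ⟨a, ha, fun z hz => ?_, fun c' z h1 h2 h3 h4 h5 x' hx' => ?_⟩
      · have hzT := hseg z (List.mem_of_mem_head? hz)
        exact (h c z rfl hc hzT.1 hzT.2).2 (F.symm (hj₁' x hl z hz))
      · obtain rfl : x = x' := by simpa using hx'
        exact F.symm ((h c' z h1 h2 h3 h4).1 h5)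
  obtain ⟨b, hb, hb1, hb2⟩ : ∃ b ≤ k + H, (∀ z ∈ seg.getLast?, F.attach k mods b z = 1) ∧
      ∀ c' z, F.par c' = F.par c → F.W c' → F.W z → F.Below z c' → F.attach k mods b z = 1 →
        ∀ x ∈ L₂.head?, F.Adj z x := by
    rcases hl : L₂.head? with _ | x
    · exact ⟨k, by omega, fun z _ => attach_free k mods z, by simp⟩
    · have hxL : x ∈ L₂ := List.mem_of_mem_head? hl
      obtain ⟨y, hy⟩ : ∃ y, y ∈ seg.getLast? := ⟨_, List.getLast?_eq_some_getLast hsegne⟩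
      have hyT := hseg y (List.mem_of_mem_getLast? hy)
      obtain ⟨b, hb, h⟩ := exists_attach hmods hc (hP.lt x (hmem₂ x hxL))
        (boundary_of_adj hc hyT.1 hyT.2 (hL₂ x hl) (F.symm (hj₂ y hy x hl)))
      refine ⟨b, hb, fun z hz => ?_, fun c' z h1 h2 h3 h4 h5 x' hx' => ?_⟩
      · have hzT := hseg z (List.mem_of_mem_getLast? hz)
        exact (h c z rfl hc hzT.1 hzT.2).2 (hj₂ z hz x hl)
      · obtain rfl : x = x' := by simpa using hx'
        exact (h c' z h1 h2 h3 h4).1 h5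
  have hsegS : F.IsSeg (F.attach k mods a) (F.attach k mods b) c seg :=
    ⟨hsegne, hnds, hchs, hseg, ha1, hb1⟩
  have hseglen : seg.length ≤ H := hH seg ⟨hnds, hchs, fun z hz => hP.lt z (hmems z hz)⟩
    fun z hz => (hseg z hz).1
  obtain ⟨hits, hcard, hhits⟩ := card_hits_le hmods hc hP
  obtain ⟨c', hc'M, hc'n, hpar, hc'h, L', hL', hlen⟩ := exists_replacement hsel ha hb hc hcM hsegS
    hseglen hcard (hhits z₀ hz₀ c hc rfl hz₀W hz₀c)
  have hc' : F.W c' := by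
    rcases F.par_W hc with h5 | h5
    · exact F.W_of_par hc'n hpar h5
    · exact F.W_of_par_top hc'n (hpar.trans h5)
  have hc'd := dep_eq_of_par_eq hc hc' hpar
  have hfresh : ∀ x ∈ L', x ∉ P := fun x hx hxP =>
    hc'h (hhits x hxP c' hc' hpar (hL'.below x hx).1 (hL'.below x hx).2)
  have hgood : ∀ z ∈ L', F.KeptUpTo Mk (i + 1) z := by
    intro z hz r heW hed
    obtain ⟨hzW, hzc'⟩ := hL'.below z hz
    have hce : F.Below c' (F.par^[r] z) :=
      hzc'.below_of_dep_le hzW hc' heW ⟨r, rfl⟩ (by omega)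
    by_cases he : F.par^[r] z = c'
    · rwa [he]
    · obtain ⟨s, hs⟩ := hpar ▸ hce.par_below (Ne.symm he)
      have h1 := F.dep_W hc
      have h2 : F.Below c (F.par^[r] z) := ⟨s + 1, hs⟩
      have h3 := h2.dep_le hc heW
      obtain ⟨t, ht⟩ := hz₀c.trans h2
      have h4 := dep_of_iterate (r := s + 1) hc heW hs
      exact ht ▸ hk z₀ hz₀ t (by rwa [ht]) (by rw [ht]; omega)
  refine ⟨L₁ ++ (L' ++ L₂), ⟨?_, ?_, ?_⟩, ?_, ?_, ?_⟩
  · refine List.nodup_append.2 ⟨hnd₁, List.nodup_append.2 ⟨hL'.nodup, hnd₂, ?_⟩, ?_⟩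
    · rintro x hx y hy rfl
      exact hfresh x hx (hmem₂ x hy)
    · rintro x hx y hy rfl
      rcases List.mem_append.1 hy with h | h
      · exact hfresh x h (hmem₁ x hx)
      · exact hdis₁ x hx x (List.mem_append_right _ h) rfl
  · refine List.isChain_append.2 ⟨hch₁, List.isChain_append.2 ⟨hL'.chain, hch₂, ?_⟩, ?_⟩
    · intro z hz x hx
      have h := hL'.below z (List.mem_of_mem_getLast? hz)
      exact hb2 c' z hpar hc' h.1 h.2 (hL'.last z hz) x hx
    · intro x hx z hz
      obtain ⟨y, hy⟩ : ∃ y, y ∈ L'.head? := ⟨_, List.head?_eq_some_head hL'.ne_nil⟩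
      rw [List.head?_append, Option.mem_def.1 hy] at hz
      obtain rfl : y = z := by simpa using hz
      have h := hL'.below y (List.mem_of_mem_head? hy)
      exact ha2 c' y hpar hc' h.1 h.2 (hL'.head y hy) x hx
  · intro z hz
    rcases List.mem_append.1 hz with h | h
    · exact hP.lt z (hmem₁ z h)
    · rcases List.mem_append.1 h with h | h
      · exact F.W_lt (hL'.below z h).1
      · exact hP.lt z (hmem₂ z h)
  · rw [congrArg List.length hPeq]
    simp only [List.length_append]; omega
  · intro z hz
    rcases List.mem_append.1 hz with h | h
    · exact hk z (hmem₁ z h)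
    · rcases List.mem_append.1 h with h | h
      · exact fun r h1 h2 => hgood z h r h1 (by omega)
      · exact hk z (hmem₂ z h)
  · rw [congrArg (fun l => (l.filter fun z => decide (¬ F.KeptUpTo Mk (i + 1) z)).length) hPeq]
    simp only [List.filter_append, List.length_append]
    have h1 : (L'.filter fun z => decide (¬ F.KeptUpTo Mk (i + 1) z)) = [] :=
      List.filter_eq_nil_iff.2 fun z hz => by simpa using hgood z hz
    have h2 : (seg.filter fun z => decide (¬ F.KeptUpTo Mk (i + 1) z)) = seg :=
      List.filter_eq_self.2 fun z hz => by simpa using hTbad z (hseg z hz)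
    rw [h1, h2]
    have := List.length_pos_iff.2 hsegne
    simp only [List.length_nil]; omega

/-- Every path can be rerouted, without becoming shorter, to use only kept vertices. -/
theorem exists_kept_path {k : ℕ} {mods : ℕ → ℕ} {Mk : Finset ℕ} (hmods : F.Enum k mods)
    (hH : ∀ P, F.IsPathList P → (∀ z ∈ P, F.W z) → P.length ≤ H)
    (hsel : F.Selects k mods Mk) {P : List ℕ} (hP : F.IsPathList P) :
    ∃ P', F.IsPathList P' ∧ P.length ≤ P'.length ∧ ∀ z ∈ P', F.Kept Mk z := by
  classical
  have level : ∀ i m, ∀ P, F.IsPathList P → (∀ z ∈ P, F.KeptUpTo Mk i z) →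
      (P.filter fun z => ¬ F.KeptUpTo Mk (i + 1) z).length ≤ m →
      ∃ P', F.IsPathList P' ∧ P.length ≤ P'.length ∧ ∀ z ∈ P', F.KeptUpTo Mk (i + 1) z := by
    intro i m
    induction m with
    | zero =>
      intro P hP _ hm
      refine ⟨P, hP, le_rfl, fun z hz => ?_⟩
      by_contra hn
      have hmem : z ∈ P.filter fun z => ¬ F.KeptUpTo Mk (i + 1) z :=
        List.mem_filter.2 ⟨hz, by simpa using hn⟩
      have := List.length_pos_of_mem hmem
      omega
    | succ m ih =>
      intro P hP hk hm
      by_cases hbad : ∃ z ∈ P, ¬ F.KeptUpTo Mk (i + 1) z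
      · obtain ⟨P', h1, h2, h3, h4⟩ := exists_exchange hmods hH hsel hP hk hbad
        obtain ⟨P'', h5, h6, h7⟩ := ih P' h1 h3 (by omega)
        exact ⟨P'', h5, h2.trans h6, h7⟩
      · push Not at hbad
        exact ⟨P, hP, le_rfl, hbad⟩
  have all : ∀ i, ∃ P', F.IsPathList P' ∧ P.length ≤ P'.length ∧ ∀ z ∈ P', F.KeptUpTo Mk i z := by
    intro i
    induction i with
    | zero =>
      refine ⟨P, hP, le_rfl, fun z _ r h1 h2 => ?_⟩
      have := dep_pos h1; omega
    | succ i ih =>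
      obtain ⟨P', h1, h2, h3⟩ := ih
      obtain ⟨P'', h4, h5, h6⟩ := level i _ P' h1 h3 le_rfl
      exact ⟨P'', h4, h2.trans h5, h6⟩
  obtain ⟨P', h1, h2, h3⟩ := all H
  exact ⟨P', h1, h2, fun z hz r h => h3 z hz r h (F.dep_le h)⟩

/-- If each parent has at most `q` marked children, then at most `k + q + q ^ 2 + ⋯ + q ^ H` vertices
are kept. -/
theorem card_kept_le {k : ℕ} {mods : ℕ → ℕ} {Mk : Finset ℕ} (hmods : F.Enum k mods) {q : ℕ}
    (hq : ∀ v, ((Finset.range F.n).filter fun c => c ∈ Mk ∧ F.par c = v).card ≤ q)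
    (K : Finset ℕ) (hK : ∀ z ∈ K, z < F.n ∧ F.Kept Mk z) :
    K.card ≤ k + ∑ i ∈ Finset.range H, q ^ (i + 1) := by
  classical
  have level : ∀ i, ∀ X : Finset ℕ, (∀ z ∈ X, F.W z ∧ F.Kept Mk z ∧ F.dep z = i + 1) →
      X.card ≤ q ^ (i + 1) := by
    intro i
    induction i with
    | zero =>
      intro X hX
      rw [zero_add, pow_one]
      refine (Finset.card_le_card fun z hz => ?_).trans (hq F.n)
      obtain ⟨h1, h2, h3⟩ := hX z hz
      refine Finset.mem_filter.2 ⟨Finset.mem_range.2 (F.W_lt h1), h2 0 h1, ?_⟩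
      have h4 := F.dep_W h1
      rcases F.par_W h1 with h5 | h5
      · have := dep_pos h5; omega
      · exact h5
    | succ i ih =>
      intro X hX
      have h1 : (X.image F.par).card ≤ q ^ (i + 1) := by
        refine ih _ fun p hp => ?_
        obtain ⟨z, hz, rfl⟩ := Finset.mem_image.1 hp
        obtain ⟨h1, h2, h3⟩ := hX z hz
        have h4 := F.dep_W h1
        rcases F.par_W h1 with h5 | h5
        · exact ⟨h5, fun r hr => h2 (r + 1) hr, by omega⟩
        · rw [h5, F.dep_top] at h4; omega
      have h2 : X.card ≤ q * (X.image F.par).card := by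
        refine Finset.card_le_mul_card_image X q fun v _ => ?_
        refine (Finset.card_le_card fun z hz => ?_).trans (hq v)
        obtain ⟨hz, hzv⟩ := Finset.mem_filter.1 hz
        obtain ⟨h1, h2, h3⟩ := hX z hz
        exact Finset.mem_filter.2 ⟨Finset.mem_range.2 (F.W_lt h1), h2 0 h1, hzv⟩
      rw [pow_succ, mul_comm]
      exact h2.trans (Nat.mul_le_mul_left _ h1)
  have hsub : K ⊆ (Finset.range k).image mods ∪
      (Finset.range H).biUnion fun i => K.filter fun z => F.W z ∧ F.dep z = i + 1 := by
    intro z hz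
    rw [Finset.mem_union, Finset.mem_image, Finset.mem_biUnion]
    by_cases hW : F.W z
    · right
      have h1 := F.dep_le hW
      have h2 := dep_pos hW
      exact ⟨F.dep z - 1, Finset.mem_range.2 (by omega), Finset.mem_filter.2 ⟨hz, hW, by omega⟩⟩
    · left
      obtain ⟨i, hi, rfl⟩ := hmods.1 z (hK z hz).1 hW
      exact ⟨i, Finset.mem_range.2 hi, rfl⟩
  refine (Finset.card_le_card hsub).trans ((Finset.card_union_le _ _).trans ?_)
  refine Nat.add_le_add (Finset.card_image_le.trans (Finset.card_range k).le) ?_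
  refine Finset.card_biUnion_le.trans (Finset.sum_le_sum fun i _ => level i _ fun z hz => ?_)
  obtain ⟨h1, h2, h3⟩ := Finset.mem_filter.1 hz
  exact ⟨h2, (hK z h1).2, h3⟩

end Forested
end LPKernel

namespace LPKernel

/-! ### Depth-first search -/

/-- The graph `Adj` on the vertices `0, …, n - 1` is given by lists: `nb u j` is the neighbour number
`j < deg u` of `u`. A further vertex `n` has arcs to all vertices, from which the search starts. -/
structure AdjLists (n : ℕ) (Adj : ℕ → ℕ → Prop) (nb : ℕ → ℕ → ℕ) (deg : ℕ → ℕ) : Prop where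
  symm : ∀ {u v}, Adj u v → Adj v u
  irrefl : ∀ u, ¬ Adj u u
  lt : ∀ {u v}, Adj u v → u < n
  adj_iff : ∀ {u v}, u < n → (Adj u v ↔ ∃ j < deg u, nb u j = v)
  deg_top : deg n = n
  nb_top : ∀ j < n, nb n j = j

theorem AdjLists.nb_lt {n : ℕ} {Adj : ℕ → ℕ → Prop} {nb : ℕ → ℕ → ℕ} {deg : ℕ → ℕ}
    (h : AdjLists n Adj nb deg) {u j : ℕ} (hu : u ≤ n) (hj : j < deg u) : nb u j < n := by
  rcases hu.lt_or_eq with hu | rfl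
  · exact h.lt (h.symm ((h.adj_iff hu).2 ⟨j, hj, rfl⟩))
  · rw [h.deg_top] at hj
    rw [h.nb_top j hj]; exact hj

/-- `u` is a vertex outside of `S` that the search has reached. -/
def Reached (n : ℕ) (S : ℕ → Prop) (vis : ℕ → ℕ) (u : ℕ) : Prop := u < n ∧ ¬ S u ∧ vis u ≠ 0

/-- The invariant of the depth-first search that avoids `S`: `cur` is the current vertex, `ptr z`
the number of scanned neighbours of `z`, and the vertices of the search stack are those of the form
`par^[r] cur`. -/
structure DfsInv (n : ℕ) (Adj : ℕ → ℕ → Prop) (S : ℕ → Prop) (nb : ℕ → ℕ → ℕ) (deg : ℕ → ℕ)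
    (par vis ptr : ℕ → ℕ) (cur : ℕ) (dep : ℕ → ℕ) : Prop where
  cur_reached : cur = n ∨ Reached n S vis cur
  vis_of : ∀ s < n, S s → vis s ≠ 0
  par_top : par n = n
  par_of_not : ∀ u < n, ¬ Reached n S vis u → par u = u
  par_reached : ∀ u, Reached n S vis u → (Reached n S vis (par u) ∧ Adj u (par u)) ∨ par u = n
  dep_top : dep n = 0
  dep_reached : ∀ u, Reached n S vis u → dep u = dep (par u) + 1
  finished : ∀ z, Reached n S vis z → (¬ ∃ r, par^[r] cur = z) → ptr z = deg z
  seen : ∀ z ≤ n, ∀ j < ptr z, vis (nb z j) ≠ 0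
  ptr_le : ∀ z ≤ n, ptr z ≤ deg z
  comp : ∀ u v, Reached n S vis u → Reached n S vis v → Adj u v →
    (∃ r, par^[r] u = v) ∨ ∃ r, par^[r] v = u

/-- The variant of the search: it decreases in every step. -/
def dfsFuel (n : ℕ) (deg ptr : ℕ → ℕ) (cur : ℕ) (dep : ℕ → ℕ) : ℕ :=
  2 * ∑ z ∈ Finset.range (n + 1), (deg z - ptr z) + dep cur

theorem sum_sub_update {n : ℕ} {deg ptr : ℕ → ℕ} {cur : ℕ} (h : cur ≤ n) (hlt : ptr cur < deg cur) :
    ∑ z ∈ Finset.range (n + 1), (deg z - Function.update ptr cur (ptr cur + 1) z) + 1 =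
      ∑ z ∈ Finset.range (n + 1), (deg z - ptr z) := by
  have hm : cur ∈ Finset.range (n + 1) := Finset.mem_range.2 (by omega)
  rw [← Finset.add_sum_erase _ _ hm, ← Finset.add_sum_erase _ (fun z => deg z - ptr z) hm,
    Function.update_self]
  have : ∑ z ∈ (Finset.range (n + 1)).erase cur,
      (deg z - Function.update ptr cur (ptr cur + 1) z) =
      ∑ z ∈ (Finset.range (n + 1)).erase cur, (deg z - ptr z) :=
    Finset.sum_congr rfl fun z hz => by rw [Function.update_of_ne (Finset.ne_of_mem_erase hz)]
  omega

namespace DfsInv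
variable {n : ℕ} {Adj : ℕ → ℕ → Prop} {S : ℕ → Prop} {nb : ℕ → ℕ → ℕ} {deg par vis ptr : ℕ → ℕ}
  {cur : ℕ} {dep : ℕ → ℕ}

theorem cur_le (h : DfsInv n Adj S nb deg par vis ptr cur dep) : cur ≤ n := by
  rcases h.cur_reached with h | h
  · exact h.le
  · exact h.1.le

theorem ptr_le_update (h : DfsInv n Adj S nb deg par vis ptr cur dep) (hlt : ptr cur < deg cur) :
    ∀ z ≤ n, Function.update ptr cur (ptr cur + 1) z ≤ deg z := by
  intro z hz
  by_cases hzc : z = cur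
  · subst hzc; rw [Function.update_self]; exact hlt
  · rw [Function.update_of_ne hzc]; exact h.ptr_le z hz

theorem init (hvis : ∀ u < n, vis u ≠ 0 ↔ S u) (hpar : ∀ u ≤ n, par u = u)
    (hptr : ∀ u ≤ n, ptr u = 0) : DfsInv n Adj S nb deg par vis ptr n fun _ => 0 := by
  have hno : ∀ u, ¬ Reached n S vis u := fun u ⟨h1, h2, h3⟩ => h2 ((hvis u h1).1 h3)
  exact {
    cur_reached := Or.inl rfl
    vis_of := fun s h1 h2 => (hvis s h1).2 h2
    par_top := hpar n le_rfl
    par_of_not := fun u hu _ => hpar u hu.le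
    par_reached := fun u hu => absurd hu (hno u)
    dep_top := rfl
    dep_reached := fun u hu => absurd hu (hno u)
    finished := fun u hu => absurd hu (hno u)
    seen := fun z hz j hj => by rw [hptr z hz] at hj; omega
    ptr_le := fun z hz => by rw [hptr z hz]; omega
    comp := fun u _ hu => absurd hu (hno u) }

/-- The scanned neighbour has been reached before. -/
theorem skip (h : DfsInv n Adj S nb deg par vis ptr cur dep) (hlt : ptr cur < deg cur)
    (hu : vis (nb cur (ptr cur)) ≠ 0) :
    DfsInv n Adj S nb deg par vis (Function.update ptr cur (ptr cur + 1)) cur dep where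
  cur_reached := h.cur_reached
  vis_of := h.vis_of
  par_top := h.par_top
  par_of_not := h.par_of_not
  par_reached := h.par_reached
  dep_top := h.dep_top
  dep_reached := h.dep_reached
  finished z hz hs := by
    rw [Function.update_of_ne (by rintro rfl; exact hs ⟨0, rfl⟩)]
    exact h.finished z hz hs
  seen z hz j hj := by
    by_cases hzc : z = cur
    · subst hzc
      rw [Function.update_self] at hj
      rcases (Nat.lt_succ_iff.1 hj).lt_or_eq with h' | rfl
      · exact h.seen z hz j h'
      · exact hu
    · rw [Function.update_of_ne hzc] at hj
      exact h.seen z hz j hj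
  ptr_le := h.ptr_le_update hlt
  comp := h.comp

/-- All neighbours of the current vertex have been scanned. -/
theorem pop (h : DfsInv n Adj S nb deg par vis ptr cur dep) (hle : ¬ ptr cur < deg cur)
    (hcur : cur < n) : DfsInv n Adj S nb deg par vis ptr (par cur) dep := by
  have hr : Reached n S vis cur := h.cur_reached.resolve_left hcur.ne
  exact { h with
    cur_reached := by
      rcases h.par_reached cur hr with h' | h'
      · exact Or.inr h'.1
      · exact Or.inl h'
    finished := by
      intro z hz hs
      by_cases hzc : z = cur
      · subst hzc; have := h.ptr_le z hcur.le; omega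
      · refine h.finished z hz ?_
        rintro ⟨r, hr⟩
        cases r with
        | zero => exact hzc hr.symm
        | succ r => exact hs ⟨r, by rwa [Function.iterate_succ_apply] at hr⟩ }

theorem pop_fuel (h : DfsInv n Adj S nb deg par vis ptr cur dep) (hcur : cur < n) :
    dfsFuel n deg ptr (par cur) dep < dfsFuel n deg ptr cur dep := by
  have := h.dep_reached cur (h.cur_reached.resolve_left hcur.ne)
  unfold dfsFuel; omega

/-- The scanned neighbour is new, and becomes the current vertex. Its neighbours reached before are
on the stack, since the vertices that have left the stack have no unreached neighbours. -/
theorem push (hA : AdjLists n Adj nb deg) (h : DfsInv n Adj S nb deg par vis ptr cur dep)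
    (hlt : ptr cur < deg cur) {u : ℕ} (hnb : nb cur (ptr cur) = u) (hu : vis u = 0) :
    DfsInv n Adj S nb deg (Function.update par u cur) (Function.update vis u 1)
      (Function.update ptr cur (ptr cur + 1)) u (Function.update dep u (dep cur + 1)) := by
  have hun : u < n := hnb ▸ hA.nb_lt h.cur_le hlt
  have huS : ¬ S u := fun hs => h.vis_of u hun hs hu
  have hnot : ¬ Reached n S vis u := fun hr => hr.2.2 hu
  have hne : ∀ x, x = n ∨ Reached n S vis x → x ≠ u := by
    rintro x (rfl | hx) rfl
    · exact lt_irrefl _ hun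
    · exact hnot hx
  have hcu := hne cur h.cur_reached
  have hreach : ∀ x, Reached n S (Function.update vis u 1) x ↔ x = u ∨ Reached n S vis x := by
    intro x
    by_cases hx : x = u
    · subst hx; simp [Reached, hun, huS]
    · simp [Reached, hx]
  have hclosed : ∀ x, x = n ∨ Reached n S vis x → par x = n ∨ Reached n S vis (par x) := by
    rintro x (rfl | hx)
    · exact Or.inl h.par_top
    · rcases h.par_reached x hx with h' | h'
      · exact Or.inr h'.1
      · exact Or.inl h'
  have hiter : ∀ r x, x = n ∨ Reached n S vis x →
      (Function.update par u cur)^[r] x = par^[r] x := by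
    intro r
    induction r with
    | zero => intro x _; rfl
    | succ r ih =>
      intro x hx
      rw [Function.iterate_succ_apply, Function.iterate_succ_apply,
        Function.update_of_ne (hne x hx), ih _ (hclosed x hx)]
  have hiteru : ∀ r, (Function.update par u cur)^[r + 1] u = par^[r] cur := by
    intro r
    rw [Function.iterate_succ_apply, Function.update_self, hiter r cur h.cur_reached]
  have hcompu : ∀ v, Reached n S vis v → Adj u v →
      ∃ r, (Function.update par u cur)^[r] u = v := by
    intro v hv huv
    by_contra hcon
    have hs : ¬ ∃ r, par^[r] cur = v := fun ⟨r, hr⟩ => hcon ⟨r + 1, (hiteru r).trans hr⟩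
    obtain ⟨j, hj, hjv⟩ := (hA.adj_iff hv.1).1 (hA.symm huv)
    rw [← h.finished v hv hs] at hj
    exact h.seen v hv.1.le j hj (hjv ▸ hu)
  exact {
    cur_reached := Or.inr ((hreach u).2 (Or.inl rfl))
    vis_of := fun s hs hS => by
      rw [Function.update_of_ne (by rintro rfl; exact huS hS)]; exact h.vis_of s hs hS
    par_top := by rw [Function.update_of_ne hun.ne']; exact h.par_top
    par_of_not := fun x hx hnx => by
      rw [hreach, not_or] at hnx
      rw [Function.update_of_ne hnx.1]; exact h.par_of_not x hx hnx.2
    par_reached := fun x hx => by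
      rcases (hreach x).1 hx with rfl | hx
      · rw [Function.update_self]
        rcases h.cur_reached with h' | h'
        · exact Or.inr h'
        · refine Or.inl ⟨(hreach cur).2 (Or.inr h'), hA.symm ?_⟩
          exact (hA.adj_iff h'.1).2 ⟨_, hlt, hnb⟩
      · rw [Function.update_of_ne (hne x (Or.inr hx)), hreach]
        rcases h.par_reached x hx with h' | h'
        · exact Or.inl ⟨Or.inr h'.1, h'.2⟩
        · exact Or.inr h'
    dep_top := by rw [Function.update_of_ne hun.ne']; exact h.dep_top
    dep_reached := fun x hx => by
      rcases (hreach x).1 hx with rfl | hx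
      · rw [Function.update_self, Function.update_self, Function.update_of_ne hcu]
      · rw [Function.update_of_ne (hne x (Or.inr hx)), Function.update_of_ne (hne x (Or.inr hx)),
          Function.update_of_ne (hne _ (hclosed x (Or.inr hx)))]
        exact h.dep_reached x hx
    finished := fun z hz hs => by
      rcases (hreach z).1 hz with rfl | hz
      · exact absurd ⟨0, rfl⟩ hs
      · have hs' : ¬ ∃ r, par^[r] cur = z := fun ⟨r, hr⟩ => hs ⟨r + 1, (hiteru r).trans hr⟩
        rw [Function.update_of_ne (by rintro rfl; exact hs' ⟨0, rfl⟩)]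
        exact h.finished z hz hs'
    seen := fun z hz j hj => by
      have hmono : ∀ x, vis x ≠ 0 → Function.update vis u 1 x ≠ 0 := by
        intro x hx
        rw [Function.update_apply]; split
        · exact one_ne_zero
        · exact hx
      by_cases hzc : z = cur
      · subst hzc
        rw [Function.update_self] at hj
        rcases (Nat.lt_succ_iff.1 hj).lt_or_eq with h' | rfl
        · exact hmono _ (h.seen z hz j h')
        · rw [hnb, Function.update_self]; exact one_ne_zero
      · rw [Function.update_of_ne hzc] at hj
        exact hmono _ (h.seen z hz j hj)
    ptr_le := h.ptr_le_update hlt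
    comp := fun x y hx hy hxy => by
      rcases (hreach x).1 hx with rfl | hx' <;> rcases (hreach y).1 hy with rfl | hy'
      · exact Or.inl ⟨0, rfl⟩
      · exact Or.inl (hcompu y hy' hxy)
      · exact Or.inr (hcompu x hx' (hA.symm hxy))
      · rcases h.comp x y hx' hy' hxy with ⟨r, hr⟩ | ⟨r, hr⟩
        · exact Or.inl ⟨r, by rw [hiter r x (Or.inr hx'), hr]⟩
        · exact Or.inr ⟨r, by rw [hiter r y (Or.inr hy'), hr]⟩ }

end DfsInv

/-- When the search is complete, its tree is a treedepth decomposition of the graph without `S`; its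
height is bounded since the tree paths are paths of the graph. -/
theorem DfsInv.exists_forested {n : ℕ} {Adj : ℕ → ℕ → Prop} {S : ℕ → Prop} {nb : ℕ → ℕ → ℕ}
    {deg par vis ptr dep : ℕ → ℕ} (hA : AdjLists n Adj nb deg)
    (h : DfsInv n Adj S nb deg par vis ptr n dep) (hptr : n ≤ ptr n) {H : ℕ}
    (hH : ∀ L : List ℕ, L.Nodup → L.IsChain Adj → (∀ z ∈ L, z < n ∧ ¬ S z) → L.length ≤ H) :
    ∃ F : Forested H, F.n = n ∧ F.Adj = Adj ∧ F.W = (fun u => u < n ∧ ¬ S u) ∧ F.par = par := by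
  have hall : ∀ u, Reached n S vis u ↔ u < n ∧ ¬ S u := by
    refine fun u => ⟨fun h => ⟨h.1, h.2.1⟩, fun hu => ⟨hu.1, hu.2, ?_⟩⟩
    have := h.seen n le_rfl u (hu.1.trans_le hptr)
    rwa [hA.nb_top u hu.1] at this
  have hup : ∀ r u, Reached n S vis u → r < dep u →
      Reached n S vis (par^[r] u) ∧ dep (par^[r] u) + r = dep u := by
    intro r
    induction r with
    | zero => intro u hu _; exact ⟨hu, rfl⟩
    | succ r ih =>
      intro u hu hr
      obtain ⟨h1, h2⟩ := ih u hu (by omega)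
      rw [Function.iterate_succ_apply']
      have h3 := h.dep_reached _ h1
      rcases h.par_reached _ h1 with h4 | h4
      · exact ⟨h4.1, by omega⟩
      · rw [h4, h.dep_top] at h3; omega
  have hdep : ∀ u, Reached n S vis u → dep u ≤ H := by
    intro u hu
    have := hH ((List.range (dep u)).map fun r => par^[r] u) ?_ ?_ ?_
    · simpa using this
    · refine List.Nodup.map_on (fun r hr s hs hrs => ?_) List.nodup_range
      have h1 := (hup r u hu (List.mem_range.1 hr)).2
      have h2 := (hup s u hu (List.mem_range.1 hs)).2
      rw [hrs] at h1; omega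
    · rw [List.isChain_map, List.isChain_iff_getElem]
      intro r hr
      rw [List.length_range] at hr
      rw [List.getElem_range, List.getElem_range, Function.iterate_succ_apply']
      obtain ⟨h1, h2⟩ := hup r u hu (by omega)
      rcases h.par_reached _ h1 with h4 | h4
      · exact h4.2
      · have h5 := (hup (r + 1) u hu hr).1.1
        rw [Function.iterate_succ_apply', h4] at h5
        exact absurd h5 (lt_irrefl _)
    · intro z hz
      obtain ⟨r, hr, rfl⟩ := List.mem_map.1 hz
      exact (hall _).1 (hup r u hu (List.mem_range.1 hr)).1
  exact ⟨{
    n := n, Adj := Adj, W := fun u => u < n ∧ ¬ S u, par := par, dep := dep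
    symm := hA.symm, irrefl := hA.irrefl, adj_lt := hA.lt
    W_lt := fun h => h.1
    par_top := h.par_top
    par_W := fun {u} hu => by
      rcases h.par_reached u ((hall u).2 hu) with h' | h'
      · exact Or.inl ((hall _).1 h'.1)
      · exact Or.inr h'
    par_of_not := fun {u} hu hW => h.par_of_not u hu fun hr => hW ((hall u).1 hr)
    dep_top := h.dep_top
    dep_W := fun {u} hu => h.dep_reached u ((hall u).2 hu)
    dep_le := fun {u} hu => hdep u ((hall u).2 hu)
    comp := fun {u v} hu hv => h.comp u v ((hall u).2 hu) ((hall v).2 hv) }, rfl, rfl, rfl, rfl⟩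

end LPKernel

namespace LPKernel

/-! ### The program for colour refinement -/

/-! The registers and arrays of the programs are named as follows.

* `rN`, `rKraw`, `rL`: the number `n` of vertices, the size of the modulator, the required length.
* `rK`: the number of vertices that the search avoids, which is `0` if the modulator is small.
* `rU`, `rJ`: counters of loops over the vertices and over the neighbours of a vertex.
* `rPos`: a position in the input.
* `rCur`, `rV`: the current vertex of the search, and the neighbour that is scanned.
* `rA`, `rB`: a pair of attachments.
* `rOut`: the length of the output so far.
* `rCnt`, `rDeg`: the numbers of kept vertices and of kept neighbours of a vertex.
* `rAns`: the answer of an instance that is solved directly.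
* `aIn`, `aOut`: the input, followed by an artificial list of neighbours, and the output.
* `aStart`: the position in the input of the list of neighbours of each vertex.
* `aMat`: the adjacency matrix, with rows of length `n + 1`.
* `aVis`, `aPtr`, `aPar`: in the search, whether a vertex has been reached or is to be avoided, the
  number of its scanned neighbours, and its parent.
* `aDep`: the depths in the search forest.
* `aX`, `aY`: the two labels of each vertex.
* `aCol`: the colours.
* `aCnt`: the number of children of each vertex for each colour, up to the threshold.
* `aSel`: the number of children of each vertex that are chosen for the current pair.
* `aMark`, `aKeep`, `aNew`: whether a vertex is marked or kept, and its number in the kernel. -/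

notation "rN" => 0
notation "rK" => 1
notation "rL" => 2
notation "rKraw" => 3
notation "rU" => 4
notation "rJ" => 5
notation "rPos" => 6
notation "rCur" => 7
notation "rV" => 8
notation "rA" => 9
notation "rB" => 10
notation "rOut" => 11
notation "rCnt" => 12
notation "rDeg" => 13
notation "rAns" => 14
notation "aIn" => 0
notation "aOut" => 1
notation "aStart" => 2
notation "aMat" => 3
notation "aVis" => 4
notation "aPtr" => 5
notation "aPar" => 6
notation "aDep" => 7
notation "aX" => 8
notation "aY" => 9
notation "aCol" => 10
notation "aCnt" => 11
notation "aSel" => 12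
notation "aMark" => 13
notation "aKeep" => 14
notation "aNew" => 15

open Program
open Term (const reg cell const_eq cell_eq add_eq sub_eq mul_eq lt_eq eq_eq eval_reg)

/-- The position of the entry of the adjacency matrix in row `e` and column `f`. -/
def matIdx (e f : Term) : Term := e * (reg rN + const 1) + f

/-- The ancestor `j` steps above the vertex `e`. -/
def anc : ℕ → Term → Term
  | 0, e => e
  | j + 1, e => cell aPar (anc j e)

/-- The state holds a forest and the graph that it decomposes: the number of vertices, the
parent map, and the adjacency matrix. -/
structure HoldsForest {H : ℕ} (F : Forested H) (σ : State) : Prop where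
  n : σ.reg rN = F.n
  par : σ.mem aPar = F.par
  mat : ∀ u < F.n, ∀ v ≤ F.n, σ.mem aMat (u * (F.n + 1) + v) = bit (F.Adj u v)

theorem HoldsForest.of_frame {H : ℕ} {F : Forested H} {σ τ : State} {p : Program}
    (h : HoldsForest F σ) (hF : Frame p σ τ) (hr : ¬ p.WritesReg rN) (hm : ¬ p.WritesMem aMat)
    (hp : ¬ p.WritesMem aPar) : HoldsForest F τ where
  n := (hF.reg _ hr).trans h.n
  par := (hF.mem _ hp).trans h.par
  mat u hu v hv := by rw [hF.mem _ hm]; exact h.mat u hu v hv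

/-- Words are long enough for the numbers that occur. -/
structure Fits (H n w : ℕ) : Prop where
  small : 16 + n + cap H < 2 ^ w
  mat : (n + 1) * (n + 1) < 2 ^ w
  col : ∀ h ≤ H, (n + 1) * numColors H h < 2 ^ w

theorem Fits.one {H n w : ℕ} (h : Fits H n w) : 1 < 2 ^ w := by have := h.small; omega

theorem add_mul_lt {a b n s : ℕ} (ha : a < n) (hb : b < s) : a * s + b < n * s := by
  calc a * s + b < a * s + s := by omega
    _ = (a + 1) * s := by ring
    _ ≤ n * s := Nat.mul_le_mul_right _ ha

theorem add_mul_inj {a b a' b' s : ℕ} (hb : b < s) (hb' : b' < s) (h : a * s + b = a' * s + b') :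
    a = a' ∧ b = b' := by
  have h1 : a = a' := by
    have := congrArg (· / s) h
    simp only [mul_comm _ s, Nat.mul_add_div (show s > 0 by omega), Nat.div_eq_of_lt hb,
      Nat.div_eq_of_lt hb', add_zero] at this
    exact this
  subst h1
  exact ⟨rfl, by omega⟩

section
variable {H : ℕ} {F : Forested H} {w : ℕ} {σ : State}

theorem HoldsForest.anc_eq (h : HoldsForest F σ) {e : Term} {u : ℕ} (he : e.eval w σ = u) (j : ℕ) :
    (anc j e).eval w σ = F.par^[j] u := by
  induction j with
  | zero => exact he
  | succ j ih => rw [anc, cell_eq _ ih, h.par, Function.iterate_succ_apply']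

theorem Forested.par_le {u : ℕ} (hu : u ≤ F.n) : F.par u ≤ F.n := by
  rcases hu.lt_or_eq with hu | rfl
  · by_cases hW : F.W u
    · rcases F.par_W hW with h | h
      · exact (F.W_lt h).le
      · exact h.le
    · rw [F.par_of_not hu hW]; exact hu.le
  · exact F.par_top.le

theorem Forested.iterate_le {u : ℕ} (hu : u ≤ F.n) (j : ℕ) : F.par^[j] u ≤ F.n := by
  induction j with
  | zero => exact hu
  | succ j ih => rw [Function.iterate_succ_apply']; exact Forested.par_le ih

theorem HoldsForest.matIdx_eq (h : HoldsForest F σ) (hf : Fits H F.n w) {e f : Term} {u v : ℕ}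
    (he : e.eval w σ = u) (hfv : f.eval w σ = v) (hu : u < F.n) (hv : v ≤ F.n) :
    (cell aMat (matIdx e f)).eval w σ = bit (F.Adj u v) := by
  have h1 := hf.small
  have h2 := hf.mat
  have h3 := add_mul_lt (a := u) (n := F.n + 1) (b := v) (s := F.n + 1) (by omega) (by omega)
  have h4 : (matIdx e f).eval w σ = u * (F.n + 1) + v :=
    add_eq (mul_eq he (add_eq (by rw [eval_reg, h.n]) (const_eq (by omega)) (by omega)) (by omega))
      hfv (by omega)
  rw [cell_eq _ h4, h.mat u hu v hv]

end

/-- The digits of the next colour of the vertex in the register `rU`. -/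
def digitTerms (H C : ℕ) : List Term :=
  (List.range H).map (fun j => cell aMat (matIdx (reg rU) (anc (j + 1) (reg rU)))) ++
    [cell aX (reg rU), cell aY (reg rU)] ++
    (List.range C).map fun κ => cell aCnt (reg rU * const C + const κ)

/-- The counter for the colour of the vertex in the register `rU` at its parent. -/
def countIdx (C : ℕ) : Term := cell aPar (reg rU) * const C + cell aCol (reg rU)

/-- Set all counters to `0`. -/
def clearCounts (C : ℕ) : Program :=
  forLoop rU (reg rN + const 1) (.seqs ((List.range C).map fun κ =>
    .store aCnt (reg rU * const C + const κ) (const 0)))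

/-- Count the children of each vertex by colours, up to the threshold. -/
def countColors (H C : ℕ) : Program :=
  forLoop rU (reg rN) (.store aCnt (countIdx C)
    (cell aCnt (countIdx C) + .op .lt (cell aCnt (countIdx C)) (const (cap H))))

/-- Compute the next colour of each vertex. -/
def recolor (H C : ℕ) : Program :=
  forLoop rU (reg rN) (.store aCol (reg rU) (Term.ofDigits (cap H + 1) (digitTerms H C)))

/-- One round of colour refinement. -/
def refineRound (H h : ℕ) : Program :=
  .seq (clearCounts (numColors H h)) (.seq (countColors H (numColors H h))
    (recolor H (numColors H h)))

theorem refineRound_writes {H h : ℕ} : (∀ r, (refineRound H h).WritesReg r → r = rU) ∧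
    ∀ a, (refineRound H h).WritesMem a → a = aCnt ∨ a = aCol := by
  constructor
  · intro r; simp [refineRound, clearCounts, countColors, recolor, WritesReg]
  · intro r; simp [refineRound, clearCounts, countColors, recolor, WritesMem]; tauto

section
variable {H : ℕ} {F : Forested H} {w : ℕ}

variable {lx ly : ℕ → ℕ}

theorem HoldsForest.digitTerms_eq {σ : State} (h : HoldsForest F σ) (hf : Fits H F.n w) {r C u : ℕ}
    (hC : (F.n + 1) * C < 2 ^ w) (hu : σ.reg rU = u) (hun : u < F.n)
    (hlab : σ.mem aX u = lx u ∧ σ.mem aY u = ly u)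
    (hcnt : ∀ κ < numColors H r, σ.mem aCnt (u * C + κ) = min ((Finset.range F.n).filter
      fun c => F.par c = u ∧ F.color lx ly r c = κ).card (cap H)) (hCr : C = numColors H r) :
    (digitTerms H C).map (Term.eval w σ) = F.digits lx ly r u := by
  have hU : (reg rU).eval w σ = u := by rw [eval_reg, hu]
  unfold digitTerms Forested.digits Forested.label
  rw [List.map_append, List.map_append]
  congr 1
  · congr 1
    · rw [List.map_map]
      refine List.map_congr_left fun j _ => ?_
      exact h.matIdx_eq hf hU (h.anc_eq hU (j + 1)) hun (Forested.iterate_le hun.le _)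
    · simp only [List.map_cons, List.map_nil]
      rw [cell_eq _ hU, cell_eq _ hU, hlab.1, hlab.2]
  · rw [List.map_map, ← hCr]
    refine List.map_congr_left fun κ hκ => ?_
    have hκ := List.mem_range.1 hκ
    have h1 := add_mul_lt (a := u) (n := F.n + 1) (b := κ) (s := C) (by omega) hκ
    have h2 : C ≤ (F.n + 1) * C := Nat.le_mul_of_pos_left _ (by omega)
    have h3 : (reg rU * const C + const κ).eval w σ = u * C + κ :=
      add_eq (mul_eq hU (const_eq (by omega)) (by omega)) (const_eq (by omega)) (by omega)
    rw [Function.comp_apply, cell_eq _ h3, hcnt κ (hCr ▸ hκ)]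

theorem runs_clearCounts {C n w : ℕ} {σ : State} (hw : 16 + n < 2 ^ w)
    (hC : (n + 1) * C < 2 ^ w) (hn : σ.reg rN = n) :
    Runs w (clearCounts C) σ ((clearCounts C).rate * (n + 2))
      fun τ => ∀ v ≤ n, ∀ κ < C, τ.mem aCnt (v * C + κ) = 0 := by
  have hle : C ≤ (n + 1) * C := Nat.le_mul_of_pos_left _ (by omega)
  refine (Runs.forLoop_rate (m := n + 1) le_rfl
    (fun i τ => ∀ v < i, ∀ κ < C, τ.mem aCnt (v * C + κ) = 0) (by omega) (by omega)
    (by simp [WritesReg]) (fun v hv => absurd hv (Nat.not_lt_zero v)) (fun _ _ _ h => h)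
    (fun τ hF => ?_) fun i hi τ hF hri hI => ?_).mono le_rfl
      fun τ _ h v hv κ hκ => h v (by omega) κ hκ
  · have : τ.reg rN = n := (hF.reg _ (by simp [WritesReg])).trans hn
    exact add_eq (by rw [eval_reg, this]) (const_eq (by omega)) (by omega)
  · have := Runs.seqs (w := w) (σ := τ) (N := 1) le_rfl
      (f := fun κ => .store aCnt (reg rU * const C + const κ) (const 0))
      (fun j τ => ∀ v ≤ i, ∀ κ < C, (v < i ∨ κ < j) → τ.mem aCnt (v * C + κ) = 0) C
      (fun v hv κ hκ h => hI v (h.resolve_right (Nat.not_lt_zero κ)) κ hκ)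
      fun j hj υ hF' hυ => Runs.rate_mul le_rfl ?_
    · rw [mul_one] at this
      exact this.mono le_rfl fun υ _ h v hv κ hκ => h v (by omega) κ hκ (Or.inr hκ)
    · have hU : υ.reg rU = i := (hF'.reg _ (by simp [WritesReg])).trans hri
      have h1 := add_mul_lt (a := i) (n := n + 1) (b := j) (s := C) hi hj
      refine Runs.store (u := i * C + j) (v := 0) (add_eq (mul_eq (by rw [eval_reg, hU])
        (const_eq (by omega)) (by omega)) (const_eq (by omega)) (by omega)) (const_eq (by omega)) ?_
      intro v hv κ hκ h
      simp only [State.setMem_mem, if_true, Function.update_apply]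
      split
      · rfl
      · next hne =>
        refine hυ v hv κ hκ ?_
        by_contra hcon
        obtain rfl : v = i := by omega
        obtain rfl : κ = j := by omega
        exact hne rfl

theorem countIdx_eq {σ : State} (h : HoldsForest F σ) {C u κ : ℕ}
    (hC : (F.n + 1) * C < 2 ^ w) (hu : σ.reg rU = u) (hun : u < F.n) (hκ : σ.mem aCol u = κ)
    (hκC : κ < C) : (countIdx C).eval w σ = F.par u * C + κ := by
  have hU : (reg rU).eval w σ = u := by rw [eval_reg, hu]
  have h0 := Forested.par_le (F := F) hun.le
  have h1 := add_mul_lt (a := F.par u) (n := F.n + 1) (b := κ) (s := C) (by omega) hκC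
  have h2 : C ≤ (F.n + 1) * C := Nat.le_mul_of_pos_left _ (by omega)
  exact add_eq (mul_eq (by rw [cell_eq _ hU, h.par]) (const_eq (by omega)) (by omega))
    (by rw [cell_eq _ hU, hκ]) (by omega)

theorem runs_countColors {r : ℕ} {σ : State} (hf : Fits H F.n w) (hr : r ≤ H)
    (hx : ∀ u, lx u ≤ 1) (hy : ∀ u, ly u ≤ 1) (hσ : HoldsForest F σ)
    (hcol : ∀ u < F.n, σ.mem aCol u = F.color lx ly r u)
    (hzero : ∀ v ≤ F.n, ∀ κ < numColors H r, σ.mem aCnt (v * numColors H r + κ) = 0) :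
    Runs w (countColors H (numColors H r)) σ ((countColors H (numColors H r)).rate * (F.n + 2))
      fun τ => ∀ v ≤ F.n, ∀ κ < numColors H r, τ.mem aCnt (v * numColors H r + κ) =
        min ((Finset.range F.n).filter fun c => F.par c = v ∧ F.color lx ly r c = κ).card
          (cap H) := by
  have hsmall := hf.small
  have hC := hf.col r hr
  set C := numColors H r
  have hlt := fun u => Forested.color_lt (F := F) hx hy r u
  refine Runs.forLoop_rate (m := F.n) (by omega) (fun i τ => ∀ v ≤ F.n, ∀ κ < C,
    τ.mem aCnt (v * C + κ) = min ((Finset.range i).filter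
      fun c => F.par c = v ∧ F.color lx ly r c = κ).card (cap H)) (by omega) hf.one
    (by simp [WritesReg]) ?_ (fun _ _ _ h => h) (fun τ hF => ?_) fun i hi τ hF hri hI => ?_
  · intro v hv κ hκ
    rw [hzero v hv κ hκ]
    simp
  · exact (hF.reg _ (by simp [WritesReg])).trans hσ.n
  · have hτ := hσ.of_frame hF (by simp [WritesReg]) (by simp [WritesMem]) (by simp [WritesMem])
    have hτc : τ.mem aCol i = F.color lx ly r i := by
      rw [hF.mem _ (by simp [WritesMem]), hcol i hi]
    have hidx := countIdx_eq hτ hC hri hi hτc (hlt i)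
    have hold := hI (F.par i) (Forested.par_le hi.le) _ (hlt i)
    have hcell := cell_eq aCnt hidx
    rw [hold] at hcell
    refine Runs.store hidx (add_eq hcell
      (lt_eq hcell (const_eq (by omega)) hf.one) ?_) ?_
    · split <;> omega
    · intro v hv κ hκ
      simp only [State.setMem_mem, if_true, Function.update_apply]
      rw [Finset.range_add_one, Finset.filter_insert]
      by_cases hvκ : F.par i = v ∧ F.color lx ly r i = κ
      · rw [if_pos hvκ, Finset.card_insert_of_notMem (by simp), ← hvκ.1, ← hvκ.2, if_pos rfl]
        split <;> omega
      · rw [if_neg hvκ, if_neg, hI v hv κ hκ]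
        intro he
        have := add_mul_inj hκ (hlt i) he
        exact hvκ ⟨this.1.symm, this.2.symm⟩

theorem runs_recolor {r : ℕ} {σ : State} (hf : Fits H F.n w) (hr : r < H)
    (hx : ∀ u, lx u ≤ 1) (hy : ∀ u, ly u ≤ 1) (hσ : HoldsForest F σ)
    (hlab : ∀ u < F.n, σ.mem aX u = lx u ∧ σ.mem aY u = ly u)
    (hcnt : ∀ v ≤ F.n, ∀ κ < numColors H r, σ.mem aCnt (v * numColors H r + κ) =
        min ((Finset.range F.n).filter fun c => F.par c = v ∧ F.color lx ly r c = κ).card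
          (cap H)) :
    Runs w (recolor H (numColors H r)) σ ((recolor H (numColors H r)).rate * (F.n + 2))
      fun τ => ∀ u < F.n, τ.mem aCol u = F.color lx ly (r + 1) u := by
  have hsmall := hf.small
  have hpow : (cap H + 1) ^ (H + 2 + numColors H r) ≤ 2 ^ w := by
    have h1 := hf.col (r + 1) hr
    have h2 : numColors H (r + 1) ≤ (F.n + 1) * numColors H (r + 1) :=
      Nat.le_mul_of_pos_left _ (by omega)
    exact h2.trans h1.le
  refine Runs.forLoop_rate (m := F.n) (by omega) (fun i τ => ∀ u < i,
    τ.mem aCol u = F.color lx ly (r + 1) u) (by omega) hf.one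
    (by simp [WritesReg]) (by simp) (fun _ _ _ h => h) (fun τ hF => ?_) fun i hi τ hF hri hI => ?_
  · exact (hF.reg _ (by simp [WritesReg])).trans hσ.n
  · have hτ := hσ.of_frame hF (by simp [WritesReg]) (by simp [WritesMem]) (by simp [WritesMem])
    have hdig := hτ.digitTerms_eq hf (lx := lx) (ly := ly) (hf.col r hr.le) hri hi
      (by rw [hF.mem _ (by simp [WritesMem]), hF.mem _ (by simp [WritesMem])]; exact hlab i hi)
      (by rw [hF.mem _ (by simp [WritesMem])]; exact hcnt i hi.le) rfl
    have hlt := Forested.digits_lt (F := F) hx hy r i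
    have hcapp : 1 ≤ cap H := by simp [cap]
    refine Runs.store (u := i) (v := F.color lx ly (r + 1) i) (by rw [eval_reg, hri]) ?_ ?_
    · rw [Term.eval_ofDigits (by omega) (by omega), hdig, Forested.color_succ]
      · refine le_trans (le_of_eq ?_) hpow
        rw [← List.length_map (Term.eval w τ), hdig, Forested.length_digits]
      · intro e he
        exact hlt _ (hdig ▸ List.mem_map_of_mem he)
    · intro u hu
      simp only [State.setMem_mem, if_true, Function.update_apply]
      split
      · next h => rw [h]
      · exact hI u (by omega)

theorem runs_refineRound {r : ℕ} {σ : State} (hf : Fits H F.n w) (hr : r < H)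
    (hx : ∀ u, lx u ≤ 1) (hy : ∀ u, ly u ≤ 1) (hσ : HoldsForest F σ)
    (hlab : ∀ u < F.n, σ.mem aX u = lx u ∧ σ.mem aY u = ly u)
    (hcol : ∀ u < F.n, σ.mem aCol u = F.color lx ly r u) :
    Runs w (refineRound H r) σ ((refineRound H r).rate * (F.n + 2))
      fun τ => ∀ u < F.n, τ.mem aCol u = F.color lx ly (r + 1) u := by
  have hs := hf.small
  refine (runs_clearCounts (by omega) (hf.col r hr.le) hσ.n).seq_rate fun τ hF hτ => ?_
  have hσ' := hσ.of_frame hF (by simp [clearCounts, WritesReg]) (by simp [clearCounts, WritesMem])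
    (by simp [clearCounts, WritesMem])
  refine (runs_countColors hf hr.le hx hy hσ' (fun u hu => ?_) hτ).seq_rate fun υ hF' hυ => ?_
  · rw [hF.mem _ (by simp [clearCounts, WritesMem])]; exact hcol u hu
  refine runs_recolor hf hr hx hy (hσ'.of_frame hF' (by simp [countColors, WritesReg])
    (by simp [countColors, WritesMem]) (by simp [countColors, WritesMem])) (fun u hu => ?_) hυ
  rw [hF'.mem _ (by simp [countColors, WritesMem]), hF'.mem _ (by simp [countColors, WritesMem]),
    hF.mem _ (by simp [clearCounts, WritesMem]), hF.mem _ (by simp [clearCounts, WritesMem])]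
  exact hlab u hu

/-- Compute the final colours of all vertices. -/
def colorAll (H : ℕ) : Program :=
  .seq (forLoop rU (reg rN) (.store aCol (reg rU) (const 0)))
    (.seqs ((List.range H).map (refineRound H)))

theorem colorAll_writesReg {H r : ℕ} (h : (colorAll H).WritesReg r) : r = rU := by
  simp only [colorAll, WritesReg, writesReg_forLoop, writesReg_seqs, List.mem_map,
    or_false] at h
  rcases h with h | ⟨_, ⟨i, _, rfl⟩, h⟩
  · exact h
  · exact refineRound_writes.1 _ h

theorem colorAll_writesMem {H a : ℕ} (h : (colorAll H).WritesMem a) : a = aCnt ∨ a = aCol := by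
  simp only [colorAll, WritesMem, writesMem_forLoop, writesMem_seqs, List.mem_map] at h
  rcases h with h | ⟨_, ⟨i, _, rfl⟩, h⟩
  · exact Or.inr h
  · exact refineRound_writes.2 _ h

theorem runs_colorAll {σ : State} (hf : Fits H F.n w)
    (hx : ∀ u, lx u ≤ 1) (hy : ∀ u, ly u ≤ 1) (hσ : HoldsForest F σ)
    (hlab : ∀ u < F.n, σ.mem aX u = lx u ∧ σ.mem aY u = ly u) :
    Runs w (colorAll H) σ ((colorAll H).rate * (F.n + 2))
      fun τ => ∀ u < F.n, τ.mem aCol u = F.color lx ly H u := by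
  have hsmall := hf.small
  refine Runs.seq_rate (R := fun τ => ∀ u < F.n, τ.mem aCol u = 0) ?_ (fun τ hF hτ => ?_)
  · refine Runs.forLoop_rate (m := F.n) (by omega) (fun i τ => ∀ u < i,
      τ.mem aCol u = 0) (by omega) hf.one
      (by simp [WritesReg]) (by simp) (fun _ _ _ h => h) (fun τ hF => ?_)
      fun i hi τ hF hri hI => ?_
    · exact (hF.reg _ (by simp [WritesReg])).trans hσ.n
    · refine Runs.store (u := i) (v := 0) (by rw [eval_reg, hri]) (const_eq (by omega)) ?_
      intro j hj
      simp only [State.setMem_mem, if_true, Function.update_apply]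
      split
      · rfl
      · exact hI j (by omega)
  · have hσ' := hσ.of_frame hF (by simp [WritesReg]) (by simp [WritesMem]) (by simp [WritesMem])
    have hwr : ∀ r, (Program.seqs ((List.range H).map (refineRound H))).WritesReg r → r = rU :=
      fun r h => colorAll_writesReg (H := H) (Or.inr h)
    have hwm : ∀ r, (Program.seqs ((List.range H).map (refineRound H))).WritesMem r →
      r = aCnt ∨ r = aCol := fun r h => colorAll_writesMem (H := H) (Or.inr h)
    refine Runs.seqs (by omega) (fun i τ => ∀ u < F.n, τ.mem aCol u = F.color lx ly i u) H hτ
      fun i hi υ hF' hυ => ?_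
    refine runs_refineRound hf hi hx hy (hσ'.of_frame hF' (fun h => by simpa using hwr _ h)
      (fun h => by simpa using hwm _ h) (fun h => by simpa using hwm _ h)) (fun u hu => ?_) hυ
    rw [hF'.mem _ (fun h => by simpa using hwm _ h), hF'.mem _ (fun h => by simpa using hwm _ h),
      hF.mem _ (by simp [WritesMem]), hF.mem _ (by simp [WritesMem])]
    exact hlab u hu

end
end LPKernel

namespace LPKernel
open Program
open Term (const reg cell const_eq cell_eq add_eq sub_eq mul_eq lt_eq eq_eq eval_reg)

/-! ### The program that marks vertices -/

/-- Besides the forest, the state holds the modulator and the depths. -/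
structure HoldsLabels {H : ℕ} (F : Forested H) (k : ℕ) (mods : ℕ → ℕ) (σ : State) : Prop extends
    HoldsForest F σ where
  reg_k : σ.reg rK = k
  mem_mods : ∀ i < k, σ.mem aIn (3 + i) = mods i
  mem_dep : ∀ u, F.W u ∨ u = F.n → σ.mem aDep u = F.dep u

theorem HoldsLabels.of_frame {H k : ℕ} {F : Forested H} {mods : ℕ → ℕ} {σ τ : State} {p : Program}
    (h : HoldsLabels F k mods σ) (hF : Frame p σ τ) (hr : ∀ r ≤ 1, ¬ p.WritesReg r)
    (hm : ∀ a ≤ 7, ¬ p.WritesMem a) : HoldsLabels F k mods τ where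
  toHoldsForest := h.toHoldsForest.of_frame hF (hr _ (by omega)) (hm _ (by omega)) (hm _ (by omega))
  reg_k := (hF.reg _ (hr _ (by omega))).trans h.reg_k
  mem_mods i hi := by rw [hF.mem _ (hm _ (by omega))]; exact h.mem_mods i hi
  mem_dep u hu := by rw [hF.mem _ (hm _ (by omega))]; exact h.mem_dep u hu

/-- The ways in which the vertex in the register `rU` can have the attachment whose index is in the
register `r`. -/
def attachTerms (H r : ℕ) : List Term :=
  .op .lt (reg r) (reg rK) * cell aMat (matIdx (reg rU) (cell aIn (const 3 + reg r))) ::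
    .op .eq (reg r) (reg rK) ::
    (List.range H).map fun j => .op .lt (reg rK) (reg r) *
      (.op .eq (cell aDep (anc (j + 1) (reg rU)) + reg rK) (reg r) *
        cell aMat (matIdx (reg rU) (anc (j + 1) (reg rU))))

/-- Whether the vertex in the register `rU` has the attachment whose index is in the register
`r`. -/
def attachTerm (H r : ℕ) : Term := .op .lt (const 0) (Term.sum (attachTerms H r))

theorem ite_eq_bit (p : Prop) [Decidable p] : (if p then 1 else 0) = bit p := by
  unfold bit; congr

theorem bit_mul_bit (p q : Prop) : bit p * bit q = bit (p ∧ q) := by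
  unfold bit; split <;> split <;> simp_all

theorem bit_congr {p q : Prop} (h : p ↔ q) : bit p = bit q := by rw [propext h]

theorem Term.mul_eq_zero {w : ℕ} {σ : State} {e f : Term} (he : e.eval w σ = 0) :
    (e * f).eval w σ = 0 := by
  have : e.eval w σ * f.eval w σ = 0 := by rw [he, zero_mul]
  rw [Term.eval_mul _ _ (by rw [this]; positivity), this]

section
variable {H k w : ℕ} {F : Forested H} {mods : ℕ → ℕ}

theorem Forested.W_iterate_or {u : ℕ} (hu : F.W u) (j : ℕ) :
    F.W (F.par^[j] u) ∨ F.par^[j] u = F.n := by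
  by_cases h : j < F.dep u
  · exact Or.inl (Forested.iterate_W hu h).1
  · exact Or.inr (Forested.iterate_of_dep_le hu (by omega))

theorem HoldsLabels.attachTerm_eq {σ : State} (h : HoldsLabels F k mods σ) (hf : Fits H F.n w)
    (hk : k + H + 16 < 2 ^ w) (hmods : ∀ i < k, mods i < F.n) {r a u : ℕ} (hr : σ.reg r = a)
    (hu : σ.reg rU = u) (hun : u < F.n) :
    (attachTerm H r).eval w σ = F.attach k mods a u := by
  have h16 := hf.small
  have hone := hf.one
  have hU : (reg rU).eval w σ = u := by rw [eval_reg, hu]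
  have hR : (reg r).eval w σ = a := by rw [eval_reg, hr]
  have hK : (reg rK).eval w σ = k := by rw [eval_reg, h.reg_k]
  have e1 : (.op .lt (reg r) (reg rK) *
      cell aMat (matIdx (reg rU) (cell aIn (const 3 + reg r))) : Term).eval w σ =
      bit (a < k ∧ F.Adj u (mods a)) := by
    have hlt := lt_eq hR hK hone
    rw [ite_eq_bit] at hlt
    by_cases hak : a < k
    · have h3 : (cell aIn (const 3 + reg r)).eval w σ = mods a := by
        rw [cell_eq _ (add_eq (const_eq (c := 3) (by omega)) hR (by omega)), h.mem_mods a hak]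
      have h4 := h.matIdx_eq hf hU h3 hun (hmods a hak).le
      rw [← bit_mul_bit]
      refine mul_eq hlt h4 ?_
      rw [bit_mul_bit]; exact (bit_le_one _).trans_lt hone
    · rw [bit, if_neg hak] at hlt
      rw [Term.mul_eq_zero hlt, bit, if_neg fun h => hak h.1]
  have e2 : (.op .eq (reg r) (reg rK) : Term).eval w σ = bit (a = k) := by
    rw [eq_eq hR hK hone, ite_eq_bit]
  have e3 : ∀ j, (.op .lt (reg rK) (reg r) *
      (.op .eq (cell aDep (anc (j + 1) (reg rU)) + reg rK) (reg r) *
        cell aMat (matIdx (reg rU) (anc (j + 1) (reg rU)))) : Term).eval w σ =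
      bit (k < a ∧ F.dep (F.par^[j + 1] u) + k = a ∧ F.Adj u (F.par^[j + 1] u)) := by
    intro j
    have hanc := h.anc_eq hU (j + 1)
    have h4 := h.matIdx_eq hf hU hanc hun (Forested.iterate_le hun.le _)
    have hlt := lt_eq hK hR hone
    rw [ite_eq_bit] at hlt
    have h5 : (.op .eq (cell aDep (anc (j + 1) (reg rU)) + reg rK) (reg r) *
        cell aMat (matIdx (reg rU) (anc (j + 1) (reg rU))) : Term).eval w σ =
        bit (F.dep (F.par^[j + 1] u) + k = a ∧ F.Adj u (F.par^[j + 1] u)) := by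
      by_cases hadj : F.Adj u (F.par^[j + 1] u)
      · have hW : F.W u := by
          by_contra hn
          rw [Function.iterate_fixed (F.par_of_not hun hn)] at hadj
          exact F.irrefl u hadj
        have hd := h.mem_dep _ (F.W_iterate_or hW (j + 1))
        have hdH : F.dep (F.par^[j + 1] u) ≤ H := by
          rcases F.W_iterate_or hW (j + 1) with h' | h'
          · exact F.dep_le h'
          · rw [h', F.dep_top]; omega
        rw [← bit_mul_bit]
        refine mul_eq ?_ h4 ?_
        · rw [eq_eq (add_eq (by rw [cell_eq _ hanc, hd]) hK (by omega)) hR hone, ite_eq_bit]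
        · rw [bit_mul_bit]; exact (bit_le_one _).trans_lt hone
      · have h6 : bit (F.Adj u (F.par^[j + 1] u)) = 0 := by rw [bit, if_neg hadj]
        rw [h6] at h4
        rw [Term.eval_mul _ _ (by rw [h4, mul_zero]; omega), h4, mul_zero, bit,
          if_neg fun h => hadj h.2]
    rw [← bit_mul_bit]
    refine mul_eq hlt h5 ?_
    rw [bit_mul_bit]; exact (bit_le_one _).trans_lt hone
  set l := attachTerms H r with hl
  have e4 : l.map (Term.eval w σ) = bit (a < k ∧ F.Adj u (mods a)) :: bit (a = k) ::
      (List.range H).map fun j =>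
        bit (k < a ∧ F.dep (F.par^[j + 1] u) + k = a ∧ F.Adj u (F.par^[j + 1] u)) := by
    rw [hl, attachTerms, List.map_cons, List.map_cons, e1, e2, List.map_map]
    congr 2
    exact List.map_congr_left fun j _ => e3 j
  have hsum : (l.map (Term.eval w σ)).sum ≤ H + 2 := by
    have : ∀ x ∈ l.map (Term.eval w σ), x ≤ 1 := by
      rw [e4]
      intro x hx
      simp only [List.mem_cons, List.mem_map] at hx
      rcases hx with rfl | rfl | ⟨j, _, rfl⟩ <;> exact bit_le_one _
    have := List.sum_le_card_nsmul _ 1 this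
    rw [e4] at this ⊢
    simpa using this
  have e5 := Term.eval_sum (w := w) (σ := σ) l (by omega)
  rw [attachTerm, ← hl, lt_eq (const_eq (by omega)) e5 hone, ite_eq_bit, Forested.attach]
  refine bit_congr ?_
  rw [Nat.pos_iff_ne_zero, Ne, List.sum_eq_zero_iff, e4]
  have hz : ∀ p : Prop, bit p = 0 ↔ ¬ p := by
    intro p; unfold bit; split <;> simp_all
  simp only [List.mem_cons, List.mem_map, List.mem_range, forall_eq_or_imp, hz,
    forall_exists_index, and_imp, forall_apply_eq_imp_iff₂]
  constructor
  · intro hn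
    by_contra hcon
    push Not at hcon
    refine hn ⟨fun h => hcon.1 h.1 h.2, hcon.2.1, fun j hj h => hcon.2.2 h.1 j hj h.2.1 h.2.2⟩
  · rintro (h | h | ⟨h1, j, hj, h2, h3⟩) ⟨h4, h5, h6⟩
    · exact h4 h
    · exact h5 h
    · exact h6 j hj ⟨h1, h2, h3⟩

/-- Compute the labels of all vertices for the pair of attachments in the registers `rA`, `rB`. -/
def setLabels (H : ℕ) : Program :=
  forLoop rU (reg rN) (.seq (.store aX (reg rU) (attachTerm H rA))
    (.store aY (reg rU) (attachTerm H rB)))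

theorem runs_setLabels {σ : State} (h : HoldsLabels F k mods σ) (hf : Fits H F.n w)
    (hk : k + H + 16 < 2 ^ w) (hmods : ∀ i < k, mods i < F.n) {a b : ℕ} (hra : σ.reg rA = a)
    (hrb : σ.reg rB = b) :
    Runs w (setLabels H) σ ((setLabels H).rate * (F.n + 2)) fun τ => ∀ u < F.n,
      τ.mem aX u = F.attach k mods a u ∧ τ.mem aY u = F.attach k mods b u := by
  have hsmall := hf.small
  refine Runs.forLoop_rate (m := F.n) (by omega) (fun i τ => ∀ u < i,
    τ.mem aX u = F.attach k mods a u ∧ τ.mem aY u = F.attach k mods b u) (by omega) hf.one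
    (by simp [WritesReg]) (by simp) (fun _ _ _ h => h) (fun τ hF => ?_) fun i hi τ hF hri hI => ?_
  · exact (hF.reg _ (by simp [WritesReg])).trans h.n
  · have hτ := h.of_frame hF (by simp [WritesReg]; omega) (by simp [WritesMem]; omega)
    have hτa : τ.reg rA = a := (hF.reg _ (by simp [WritesReg])).trans hra
    have hτb : τ.reg rB = b := (hF.reg _ (by simp [WritesReg])).trans hrb
    refine Runs.seq (Runs.store (u := i) (v := F.attach k mods a i)
      (Q := fun υ => υ = τ.setMem aX i (F.attach k mods a i)) (by rw [eval_reg, hri])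
      (hτ.attachTerm_eq hf hk hmods hτa hri hi) rfl) fun υ hF' hυ => ?_
    have hυ' := hτ.of_frame hF' (by simp [WritesReg]) (by simp [WritesMem]; omega)
    subst hυ
    refine Runs.store (u := i) (v := F.attach k mods b i) (by simp [hri])
      (hυ'.attachTerm_eq hf hk hmods (by simpa using hτb) (by simpa using hri) hi) ?_
    intro u hu
    simp only [State.setMem_mem, if_true, Function.update_apply]
    by_cases hui : u = i
    · simp [hui]
    · have := hI u (by omega)
      simp [hui, this]

/-- The condition under which the vertex in the register `rU` is marked, in the phase for the
score `p`. -/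
noncomputable def selectCond (H p : ℕ) : Term :=
  .op .eq (Term.lookup (numColors H H) (Forested.segLen H) (cell aCol (reg rU))) (const p) *
    .op .lt (cell aSel (cell aPar (reg rU))) (reg rK + const H)

/-- Mark children of the score `p`, until `k + H` children of the same parent have been marked. -/
noncomputable def selectPhase (H p : ℕ) : Program :=
  forLoop rU (reg rN) (.ite (selectCond H p)
    (.seq (.store aSel (cell aPar (reg rU)) (cell aSel (cell aPar (reg rU)) + const 1))
      (.store aMark (reg rU) (const 1))) .skip)

/-- Mark children of the best scores. -/
noncomputable def selectBest (H : ℕ) : Program :=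
  .seq (forLoop rU (reg rN + const 1) (.store aSel (reg rU) (const 0)))
    (.seqs ((List.range H).map fun i => selectPhase H (H - i)))

/-- The state of the marking for one pair of attachments with scores `s`, when all vertices of
scores above `p` and the vertices below `i` of score `p` have been considered: `X` is the set of
vertices chosen so far. -/
structure SelInv (n k H : ℕ) (par s : ℕ → ℕ) (Mk : Finset ℕ) (p i : ℕ) (X : Finset ℕ) (τ : State) :
    Prop where
  count : ∀ v ≤ n, τ.mem aSel v = (X.filter fun c => par c = v).card
  count_le : ∀ v, (X.filter fun c => par c = v).card ≤ k + H
  mark : ∀ z, τ.mem aMark z = bit (z ∈ Mk ∪ X)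
  considered : ∀ c ∈ X, c < n ∧ (p < s c ∨ (s c = p ∧ c < i))
  chosen : ∀ c < n, (p < s c ∨ (s c = p ∧ c < i)) →
    c ∈ X ∨ k + H ≤ (X.filter fun c' => par c' = par c ∧ s c ≤ s c').card

theorem SelInv.next {n k H : ℕ} {par s : ℕ → ℕ} {Mk X : Finset ℕ} {p : ℕ} {τ : State}
    (h : SelInv n k H par s Mk (p + 1) n X τ) : SelInv n k H par s Mk p 0 X τ where
  count := h.count
  count_le := h.count_le
  mark := h.mark
  considered c hc := by
    have h1 := h.considered c hc
    exact ⟨h1.1, Or.inl (by omega)⟩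
  chosen c hc hs := h.chosen c hc (by omega)

/-- What the marking of one pair of attachments relies on. -/
structure SelectHyp {H : ℕ} (F : Forested H) (k w : ℕ) (s : ℕ → ℕ) (σ : State) : Prop where
  forest : HoldsForest F σ
  reg_k : σ.reg rK = k
  col : ∀ u < F.n, σ.mem aCol u < numColors H H ∧ Forested.segLen H (σ.mem aCol u) = s u

theorem SelectHyp.of_frame {s : ℕ → ℕ} {σ τ : State} {p : Program} (h : SelectHyp F k w s σ)
    (hF : Frame p σ τ) (hr : ∀ r ≤ 1, ¬ p.WritesReg r) (hm : ∀ a ≤ 10, ¬ p.WritesMem a) :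
    SelectHyp F k w s τ where
  forest := h.forest.of_frame hF (hr _ (by omega)) (hm _ (by omega)) (hm _ (by omega))
  reg_k := (hF.reg _ (hr _ (by omega))).trans h.reg_k
  col u hu := by rw [hF.mem _ (hm _ (by omega))]; exact h.col u hu

/-- All vertices of score `p` are considered, and each one is marked unless its parent has its quota. -/
theorem runs_selectPhase {s : ℕ → ℕ} {Mk X : Finset ℕ} {p : ℕ} {σ : State} (hf : Fits H F.n w)
    (hk : k + H + 16 < 2 ^ w) (hp : p ≤ H) (h : SelectHyp F k w s σ)
    (hI : SelInv F.n k H F.par s Mk p 0 X σ) :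
    Runs w (selectPhase H p) σ ((selectPhase H p).rate * (F.n + 2))
      fun τ => ∃ X, SelInv F.n k H F.par s Mk p F.n X τ := by
  have hsmall := hf.small
  have hone := hf.one
  refine Runs.forLoop_rate (m := F.n) (by omega) (fun i τ => ∃ X, SelInv F.n k H F.par s Mk p i X τ)
    (by omega) hone (by simp [WritesReg]) ⟨X, hI⟩
    (fun i τ x ⟨X, h⟩ => ⟨X, h.count, h.count_le, h.mark, h.considered, h.chosen⟩)
    (fun τ hF => ?_) fun i hi τ hF hri ⟨X, hI⟩ => ?_
  · exact (hF.reg _ (by simp [WritesReg])).trans h.forest.n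
  · have hτ := h.of_frame hF (by simp [WritesReg]; omega) (by simp [WritesMem]; omega)
    have hU : (reg rU).eval w τ = i := by rw [eval_reg, hri]
    obtain ⟨hc1, hc2⟩ := hτ.col i hi
    have hlk : (Term.lookup (numColors H H) (Forested.segLen H) (cell aCol (reg rU))).eval w τ =
        s i := by
      have h1 := hf.col H le_rfl
      have h2 : numColors H H ≤ (F.n + 1) * numColors H H := Nat.le_mul_of_pos_left _ (by omega)
      have h3 := cell_eq aCol hU
      rw [Term.eval_lookup (by omega) _ hone (by rw [h3]; exact hc1), h3, hc2]
      intro κ _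
      have := Forested.segLen_le H κ
      omega
    have hpar : (cell aPar (reg rU)).eval w τ = F.par i := by rw [cell_eq _ hU, hτ.forest.par]
    have hpn := Forested.par_le (F := F) hi.le
    have hsel := cell_eq aSel hpar
    rw [hI.count _ hpn] at hsel
    set m := (X.filter fun c => F.par c = F.par i).card with hm
    have hcond : (selectCond H p).eval w τ = bit (s i = p ∧ m < k + H) := by
      rw [← bit_mul_bit]
      refine mul_eq ?_ ?_ (by rw [bit_mul_bit]; exact (bit_le_one _).trans_lt hone)
      · rw [eq_eq hlk (const_eq (by omega)) hone, ite_eq_bit]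
      · rw [lt_eq hsel (add_eq (by rw [eval_reg, hτ.reg_k]) (const_eq (by omega)) (by omega)) hone,
          ite_eq_bit]
    have hxX : s i = p → i ∉ X := fun hs hi' => by
      have := (hI.considered i hi').2
      omega
    rw [← mul_one (Program.rate _)]
    refine Runs.ite_rate le_rfl (fun hne => Runs.rate_mul le_rfl ?_)
      (fun hne => Runs.rate_mul le_rfl (Runs.skip ⟨X, hI.count, hI.count_le, hI.mark, ?_, ?_⟩))
    · obtain ⟨hs, hmk⟩ : s i = p ∧ m < k + H := by
        by_contra hcon
        exact hne (by rw [hcond, bit, if_neg hcon])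
      have hiX := hxX hs
      refine Runs.seq (Runs.store (u := F.par i) (v := m + 1)
        (Q := fun υ => υ = τ.setMem aSel (F.par i) (m + 1)) hpar
        (add_eq hsel (const_eq hone) (by omega)) rfl) fun υ hF' hυ => ?_
      subst hυ
      have hcard : ∀ q : ℕ → Prop, [DecidablePred q] → (X.filter q).card ≤
          ((insert i X).filter q).card := fun q _ =>
        Finset.card_le_card (Finset.filter_subset_filter _ (Finset.subset_insert _ _))
      have hfil : ∀ v, ((insert i X).filter fun c => F.par c = v).card =
          if F.par i = v then m + 1 else (X.filter fun c => F.par c = v).card := by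
        intro v
        rw [Finset.filter_insert]
        split_ifs with hv
        · rw [Finset.card_insert_of_notMem (by simp [hiX]), hm, hv]
        · rfl
      refine Runs.store (u := i) (v := 1) (by simp [hri]) (const_eq hone)
        ⟨insert i X, fun v hv => ?_, fun v => ?_, fun z => ?_, fun c hc => ?_, fun c hc hs' => ?_⟩
      · rw [State.setMem_mem, if_neg (by decide), State.setMem_mem, if_pos rfl,
          Function.update_apply, hfil v]
        by_cases hv' : F.par i = v
        · simp [hv']
        · rw [if_neg hv', if_neg (Ne.symm hv'), hI.count v hv]
      · rw [hfil v]
        split_ifs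
        · omega
        · exact hI.count_le v
      · rw [State.setMem_mem, if_pos rfl, Function.update_apply]
        split_ifs with hz
        · rw [bit, if_pos (by simp [hz])]
        · rw [State.setMem_mem, if_neg (by decide), hI.mark z]
          refine bit_congr ?_
          simp only [Finset.mem_union, Finset.mem_insert, hz, false_or]
      · rcases Finset.mem_insert.1 hc with rfl | hc
        · exact ⟨hi, Or.inr ⟨hs, by omega⟩⟩
        · have := hI.considered c hc
          exact ⟨this.1, by omega⟩
      · by_cases hci : c = i
        · exact Or.inl (by simp [hci])
        · rcases hI.chosen c hc (by omega) with h' | h'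
          · exact Or.inl (Finset.mem_insert_of_mem h')
          · exact Or.inr (h'.trans (hcard _))
    · intro c hc
      have := hI.considered c hc
      exact ⟨this.1, by omega⟩
    · intro c hc hs'
      by_cases hci : s i = p ∧ c = i
      · obtain ⟨hs, rfl⟩ := hci
        have hmk : k + H ≤ m := by
          by_contra hcon
          rw [hcond, bit, if_pos ⟨hs, by omega⟩] at hne
          exact one_ne_zero hne
        refine Or.inr (hmk.trans (le_of_eq ?_))
        rw [hm]
        congr 1
        refine Finset.filter_congr fun c' hc' => ?_
        have := (hI.considered c' hc').2
        constructor
        · exact fun h => ⟨h, by omega⟩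
        · exact fun h => h.1
      · refine hI.chosen c hc ?_
        rcases hs' with h' | ⟨h', h''⟩
        · exact Or.inl h'
        · refine Or.inr ⟨h', ?_⟩
          by_contra hcon
          obtain rfl : c = i := by omega
          exact hci ⟨h', rfl⟩

theorem selectPhase_writesReg {p r : ℕ} (h : (selectPhase H p).WritesReg r) : r = rU := by
  simpa [selectPhase, WritesReg] using h

theorem selectPhase_writesMem {p a : ℕ} (h : (selectPhase H p).WritesMem a) :
    a = aSel ∨ a = aMark := by
  simpa [selectPhase, WritesMem] using h

theorem selectBest_writesReg {r : ℕ} (h : (selectBest H).WritesReg r) : r = rU := by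
  simp only [selectBest, WritesReg, writesReg_forLoop, writesReg_seqs, List.mem_map,
    or_false] at h
  rcases h with h | ⟨_, ⟨i, _, rfl⟩, h⟩
  · exact h
  · exact selectPhase_writesReg h

theorem selectBest_writesMem {a : ℕ} (h : (selectBest H).WritesMem a) : a = aSel ∨ a = aMark := by
  simp only [selectBest, WritesMem, writesMem_forLoop, writesMem_seqs, List.mem_map] at h
  rcases h with h | ⟨_, ⟨i, _, rfl⟩, h⟩
  · exact Or.inl h
  · exact selectPhase_writesMem h

variable (F) in
/-- Each child with a positive score is marked, unless enough children of the same parent whose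
scores are not smaller are marked. -/
def Forested.SelectsFor (q : ℕ) (s : ℕ → ℕ) (Mk : Finset ℕ) : Prop :=
  ∀ c < F.n, 1 ≤ s c → c ∈ Mk ∨
    q ≤ ((Finset.range F.n).filter fun c' => c' ∈ Mk ∧ F.par c' = F.par c ∧ s c ≤ s c').card

theorem Forested.SelectsFor.mono {q : ℕ} {s : ℕ → ℕ} {Mk Mk' : Finset ℕ} (h : F.SelectsFor q s Mk)
    (hM : Mk ⊆ Mk') : F.SelectsFor q s Mk' := by
  intro c hc hs
  refine (h c hc hs).imp (fun h => hM h) fun h => h.trans (Finset.card_le_card fun z hz => ?_)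
  rw [Finset.mem_filter] at hz ⊢
  exact ⟨hz.1, hM hz.2.1, hz.2.2⟩

variable (F) in
/-- The number of marked children of `v`. -/
def Forested.markedChildren (Mk : Finset ℕ) (v : ℕ) : ℕ :=
  ((Finset.range F.n).filter fun c => c ∈ Mk ∧ F.par c = v).card

/-- The scores are considered from `H` down to `1`, so a vertex that is not marked has enough marked
siblings whose scores are not smaller. -/
theorem runs_selectBest {s : ℕ → ℕ} {Mk : Finset ℕ} {σ : State} (hf : Fits H F.n w)
    (hk : k + H + 16 < 2 ^ w) (h : SelectHyp F k w s σ) (hs : ∀ c < F.n, s c ≤ H)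
    (hM : ∀ z, σ.mem aMark z = bit (z ∈ Mk)) :
    Runs w (selectBest H) σ ((selectBest H).rate * (F.n + 2)) fun τ => ∃ Mk', Mk ⊆ Mk' ∧
      (∀ z, τ.mem aMark z = bit (z ∈ Mk')) ∧
      (∀ v, F.markedChildren Mk' v ≤ F.markedChildren Mk v + (k + H)) ∧
      F.SelectsFor (k + H) s Mk' := by
  have hsmall := hf.small
  refine Runs.seq_rate (R := fun τ => ∀ v < F.n + 1, τ.mem aSel v = 0) ?_ (fun τ hF hτ => ?_)
  · refine Runs.forLoop_rate (m := F.n + 1) (by omega) (fun i τ => ∀ u < i,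
      τ.mem aSel u = 0) (by omega) hf.one
      (by simp [WritesReg]) (by simp) (fun _ _ _ h => h) (fun τ hF => ?_)
      fun i hi τ hF hri hI => ?_
    · exact add_eq ((hF.reg _ (by simp [WritesReg])).trans h.forest.n) (const_eq (by omega))
        (by omega)
    · refine Runs.store (u := i) (v := 0) (by rw [eval_reg, hri]) (const_eq (by omega)) ?_
      intro j hj
      simp only [State.setMem_mem, if_true, Function.update_apply]
      split
      · rfl
      · exact hI j (by omega)
  · have h' := h.of_frame hF (by simp [WritesReg]; omega) (by simp [WritesMem]; omega)
    have hwr : ∀ r, (Program.seqs ((List.range H).map fun i => selectPhase H (H - i))).WritesReg r →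
      r = rU := fun r h => selectBest_writesReg (H := H) (Or.inr h)
    have hwm : ∀ r, (Program.seqs ((List.range H).map fun i => selectPhase H (H - i))).WritesMem r →
      r = aSel ∨ r = aMark := fun r h => selectBest_writesMem (H := H) (Or.inr h)
    refine (Runs.seqs (by omega) (fun i τ => ∃ X, SelInv F.n k H F.par s Mk (H - i) 0 X τ) H
      ⟨∅, fun v hv => ?_, by simp, fun z => ?_, by simp, fun c hc hsc => ?_⟩
      fun i hi υ hF' ⟨X, hυ⟩ => ?_).mono le_rfl fun υ hF' ⟨X, hX⟩ => ?_
    · rw [hτ v (by omega)]; simp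
    · rw [hF.mem _ (by simp [WritesMem]), hM z, Finset.union_empty]
    · have := hs c hc
      omega
    · have h2 := h'.of_frame hF' (fun r hr h => by have := hwr r h; omega)
        (fun r hr h => by have := hwm r h; omega)
      refine (runs_selectPhase hf hk (by omega) h2 hυ).mono le_rfl fun ρ _ ⟨X, hX⟩ => ⟨X, ?_⟩
      rw [show H - i = H - (i + 1) + 1 by omega] at hX
      exact hX.next
    · refine ⟨Mk ∪ X, Finset.subset_union_left, hX.mark, fun v => ?_, fun c hc hsc => ?_⟩
      · refine le_trans ?_ (Nat.add_le_add_left (hX.count_le v) _)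
        refine le_trans (Finset.card_le_card fun z hz => ?_) (Finset.card_union_le _ _)
        simp only [Finset.mem_filter, Finset.mem_union] at hz ⊢
        tauto
      · rw [Nat.sub_self] at hX
        refine (hX.chosen c hc (by omega)).imp (fun h => Finset.mem_union_right _ h) fun h =>
          h.trans (Finset.card_le_card fun z hz => ?_)
        simp only [Finset.mem_filter, Finset.mem_union, Finset.mem_range] at hz ⊢
        exact ⟨(hX.considered z hz.1).1, Or.inr hz.1, hz.2⟩

/-- Mark children of the best scores for the pair of attachments in the registers `rA`, `rB`. -/
noncomputable def selectPair (H : ℕ) : Program :=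
  .seq (setLabels H) (.seq (colorAll H) (selectBest H))

theorem setLabels_writesReg {r : ℕ} (h : (setLabels H).WritesReg r) : r = rU := by
  simpa [setLabels, WritesReg] using h

theorem setLabels_writesMem {a : ℕ} (h : (setLabels H).WritesMem a) : a = aX ∨ a = aY := by
  simpa [setLabels, WritesMem] using h

theorem selectPair_writesReg {r : ℕ} (h : (selectPair H).WritesReg r) : r = rU := by
  rcases h with h | h | h
  · exact setLabels_writesReg h
  · exact colorAll_writesReg h
  · exact selectBest_writesReg h

theorem selectPair_writesMem {a : ℕ} (h : (selectPair H).WritesMem a) : aX ≤ a ∧ a ≤ aMark := by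
  rcases h with h | h | h
  · have := setLabels_writesMem h; omega
  · have := colorAll_writesMem h; omega
  · have := selectBest_writesMem h; omega

theorem runs_selectPair {Mk : Finset ℕ} {σ : State} (h : HoldsLabels F k mods σ)
    (hf : Fits H F.n w) (hk : k + H + 16 < 2 ^ w) (hmods : ∀ i < k, mods i < F.n) {a b : ℕ}
    (hra : σ.reg rA = a) (hrb : σ.reg rB = b) (hM : ∀ z, σ.mem aMark z = bit (z ∈ Mk)) :
    Runs w (selectPair H) σ ((selectPair H).rate * (F.n + 2)) fun τ => ∃ Mk', Mk ⊆ Mk' ∧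
      (∀ z, τ.mem aMark z = bit (z ∈ Mk')) ∧
      (∀ v, F.markedChildren Mk' v ≤ F.markedChildren Mk v + (k + H)) ∧
      F.SelectsFor (k + H) (F.score k mods a b) Mk' := by
  refine (runs_setLabels h hf hk hmods hra hrb).seq_rate fun τ hF hτ => ?_
  have h1 := h.of_frame hF (fun r hr h => by have := setLabels_writesReg h; omega)
    (fun r hr h => by have := setLabels_writesMem h; omega)
  refine (runs_colorAll hf (F.attach_le_one k mods a) (F.attach_le_one k mods b)
    h1.toHoldsForest hτ).seq_rate fun υ hF' hυ => ?_
  have h2 := h1.of_frame hF' (fun r hr h => by have := colorAll_writesReg h; omega)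
    (fun r hr h => by have := colorAll_writesMem h; omega)
  refine runs_selectBest hf hk ⟨h2.toHoldsForest, h2.reg_k, fun u hu => ?_⟩
    (fun c _ => Forested.segLen_le _ _) fun z => ?_
  · rw [hυ u hu]
    exact ⟨Forested.color_lt (F.attach_le_one k mods a) (F.attach_le_one k mods b) _ _, rfl⟩
  · rw [hF'.mem _ (fun h => by have := colorAll_writesMem h; omega),
      hF.mem _ (fun h => by have := setLabels_writesMem h; omega), hM]

/-- Mark children of the best scores for all pairs of attachments. -/
noncomputable def selectAll (H : ℕ) : Program :=
  forLoop rB (reg rK + const (H + 1)) (forLoop rA (reg rB + const 1) (selectPair H))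

theorem selectAll_writesReg {r : ℕ} (h : (selectAll H).WritesReg r) :
    r = rU ∨ r = rA ∨ r = rB := by
  simp only [selectAll, writesReg_forLoop] at h
  rcases h with h | h | h
  · omega
  · omega
  · exact Or.inl (selectPair_writesReg h)

theorem selectAll_writesMem {a : ℕ} (h : (selectAll H).WritesMem a) : aX ≤ a ∧ a ≤ aMark := by
  simp only [selectAll, writesMem_forLoop] at h
  exact selectPair_writesMem h

/-- An upper bound for the number of marked children of a vertex. -/
def markBound (H k : ℕ) : ℕ := (k + H) * ∑ b ∈ Finset.range (k + H + 1), (b + 1)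

/-- The pairs `a ≤ b` of attachments suffice, because segments can be reversed. -/
theorem runs_selectAll {σ : State} (h : HoldsLabels F k mods σ)
    (hf : Fits H F.n w) (hk : k + H + 16 < 2 ^ w) (hmods : ∀ i < k, mods i < F.n)
    (hM : ∀ z, σ.mem aMark z = 0) :
    Runs w (selectAll H) σ ((selectAll H).rate * ((F.n + 2) * (k + H + 2) * (k + H + 2)))
      fun τ => ∃ Mk, (∀ z, τ.mem aMark z = bit (z ∈ Mk)) ∧
      (∀ v, F.markedChildren Mk v ≤ markBound H k) ∧ F.Selects k mods Mk := by
  have hone := hf.one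
  refine (Runs.forLoop_const (m := k + H + 1) le_rfl (fun i τ => ∃ Mk : Finset ℕ,
    (∀ z, τ.mem aMark z = bit (z ∈ Mk)) ∧
    (∀ v, F.markedChildren Mk v ≤ (k + H) * ∑ b ∈ Finset.range i, (b + 1)) ∧
    ∀ b < i, ∀ a ≤ b, F.SelectsFor (k + H) (F.score k mods a b) Mk) (by omega) hone
    (fun h => ?_) ⟨∅, fun z => ?_, fun v => ?_, by simp⟩ (fun _ _ _ h => h) (fun τ hF => ?_)
    (fun i hi τ hF hri ⟨Mk, h1, h2, h3⟩ => ?_) (Nat.mul_pos (by omega) (by omega))).mono le_rfl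
    fun τ _ ⟨Mk, h1, h2, h3⟩ =>
      ⟨Mk, h1, h2, fun a b hab hb c hc => h3 b (by omega) a hab c hc⟩
  · rw [writesReg_forLoop] at h
    rcases h with h | h
    · omega
    · have := selectPair_writesReg h; omega
  · rw [hM, bit, if_neg (by simp)]
  · simp [Forested.markedChildren]
  · have := (hF.reg rK (fun h => by have := selectAll_writesReg h; omega)).trans h.reg_k
    exact add_eq (a := k) (b := H + 1) (by rw [eval_reg, this]) (const_eq (by omega)) (by omega)
  · have hτ := h.of_frame hF (fun r hr h => by have := selectAll_writesReg h; omega)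
      (fun r hr h => by have := selectAll_writesMem h; omega)
    have hwr : ∀ r, (forLoop rA (reg rB + const 1) (selectPair H)).WritesReg r →
        r = rA ∨ r = rU := fun r h => by
      rw [writesReg_forLoop] at h
      exact h.imp id fun h => selectPair_writesReg h
    have hwm : ∀ r, (forLoop rA (reg rB + const 1) (selectPair H)).WritesMem r →
        aX ≤ r ∧ r ≤ aMark := fun r h => by
      rw [writesMem_forLoop] at h
      exact selectPair_writesMem h
    refine (Runs.forLoop_const (m := i + 1) (by omega) (fun j τ => ∃ Mk : Finset ℕ,
      (∀ z, τ.mem aMark z = bit (z ∈ Mk)) ∧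
      (∀ v, F.markedChildren Mk v ≤ (k + H) * (∑ b ∈ Finset.range i, (b + 1) + j)) ∧
      (∀ b < i, ∀ a ≤ b, F.SelectsFor (k + H) (F.score k mods a b) Mk) ∧
      ∀ a < j, F.SelectsFor (k + H) (F.score k mods a i) Mk) (by omega) hone
      (fun h => by have := selectPair_writesReg h; omega) ⟨Mk, h1, h2, h3, by simp⟩
      (fun _ _ _ h => h) (fun υ hF' => ?_) (fun j hj υ hF' hrj ⟨Mk, h1, h2, h3, h4⟩ => ?_)
      (by omega)).mono le_rfl fun υ _ ⟨Mk, h1, h2, h3, h4⟩ => ⟨Mk, h1, fun v => ?_,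
        fun b hb a hab => ?_⟩
    · have := (hF'.reg rB (fun h => by have := hwr _ h; omega)).trans hri
      exact add_eq (by rw [eval_reg, this]) (const_eq (by omega)) (by omega)
    · have hυ := hτ.of_frame hF' (fun r hr h => by have := hwr _ h; omega)
        (fun r hr h => by have := hwm _ h; omega)
      have hrB := (hF'.reg rB (fun h => by have := hwr _ h; omega)).trans hri
      refine (runs_selectPair hυ hf hk hmods hrj hrB h1).mono le_rfl
        fun ρ _ ⟨Mk', g0, g1, g2, g3⟩ => ⟨Mk', g1, fun v => ?_, fun b hb a hab =>
          (h3 b hb a hab).mono g0, fun a ha => ?_⟩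
      · refine (g2 v).trans ((Nat.add_le_add_right (h2 v) _).trans (le_of_eq (by ring)))
      · rcases Nat.lt_succ_iff_lt_or_eq.1 ha with ha | rfl
        · exact (h4 a ha).mono g0
        · exact g3
    · rw [Finset.sum_range_succ]; exact h2 v
    · rcases Nat.lt_succ_iff_lt_or_eq.1 hb with hb | rfl
      · exact h3 b hb a hab
      · exact h4 a (by omega)

end
end LPKernel

namespace LPKernel
open Program
open Term (const reg cell const_eq cell_eq add_eq sub_eq mul_eq lt_eq eq_eq eval_reg)

/-! ### Depths, and the vertices that are kept -/

theorem sum_bit (m : ℕ) (p : ℕ → Prop) [DecidablePred p] :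
    ((List.range m).map fun j => bit (p j)).sum = ((Finset.range m).filter p).card := by
  rw [Finset.card_filter, ← List.toFinset_range, List.sum_toFinset _ List.nodup_range]
  congr 1
  exact List.map_congr_left fun j _ => (ite_eq_bit _).symm

/-- The number of indices `j < m` for which the expression `f j` has the value `1`. -/
theorem eval_sum_bit {w m : ℕ} {σ : State} {f : ℕ → Term} {p : ℕ → Prop} [DecidablePred p]
    (h : ∀ j < m, (f j).eval w σ = bit (p j)) (hm : m < 2 ^ w) :
    (Term.sum ((List.range m).map f)).eval w σ = ((Finset.range m).filter p).card := by
  have h1 : ((List.range m).map f).map (Term.eval w σ) =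
      (List.range m).map fun j => bit (p j) := by
    rw [List.map_map]
    exact List.map_congr_left fun j hj => h j (List.mem_range.1 hj)
  have h2 : ((Finset.range m).filter p).card ≤ m :=
    (Finset.card_filter_le _ _).trans (by simp)
  rw [Term.eval_sum _ (by rw [h1, sum_bit]; omega), h1, sum_bit]

section
variable {H k w : ℕ} {F : Forested H} {mods : ℕ → ℕ}

/-- Compute the depths of all vertices. -/
def setDepths (H : ℕ) : Program :=
  forLoop rU (reg rN + const 1) (.store aDep (reg rU)
    (Term.sum ((List.range H).map fun j => .op .lt (anc j (reg rU)) (reg rN))))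

theorem runs_setDepths {σ : State} (h : HoldsForest F σ) (hf : Fits H F.n w) (hH : H < 2 ^ w) :
    Runs w (setDepths H) σ ((setDepths H).rate * (F.n + 2)) fun τ =>
      ∀ u, F.W u ∨ u = F.n → τ.mem aDep u = F.dep u := by
  classical
  have hsmall := hf.small
  refine (Runs.forLoop_rate (m := F.n + 1) (by omega) (fun i τ => ∀ u < i, F.W u ∨ u = F.n →
      τ.mem aDep u = F.dep u) (by omega) hf.one
      (by simp [WritesReg]) (by simp) (fun _ _ _ h => h) (fun τ hF => ?_)
      fun i hi τ hF hri hI => ?_).mono le_rfl fun τ _ h u hu => h u ?_ hu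
  · exact add_eq ((hF.reg _ (by simp [WritesReg])).trans h.n) (const_eq (by omega)) (by omega)
  · have hτ := h.of_frame hF (by simp [WritesReg]) (by simp [WritesMem]) (by simp [WritesMem])
    have hU : (reg rU).eval w τ = i := by rw [eval_reg, hri]
    refine Runs.store (u := i) (v := ((Finset.range H).filter fun j => F.par^[j] i < F.n).card) hU
      (eval_sum_bit (fun j _ => ?_) hH) ?_
    · rw [lt_eq (hτ.anc_eq hU j) (by rw [eval_reg, hτ.n]) hf.one, ite_eq_bit]
    · intro u hu hW
      simp only [State.setMem_mem, if_true, Function.update_apply]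
      split_ifs with hui
      · subst hui
        rcases hW with hW | rfl
        · have hle := F.dep_le hW
          rw [← Finset.card_range (F.dep u)]
          congr 1
          ext j
          simp only [Finset.mem_filter, Finset.mem_range]
          constructor
          · rintro ⟨_, h2⟩
            by_contra hcon
            rw [Forested.iterate_of_dep_le hW (by omega)] at h2
            omega
          · exact fun hj => ⟨by omega, F.W_lt (Forested.iterate_W hW hj).1⟩
        · rw [F.dep_top, Finset.card_eq_zero, Finset.filter_eq_empty_iff]
          intro j _
          rw [Forested.iterate_top]; omega
      · exact hI u (by omega) hW
  · rcases hu with hu | rfl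
    · have := F.W_lt hu; omega
    · omega

/-- Determine the vertices all of whose ancestors are marked. -/
def setKept (H : ℕ) : Program :=
  forLoop rU (reg rN) (.store aKeep (reg rU) (.op .eq (Term.sum ((List.range H).map fun j =>
    .op .lt (const 0) (cell aMark (anc j (reg rU)) +
      .op .eq (anc (j + 1) (reg rU)) (anc j (reg rU))))) (const H)))

theorem Forested.kept_iff {Mk : Finset ℕ} {u : ℕ} (hu : u < F.n) :
    F.Kept Mk u ↔ ∀ j < H, F.par^[j] u ∈ Mk ∨ F.par^[j + 1] u = F.par^[j] u := by
  by_cases hW : F.W u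
  · constructor
    · intro h j _
      by_cases hj : j < F.dep u
      · exact Or.inl (h j (Forested.iterate_W hW hj).1)
      · rw [Forested.iterate_of_dep_le hW (by omega), Forested.iterate_of_dep_le hW (by omega)]
        exact Or.inr rfl
    · intro h j hj
      have hlt : j < F.dep u := by
        by_contra hcon
        rw [Forested.iterate_of_dep_le hW (by omega)] at hj
        exact Forested.not_W_top hj
      refine (h j (hlt.trans_le (F.dep_le hW))).resolve_right fun h' => ?_
      rw [Function.iterate_succ_apply'] at h'
      have h1 := F.dep_W hj
      rw [h'] at h1
      omega
  · have hfix : ∀ j, F.par^[j] u = u := Function.iterate_fixed (F.par_of_not hu hW)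
    simp only [hfix, or_true, implies_true, iff_true]
    intro j hj
    rw [hfix] at hj ⊢
    exact absurd hj hW

theorem runs_setKept {Mk : Finset ℕ} {σ : State} (h : HoldsForest F σ) (hf : Fits H F.n w)
    (hH : H < 2 ^ w) (hM : ∀ z, σ.mem aMark z = bit (z ∈ Mk)) :
    Runs w (setKept H) σ ((setKept H).rate * (F.n + 2)) fun τ =>
      ∀ u < F.n, τ.mem aKeep u = bit (F.Kept Mk u) := by
  classical
  have hsmall := hf.small
  have hone := hf.one
  refine Runs.forLoop_rate (m := F.n) (by omega) (fun i τ => ∀ u < i,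
      τ.mem aKeep u = bit (F.Kept Mk u)) (by omega) hf.one
      (by simp [WritesReg]) (by simp) (fun _ _ _ h => h) (fun τ hF => ?_)
      fun i hi τ hF hri hI => ?_
  · exact (hF.reg _ (by simp [WritesReg])).trans h.n
  · have hτ := h.of_frame hF (by simp [WritesReg]) (by simp [WritesMem]) (by simp [WritesMem])
    have hU : (reg rU).eval w τ = i := by rw [eval_reg, hri]
    refine Runs.store (u := i) (v := bit (F.Kept Mk i)) hU ?_ ?_
    · rw [eq_eq (eval_sum_bit (p := fun j => F.par^[j] i ∈ Mk ∨ F.par^[j + 1] i = F.par^[j] i)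
        (fun j _ => ?_) hH) (const_eq hH) hone, ite_eq_bit]
      · refine bit_congr ?_
        rw [Forested.kept_iff hi]
        constructor
        · intro h j hj
          have h2 := Finset.eq_of_subset_of_card_le (Finset.filter_subset _ (Finset.range H))
            (by rw [h, Finset.card_range])
          rw [Finset.filter_eq_self] at h2
          exact h2 j (Finset.mem_range.2 hj)
        · intro h
          rw [Finset.filter_true_of_mem fun j hj => h j (Finset.mem_range.1 hj), Finset.card_range]
      · have h1 := eq_eq (hτ.anc_eq hU (j + 1)) (hτ.anc_eq hU j) hone
        have h2 := cell_eq aMark (hτ.anc_eq hU j)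
        rw [ite_eq_bit] at h1
        rw [hF.mem _ (by simp [WritesMem]), hM] at h2
        have b1 := bit_le_one (F.par^[j] i ∈ Mk)
        have b2 := bit_le_one (F.par^[j + 1] i = F.par^[j] i)
        rw [lt_eq (const_eq (by omega)) (add_eq h2 h1 (by omega)) hone, ite_eq_bit]
        refine bit_congr ?_
        unfold bit
        split_ifs <;> simp_all
    · intro u hu
      simp only [State.setMem_mem, if_true, Function.update_apply]
      split_ifs with hui
      · rw [hui]
      · exact hI u (by omega)

/-- From the forest, compute the set of vertices that are kept. -/
noncomputable def computeKept (H : ℕ) : Program :=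
  .seq (setDepths H) (.seq (selectAll H) (setKept H))

theorem computeKept_writesMem {a : ℕ} (h : (computeKept H).WritesMem a) :
    aDep ≤ a ∧ a ≤ aKeep := by
  rcases h with h | h | h
  · have : a = aDep := by simpa [setDepths, WritesMem] using h
    omega
  · have := selectAll_writesMem h; omega
  · have : a = aKeep := by simpa [setKept, WritesMem] using h
    omega

theorem computeKept_writesReg {r : ℕ} (h : (computeKept H).WritesReg r) :
    r = rU ∨ r = rA ∨ r = rB := by
  rcases h with h | h | h
  · have : r = rU := by simpa [setDepths, WritesReg] using h
    omega
  · exact selectAll_writesReg h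
  · have : r = rU := by simpa [setKept, WritesReg] using h
    omega

theorem runs_computeKept {σ : State} (h : HoldsForest F σ) (hK : σ.reg rK = k)
    (hm : ∀ i < k, σ.mem aIn (3 + i) = mods i) (hf : Fits H F.n w) (hk : k + H + 16 < 2 ^ w)
    (hmods : ∀ i < k, mods i < F.n) (hM : ∀ z, σ.mem aMark z = 0) :
    Runs w (computeKept H) σ ((computeKept H).rate * ((F.n + 2) * (k + H + 2) * (k + H + 2)))
      fun τ => ∃ Mk, (∀ u < F.n, τ.mem aKeep u = bit (F.Kept Mk u)) ∧
        (∀ v, F.markedChildren Mk v ≤ markBound H k) ∧ F.Selects k mods Mk := by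
  have hle : F.n + 2 ≤ (F.n + 2) * (k + H + 2) * (k + H + 2) := by
    rw [mul_assoc]
    exact Nat.le_mul_of_pos_right _ (Nat.mul_pos (by omega) (by omega))
  have hdr : ∀ r, (setDepths H).WritesReg r → r = rU := by simp [setDepths, WritesReg]
  have hdm : ∀ r, (setDepths H).WritesMem r → r = aDep := by simp [setDepths, WritesMem]
  refine ((runs_setDepths h hf (by omega)).mono (Nat.mul_le_mul_left _ hle)
    fun _ _ h => h).seq_rate fun τ hF hτ => ?_
  have h1 : HoldsLabels F k mods τ :=
    { toHoldsForest := h.of_frame hF (fun h => by have := hdr _ h; omega)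
        (fun h => by have := hdm _ h; omega) (fun h => by have := hdm _ h; omega)
      reg_k := (hF.reg _ (fun h => by have := hdr _ h; omega)).trans hK
      mem_mods := fun i hi => by
        rw [hF.mem _ (fun h => by have := hdm _ h; omega)]; exact hm i hi
      mem_dep := hτ }
  refine (runs_selectAll h1 hf hk hmods fun z => ?_).seq_rate fun υ hF' ⟨Mk, g1, g2, g3⟩ => ?_
  · rw [hF.mem _ (fun h => by have := hdm _ h; omega)]; exact hM z
  · have h2 := h1.of_frame hF' (fun r hr h => by have := selectAll_writesReg h; omega)
      (fun r hr h => by have := selectAll_writesMem h; omega)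
    exact (runs_setKept h2.toHoldsForest hf (by omega) g1).mono (Nat.mul_le_mul_left _ hle)
      fun ρ _ hρ => ⟨Mk, hρ, g2, g3⟩

end
end LPKernel

namespace LPKernel
open Program
open Term (const reg cell const_eq cell_eq add_eq sub_eq mul_eq lt_eq eq_eq eval_reg)

/-! ### Reading the input -/

/-- The rule for `forLoop` with a body whose running time is proportional to `c i` in round `i`. -/
theorem Runs.forLoop_sum {w : ℕ} {r : ℕ} {bound : Term} {body : Program} {σ : State} {m : ℕ}
    {c : ℕ → ℕ} {N : ℕ} (hN : ∑ i ∈ Finset.range m, c i + 1 ≤ N) (Inv : ℕ → State → Prop)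
    (hm : m < 2 ^ w) (hw : 1 < 2 ^ w) (hr : ¬ body.WritesReg r) (h0 : Inv 0 σ)
    (hset : ∀ i τ x, Inv i τ → Inv i (τ.setReg r x))
    (hb : ∀ τ, Frame (.forLoop r bound body) σ τ → bound.eval w τ = m)
    (hbody : ∀ i < m, ∀ τ, Frame (.forLoop r bound body) σ τ → τ.reg r = i → Inv i τ →
      Runs w body τ (body.rate * c i) (Inv (i + 1))) (hc : ∀ i, 1 ≤ c i) :
    Runs w (.forLoop r bound body) σ ((Program.forLoop r bound body).rate * N) (Inv m) := by
  refine (Runs.forLoop (fun i => body.rate * c i) Inv hm hw hr h0 hset hb hbody).mono ?_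
    fun _ _ h => h
  have h1 : (Program.forLoop r bound body).rate = body.rate + (bound.cost + 9) := by
    simp only [Program.forLoop, Program.rate, Term.cost]
    omega
  rw [h1]
  refine le_trans ?_ (Nat.mul_le_mul_left _ hN)
  rw [mul_add, mul_one, Finset.mul_sum]
  have h2 : ∑ i ∈ Finset.range m, (body.rate * c i + bound.cost + 7) ≤
      ∑ i ∈ Finset.range m, (body.rate + (bound.cost + 9)) * c i := by
    refine Finset.sum_le_sum fun i _ => ?_
    rw [add_mul]
    have := Nat.le_mul_of_pos_right (bound.cost + 9) (hc i)
    omega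
  omega

/-- The sequence `x` consists of the numbers `n`, `k`, `ℓ`, the list `mods` of length `k`, and, for
each `u < n`, the number `deg u` followed by the numbers `nb u j` for `j < deg u`, which begin at
the position `start u`. -/
structure Source (n k ℓ : ℕ) (mods start deg : ℕ → ℕ) (nb : ℕ → ℕ → ℕ) (x : ℕ → ℕ) : Prop where
  n_eq : x 0 = n
  k_eq : x 1 = k
  l_eq : x 2 = ℓ
  mods_eq : ∀ i < k, x (3 + i) = mods i
  start_zero : start 0 = 3 + k
  start_succ : ∀ u < n, start (u + 1) = start u + deg u + 1
  deg_eq : ∀ u < n, x (start u) = deg u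
  nb_eq : ∀ u < n, ∀ j < deg u, x (start u + 1 + j) = nb u j

theorem Source.le_start {n k ℓ : ℕ} {mods start deg : ℕ → ℕ} {nb : ℕ → ℕ → ℕ} {x : ℕ → ℕ}
    (h : Source n k ℓ mods start deg nb x) : 3 + k ≤ start n ∧
      ∀ u < n, start u + deg u + 1 ≤ start n := by
  have : ∀ m ≤ n, 3 + k ≤ start m ∧ ∀ u < m, start u + deg u + 1 ≤ start m := by
    intro m
    induction m with
    | zero => exact fun _ => ⟨h.start_zero.ge, fun u hu => absurd hu (Nat.not_lt_zero u)⟩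
    | succ m ih =>
      intro hm
      obtain ⟨h1, h2⟩ := ih (by omega)
      have h3 := h.start_succ m hm
      refine ⟨by omega, fun u hu => ?_⟩
      rcases Nat.lt_succ_iff_lt_or_eq.1 hu with hu | rfl
      · have := h2 u hu; omega
      · omega
  exact this n le_rfl

theorem Source.start_eq {n k ℓ : ℕ} {mods start deg : ℕ → ℕ} {nb : ℕ → ℕ → ℕ} {x : ℕ → ℕ}
    (h : Source n k ℓ mods start deg nb x) :
    start n = 3 + k + ∑ u ∈ Finset.range n, (deg u + 1) := by
  have : ∀ m ≤ n, start m = 3 + k + ∑ u ∈ Finset.range m, (deg u + 1) := by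
    intro m
    induction m with
    | zero => intro _; simpa using h.start_zero
    | succ m ih =>
      intro hm
      rw [h.start_succ m hm, ih (by omega), Finset.sum_range_succ]; ring
  exact this n le_rfl

/-- A number of modulator vertices below `K` is replaced by `0`. -/
def effective (K k : ℕ) : ℕ := if k < K then 0 else k

/-- Read the three numbers at the beginning of the input. -/
def readHeader (K : ℕ) : Program :=
  .seq (.assign rN (cell aIn (const 0))) (.seq (.assign rKraw (cell aIn (const 1)))
    (.seq (.assign rL (cell aIn (const 2)))
      (.seq (.assign rK ((const 1 - .op .lt (reg rKraw) (const K)) * reg rKraw))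
        (.assign rPos (const 3 + reg rKraw)))))

/-- Mark the vertices of the modulator as visited. -/
def readMods : Program :=
  forLoop rU (reg rK) (.store aVis (cell aIn (const 3 + reg rU)) (const 1))

/-- Read the list of neighbours of one vertex, and make the vertex its own parent. -/
def readRow : Program :=
  .seq (.store aStart (reg rU) (reg rPos))
    (.seq (forLoop rJ (cell aIn (reg rPos))
      (.store aMat (matIdx (reg rU) (cell aIn (reg rPos + const 1 + reg rJ))) (const 1)))
      (.seq (.assign rPos (reg rPos + cell aIn (reg rPos) + const 1))
        (.store aPar (reg rU) (reg rU))))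

/-- Append the list of neighbours of an artificial vertex, which is adjacent to all vertices and
serves as the root of the search. -/
def addRoot : Program :=
  .seq (.store aStart (reg rN) (reg rPos)) (.seq (.store aIn (reg rPos) (reg rN))
    (.seq (forLoop rU (reg rN) (.store aIn (reg rPos + const 1 + reg rU) (reg rU)))
      (.seq (.store aPar (reg rN) (reg rN)) (.assign rCur (reg rN)))))

section
variable {w n k ℓ K : ℕ} {mods start deg : ℕ → ℕ} {nb : ℕ → ℕ → ℕ}

/-- What the registers contain after reading the beginning of the input. -/
structure HoldsHeader (n k ℓ K : ℕ) (σ : State) : Prop where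
  reg_n : σ.reg rN = n
  reg_kraw : σ.reg rKraw = k
  reg_l : σ.reg rL = ℓ
  reg_k : σ.reg rK = effective K k

theorem HoldsHeader.of_frame {σ τ : State} {p : Program} (h : HoldsHeader n k ℓ K σ)
    (hF : Frame p σ τ) (hr : ∀ r ≤ 3, ¬ p.WritesReg r) : HoldsHeader n k ℓ K τ where
  reg_n := (hF.reg _ (hr _ (by omega))).trans h.reg_n
  reg_kraw := (hF.reg _ (hr _ (by omega))).trans h.reg_kraw
  reg_l := (hF.reg _ (hr _ (by omega))).trans h.reg_l
  reg_k := (hF.reg _ (hr _ (by omega))).trans h.reg_k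

theorem runs_readHeader {σ : State} (h : Source n k ℓ mods start deg nb (σ.mem aIn))
    (hw : start n + n + 16 < 2 ^ w) (hK : K < 2 ^ w) :
    Runs w (readHeader K) σ (readHeader K).rate
      fun τ => HoldsHeader n k ℓ K τ ∧ τ.reg rPos = 3 + k := by
  have hst := h.le_start.1
  refine Runs.seq (Runs.assign (v := n) (Q := fun τ => τ = σ.setReg rN n) ?_ rfl) fun τ _ hτ => ?_
  · rw [cell_eq _ (const_eq (by omega)), h.n_eq]
  subst hτ
  refine Runs.seq (Runs.assign (v := k)
    (Q := fun τ => τ = (σ.setReg rN n).setReg rKraw k) ?_ rfl) fun τ _ hτ => ?_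
  · rw [cell_eq _ (const_eq (by omega)), State.setReg_mem, h.k_eq]
  subst hτ
  refine Runs.seq (Runs.assign (v := ℓ)
    (Q := fun τ => τ = ((σ.setReg rN n).setReg rKraw k).setReg rL ℓ) ?_ rfl) fun τ _ hτ => ?_
  · rw [cell_eq _ (const_eq (by omega)), State.setReg_mem, State.setReg_mem, h.l_eq]
  refine Runs.seq (Runs.assign (v := effective K k)
    (Q := fun υ => υ = τ.setReg rK (effective K k)) ?_ rfl) fun υ _ hυ => ?_
  · have hk : (reg rKraw).eval w τ = k := by rw [eval_reg, hτ]; simp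
    have h1 := sub_eq (const_eq (c := 1) (w := w) (σ := τ) (by omega))
      (lt_eq hk (const_eq hK) (by omega)) (by omega)
    unfold effective
    refine (mul_eq h1 hk ?_).trans ?_
    · split <;> omega
    · split <;> simp
  subst hυ hτ
  refine Runs.assign (v := 3 + k) (add_eq (const_eq (by omega)) (by simp) (by omega))
    ⟨⟨?_, ?_, ?_, ?_⟩, ?_⟩ <;> simp

theorem runs_readMods {σ : State} (h : Source n k ℓ mods start deg nb (σ.mem aIn))
    (hh : HoldsHeader n k ℓ K σ) (hw : start n + n + 16 < 2 ^ w) (hvis : ∀ u, σ.mem aVis u = 0) :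
    Runs w readMods σ (readMods.rate * (k + 1))
      fun τ => ∀ u, τ.mem aVis u ≠ 0 ↔ ∃ i < effective K k, mods i = u := by
  have hst := h.le_start.1
  have hek : effective K k ≤ k := by unfold effective; split <;> omega
  refine Runs.forLoop_rate (m := effective K k) (by omega)
    (fun i τ => ∀ u, τ.mem aVis u ≠ 0 ↔ ∃ i' < i, mods i' = u) (by omega) (by omega)
    (by simp [WritesReg]) (by simpa using hvis) (fun _ _ _ h => h) (fun τ hF => ?_)
    fun i hi τ hF hri hI => ?_
  · exact (hF.reg _ (by simp [WritesReg])).trans hh.reg_k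
  · refine Runs.store (u := mods i) (v := 1) ?_ (const_eq (by omega)) ?_
    · rw [cell_eq _ (add_eq (const_eq (c := 3) (by omega)) (by rw [eval_reg, hri]) (by omega)),
        hF.mem _ (by simp [WritesMem]), h.mods_eq i (by omega)]
    · intro u
      simp only [State.setMem_mem, if_true, Function.update_apply]
      split_ifs with hu
      · exact ⟨fun _ => ⟨i, by omega, hu.symm⟩, fun _ => one_ne_zero⟩
      · rw [hI u]
        constructor
        · rintro ⟨i', h1, h2⟩; exact ⟨i', by omega, h2⟩
        · rintro ⟨i', h1, h2⟩
          refine ⟨i', ?_, h2⟩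
          by_contra hcon
          obtain rfl : i' = i := by omega
          exact hu h2.symm

/-- The state after reading the neighbours of the vertices below `i`. -/
structure RowsRead (n : ℕ) (Adj : ℕ → ℕ → Prop) (start : ℕ → ℕ) (i : ℕ) (τ : State) : Prop where
  pos : τ.reg rPos = start i
  starts : ∀ u < i, τ.mem aStart u = start u
  par : ∀ u < i, τ.mem aPar u = u
  mat : ∀ u < n, ∀ v ≤ n, τ.mem aMat (u * (n + 1) + v) = bit (u < i ∧ Adj u v)

theorem runs_readRow {Adj : ℕ → ℕ → Prop} {σ : State} {i : ℕ}
    (h : Source n k ℓ mods start deg nb (σ.mem aIn)) (hA : AdjLists n Adj nb deg)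
    (hn : σ.reg rN = n) (hw : start n + n + 16 < 2 ^ w) (hmat : (n + 1) * (n + 1) < 2 ^ w)
    (hi : i < n) (hri : σ.reg rU = i) (hI : RowsRead n Adj start i σ) :
    Runs w readRow σ (readRow.rate * (deg i + 2)) (RowsRead n Adj start (i + 1)) := by
  have hst := h.le_start.2 i hi
  have hsq : n + 1 ≤ (n + 1) * (n + 1) := Nat.le_mul_of_pos_left _ (by omega)
  refine Runs.seq_rate (R := fun τ => ∀ u < i + 1, τ.mem aStart u = start u)
    (Runs.rate_mul (by omega) (Runs.store (u := i) (v := start i) hri hI.pos ?_))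
    fun τ hF hτ => ?_
  · intro u hu
    simp only [State.setMem_mem, if_true, Function.update_apply]
    split_ifs with h'
    · rw [h']
    · exact hI.starts u (by omega)
  have hτn : τ.reg rN = n := (hF.reg _ (by simp [WritesReg])).trans hn
  have hτi : τ.reg rU = i := (hF.reg _ (by simp [WritesReg])).trans hri
  have hτp : τ.reg rPos = start i := (hF.reg _ (by simp [WritesReg])).trans hI.pos
  have hτin : τ.mem aIn = σ.mem aIn := hF.mem _ (by simp [WritesMem])
  refine (Runs.forLoop_rate (m := deg i) (by omega) (fun j υ => ∀ u < n, ∀ v ≤ n,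
    υ.mem aMat (u * (n + 1) + v) = bit (u < i ∧ Adj u v ∨ u = i ∧ ∃ j' < j, nb i j' = v))
    (by omega) (by omega) (by simp [WritesReg]) (fun u hu v hv => ?_) (fun _ _ _ h => h)
    (fun υ hF' => ?_) fun j hj υ hF' hrj hυ => ?_).seq_rate fun υ hF' hυ => ?_
  · rw [hF.mem _ (by simp [WritesMem]), hI.mat u hu v hv]
    exact bit_congr (by simp)
  · rw [cell_eq (i := reg rPos) (j := start i) _ ((hF'.reg _ (by simp [WritesReg])).trans hτp),
      hF'.mem _ (by simp [WritesMem]), hτin, h.deg_eq i hi]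
  · have hlt := hA.nb_lt hi.le hj
    have h1 := add_mul_lt (a := i) (n := n + 1) (b := nb i j) (s := n + 1) (by omega) (by omega)
    have h2 : (cell aIn (reg rPos + const 1 + reg rJ)).eval w υ = nb i j := by
      rw [cell_eq (j := start i + 1 + j), hF'.mem _ (by simp [WritesMem]), hτin, h.nb_eq i hi j hj]
      exact add_eq (add_eq ((hF'.reg _ (by simp [WritesReg])).trans hτp) (const_eq (by omega))
        (by omega)) hrj (by omega)
    refine Runs.store (u := i * (n + 1) + nb i j) (v := 1) ?_ (const_eq (by omega)) ?_
    · exact add_eq (mul_eq ((hF'.reg _ (by simp [WritesReg])).trans hτi)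
        (add_eq ((hF'.reg _ (by simp [WritesReg])).trans hτn) (const_eq (by omega)) (by omega))
        (by omega)) h2 (by omega)
    · intro u hu v hv
      simp only [State.setMem_mem, if_true, Function.update_apply]
      split_ifs with he
      · obtain ⟨rfl, rfl⟩ := add_mul_inj (by omega) (by omega) he
        exact (bit_eq_one.2 (Or.inr ⟨rfl, j, by omega, rfl⟩)).symm
      · rw [hυ u hu v hv]
        refine bit_congr (or_congr_right (and_congr_right fun hui => ?_))
        constructor
        · rintro ⟨j', h1, h2⟩; exact ⟨j', by omega, h2⟩
        · rintro ⟨j', h1, h2⟩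
          refine ⟨j', ?_, h2⟩
          by_contra hcon
          obtain rfl : j' = j := by omega
          exact he (by rw [hui, ‹nb i j' = v›])
  · have hυi : υ.reg rU = i := (hF'.reg _ (by simp [WritesReg])).trans hτi
    have hυp : υ.reg rPos = start i := (hF'.reg _ (by simp [WritesReg])).trans hτp
    refine Runs.seq_rate (R := fun ρ => ρ.reg rPos = start (i + 1)) (Runs.rate_mul (by omega)
      (Runs.assign (v := start (i + 1)) ?_ (by simp))) fun ρ hF'' hρ => Runs.rate_mul (by omega) ?_
    · rw [h.start_succ i hi]
      refine add_eq (add_eq hυp ?_ (by omega)) (const_eq (by omega)) (by omega)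
      rw [cell_eq (i := reg rPos) _ hυp, hF'.mem _ (by simp [WritesMem]), hτin, h.deg_eq i hi]
    · have hρi : (reg rU).eval w ρ = i := (hF''.reg _ (by simp [WritesReg])).trans hυi
      refine Runs.store (u := i) (v := i) hρi hρi ⟨by simpa using hρ, fun u hu => ?_,
        fun u hu => ?_, fun u hu v hv => ?_⟩
      · rw [State.setMem_mem, if_neg (by decide), hF''.mem _ (by simp [WritesMem]),
          hF'.mem _ (by simp [WritesMem]), hτ u hu]
      · rw [State.setMem_mem, if_pos rfl, Function.update_apply]
        split_ifs with h'
        · exact h'.symm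
        · rw [hF''.mem _ (by simp [WritesMem]), hF'.mem _ (by simp [WritesMem]),
            hF.mem _ (by simp [WritesMem]), hI.par u (by omega)]
      · rw [State.setMem_mem, if_neg (by decide), hF''.mem _ (by simp [WritesMem]), hυ u hu v hv]
        refine bit_congr ⟨?_, fun ⟨h1, h2⟩ => ?_⟩
        · rintro (⟨h1, h2⟩ | ⟨rfl, h2⟩)
          · exact ⟨by omega, h2⟩
          · exact ⟨by omega, (hA.adj_iff hu).2 h2⟩
        · rcases Nat.lt_succ_iff_lt_or_eq.1 h1 with h1 | rfl
          · exact Or.inl ⟨h1, h2⟩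
          · exact Or.inr ⟨rfl, (hA.adj_iff hu).1 h2⟩

/-- The arrays hold the lists of neighbours, including that of the artificial vertex. -/
structure HoldsLists (n w : ℕ) (deg : ℕ → ℕ) (nb : ℕ → ℕ → ℕ) (σ : State) : Prop where
  reg_n : σ.reg rN = n
  lt : ∀ u ≤ n, σ.mem aStart u + 1 + deg u < 2 ^ w
  deg_eq : ∀ u ≤ n, σ.mem aIn (σ.mem aStart u) = deg u
  nb_eq : ∀ u ≤ n, ∀ j < deg u, σ.mem aIn (σ.mem aStart u + 1 + j) = nb u j

theorem HoldsLists.of_frame {σ τ : State} {p : Program} (h : HoldsLists n w deg nb σ)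
    (hF : Frame p σ τ) (hr : ¬ p.WritesReg rN) (hm : ¬ p.WritesMem aIn)
    (hs : ¬ p.WritesMem aStart) : HoldsLists n w deg nb τ := by
  have h1 := hF.mem _ hm
  have h2 := hF.mem _ hs
  exact ⟨(hF.reg _ hr).trans h.reg_n, by rw [h2]; exact h.lt, by rw [h1, h2]; exact h.deg_eq,
    by rw [h1, h2]; exact h.nb_eq⟩

/-- Read the input. -/
def readInput (K : ℕ) : Program :=
  .seq (readHeader K) (.seq readMods (.seq (forLoop rU (reg rN) readRow) addRoot))

/-- The state after reading the input. -/
structure Prepared (n w k ℓ K : ℕ) (mods deg : ℕ → ℕ) (nb : ℕ → ℕ → ℕ) (Adj : ℕ → ℕ → Prop)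
    (σ : State) : Prop extends HoldsHeader n k ℓ K σ where
  lists : HoldsLists n w deg nb σ
  cur : σ.reg rCur = n
  mods_eq : ∀ i < k, σ.mem aIn (3 + i) = mods i
  vis : ∀ u, σ.mem aVis u ≠ 0 ↔ ∃ i < effective K k, mods i = u
  par : ∀ u ≤ n, σ.mem aPar u = u
  mat : ∀ u < n, ∀ v ≤ n, σ.mem aMat (u * (n + 1) + v) = bit (Adj u v)

theorem runs_addRoot {Adj : ℕ → ℕ → Prop} {σ : State}
    (h : Source n k ℓ mods start deg nb (σ.mem aIn)) (hA : AdjLists n Adj nb deg)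
    (hh : HoldsHeader n k ℓ K σ) (hw : start n + n + 16 < 2 ^ w) (hI : RowsRead n Adj start n σ)
    (hvis : ∀ u, σ.mem aVis u ≠ 0 ↔ ∃ i < effective K k, mods i = u) :
    Runs w addRoot σ (addRoot.rate * (n + 1)) (Prepared n w k ℓ K mods deg nb Adj) := by
  obtain ⟨hs1, hs2⟩ := h.le_start
  refine Runs.seq_rate (R := fun τ => ∀ u ≤ n, τ.mem aStart u = start u)
    (Runs.rate_mul (by omega) (Runs.store (u := n) (v := start n) hh.reg_n hI.pos ?_))
    fun τ hF hτ => ?_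
  · intro u hu
    simp only [State.setMem_mem, if_true, Function.update_apply]
    split_ifs with h'
    · rw [h']
    · exact hI.starts u (by omega)
  have hτn : τ.reg rN = n := (hF.reg _ (by simp [WritesReg])).trans hh.reg_n
  have hτp : τ.reg rPos = start n := (hF.reg _ (by simp [WritesReg])).trans hI.pos
  have hτin : τ.mem aIn = σ.mem aIn := hF.mem _ (by simp [WritesMem])
  refine Runs.seq_rate (R := fun υ => υ.mem aIn (start n) = n ∧
    ∀ m < start n, υ.mem aIn m = σ.mem aIn m)
    (Runs.rate_mul (by omega) (Runs.store (u := start n) (v := n) hτp hτn ?_))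
    fun υ hF' hυ => ?_
  · simp only [State.setMem_mem, if_true, Function.update_self, true_and]
    intro m hm
    rw [Function.update_of_ne hm.ne, hτin]
  have hυn : υ.reg rN = n := (hF'.reg _ (by simp [WritesReg])).trans hτn
  have hυp : υ.reg rPos = start n := (hF'.reg _ (by simp [WritesReg])).trans hτp
  refine (Runs.forLoop_rate (m := n) le_rfl (fun i ρ => (∀ j < i, ρ.mem aIn (start n + 1 + j) = j) ∧
    ρ.mem aIn (start n) = n ∧ ∀ m < start n, ρ.mem aIn m = σ.mem aIn m)
    (by omega) (by omega) (by simp [WritesReg]) ⟨by simp, hυ⟩ (fun _ _ _ h => h)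
    (fun ρ hF' => ?_) fun j hj ρ hF' hrj hρ => ?_).seq_rate fun ρ hF'' hρ => ?_
  · exact (hF'.reg _ (by simp [WritesReg])).trans hυn
  · refine Runs.store (u := start n + 1 + j) (v := j) ?_ hrj ⟨fun i hi => ?_, ?_, fun m hm => ?_⟩
    · exact add_eq (add_eq ((hF'.reg _ (by simp [WritesReg])).trans hυp) (const_eq (by omega))
        (by omega)) hrj (by omega)
    · simp only [State.setMem_mem, if_true, Function.update_apply]
      split_ifs with h'
      · omega
      · exact hρ.1 i (by omega)
    · simp only [State.setMem_mem, if_true]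
      rw [Function.update_of_ne (by omega), hρ.2.1]
    · simp only [State.setMem_mem, if_true]
      rw [Function.update_of_ne (by omega), hρ.2.2 m hm]
  · have hρn : ρ.reg rN = n := (hF''.reg _ (by simp [WritesReg])).trans hυn
    refine Runs.seq_rate (R := fun υ => ∀ u ≤ n, υ.mem aPar u = u) (Runs.rate_mul (by omega)
      (Runs.store (u := n) (v := n) hρn hρn fun u hu => ?_)) fun ξ hF3 hξ =>
        Runs.rate_mul (by omega) (Runs.assign (v := n)
          ((hF3.reg _ (by simp [WritesReg])).trans hρn) ?_)
    · simp only [State.setMem_mem, if_true, Function.update_apply]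
      split_ifs with h'
      · exact h'.symm
      · rw [hF''.mem _ (by simp [WritesMem]), hF'.mem _ (by simp [WritesMem]),
          hF.mem _ (by simp [WritesMem]), hI.par u (by omega)]
    · have hh' := (((hh.of_frame hF (by simp [WritesReg])).of_frame hF'
        (by simp [WritesReg])).of_frame hF'' (by simp [WritesReg]; omega)).of_frame hF3
        (by simp [WritesReg])
      have hin : ξ.mem aIn = ρ.mem aIn := hF3.mem _ (by simp [WritesMem])
      have hstart : ∀ u ≤ n, ξ.mem aStart u = start u := fun u hu => by
        rw [hF3.mem _ (by simp [WritesMem]), hF''.mem _ (by simp [WritesMem]),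
          hF'.mem _ (by simp [WritesMem]), hτ u hu]
      refine ⟨⟨by simpa using hh'.reg_n, by simpa using hh'.reg_kraw, by simpa using hh'.reg_l,
        by simpa using hh'.reg_k⟩, ⟨by simpa using hh'.reg_n, ?_, ?_, ?_⟩, by simp, ?_, ?_, hξ, ?_⟩
      · intro u hu
        rw [State.setReg_mem, hstart u hu]
        rcases hu.lt_or_eq with hu | rfl
        · have := hs2 u hu; omega
        · rw [hA.deg_top]; omega
      · intro u hu
        rw [State.setReg_mem, hstart u hu, hin]
        rcases hu.lt_or_eq with hu | rfl
        · have := hs2 u hu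
          rw [hρ.2.2 _ (by omega), h.deg_eq u hu]
        · rw [hρ.2.1, hA.deg_top]
      · intro u hu j hj
        rw [State.setReg_mem, hstart u hu, hin]
        rcases hu.lt_or_eq with hu | rfl
        · have := hs2 u hu
          rw [hρ.2.2 _ (by omega), h.nb_eq u hu j hj]
        · rw [hA.deg_top] at hj
          rw [hρ.1 j hj, hA.nb_top j hj]
      · intro i hi
        rw [State.setReg_mem, hin, hρ.2.2 _ (by omega), h.mods_eq i hi]
      · rw [State.setReg_mem, hF3.mem _ (by simp [WritesMem]), hF''.mem _ (by simp [WritesMem]),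
          hF'.mem _ (by simp [WritesMem]), hF.mem _ (by simp [WritesMem])]
        exact hvis
      · intro u hu v hv
        rw [State.setReg_mem, hF3.mem _ (by simp [WritesMem]), hF''.mem _ (by simp [WritesMem]),
          hF'.mem _ (by simp [WritesMem]), hF.mem _ (by simp [WritesMem]), hI.mat u hu v hv]
        exact bit_congr ⟨fun h => h.2, fun h => ⟨hu, h⟩⟩

theorem readInput_writesReg {r : ℕ} (h : (readInput K).WritesReg r) : r ≤ rCur := by
  simp [readInput, readHeader, readMods, readRow, addRoot, WritesReg] at h
  omega

theorem readInput_writesMem {a : ℕ} (h : (readInput K).WritesMem a) : a ≤ aPar ∧ a ≠ aPtr := by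
  simp [readInput, readHeader, readMods, readRow, addRoot, WritesMem] at h
  omega

theorem runs_readInput {Adj : ℕ → ℕ → Prop} {σ : State}
    (h : Source n k ℓ mods start deg nb (σ.mem aIn)) (hA : AdjLists n Adj nb deg)
    (hw : start n + n + 16 < 2 ^ w) (hmat : (n + 1) * (n + 1) < 2 ^ w) (hK : K < 2 ^ w)
    (hzero : ∀ a, a ≠ aIn → ∀ i, σ.mem a i = 0) :
    Runs w (readInput K) σ ((readInput K).rate * (start n + n))
      (Prepared n w k ℓ K mods deg nb Adj) := by
  have hs := h.start_eq
  have hsum : ∑ u ∈ Finset.range n, (deg u + 2) = ∑ u ∈ Finset.range n, (deg u + 1) + n := by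
    simp only [Finset.sum_add_distrib, Finset.sum_const, Finset.card_range, smul_eq_mul]
    ring
  refine Runs.seq_rate (Runs.rate_mul (by omega) (runs_readHeader h hw hK)) fun τ hF hτ => ?_
  have hin1 : τ.mem aIn = σ.mem aIn := hF.mem _ (by simp [readHeader, WritesMem])
  have h1 : Source n k ℓ mods start deg nb (τ.mem aIn) := hin1 ▸ h
  refine Runs.seq_rate ((runs_readMods h1 hτ.1 hw fun u => ?_).mono
    (Nat.mul_le_mul_left _ (by omega)) fun _ _ h => h) fun υ hF' hυ => ?_
  · rw [hF.mem _ (by simp [readHeader, WritesMem])]; exact hzero _ (by decide) u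
  have hin2 : υ.mem aIn = τ.mem aIn := hF'.mem _ (by simp [readMods, WritesMem])
  have h2 : Source n k ℓ mods start deg nb (υ.mem aIn) := hin2 ▸ h1
  have hh2 := hτ.1.of_frame hF' (by simp [readMods, WritesReg]; omega)
  have hpos : υ.reg rPos = 3 + k := (hF'.reg _ (by simp [readMods, WritesReg])).trans hτ.2
  refine Runs.seq_rate (Runs.forLoop_sum (m := n) (c := fun u => deg u + 2) (by omega)
    (RowsRead n Adj start) (by omega) (by omega) (by simp [readRow, WritesReg])
    ⟨hpos.trans h.start_zero.symm, by simp, by simp, fun u hu v hv => ?_⟩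
    (fun i τ x h => ⟨by simpa using h.pos, h.starts, h.par, h.mat⟩) (fun ρ hF'' => ?_)
    (fun i hi ρ hF'' hri hI => ?_) (by omega)) fun ρ hF'' hρ => ?_
  · rw [hF'.mem _ (by simp [readMods, WritesMem]), hF.mem _ (by simp [readHeader, WritesMem]),
      hzero _ (by decide), bit, if_neg (by simp)]
  · exact (hF''.reg _ (by simp [readRow, WritesReg])).trans hh2.reg_n
  · have hin3 : ρ.mem aIn = υ.mem aIn := hF''.mem _ (by simp [readRow, WritesMem])
    exact runs_readRow (hin3 ▸ h2) hA ((hF''.reg _ (by simp [readRow, WritesReg])).trans hh2.reg_n) hw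
      hmat hi hri hI
  · have hin3 : ρ.mem aIn = υ.mem aIn := hF''.mem _ (by simp [readRow, WritesMem])
    refine (runs_addRoot (hin3 ▸ h2) hA (hh2.of_frame hF'' (by simp [readRow, WritesReg]; omega)) hw
      hρ ?_).mono (Nat.mul_le_mul_left _ (by omega)) fun _ _ h => h
    rw [hF''.mem _ (by simp [readRow, WritesMem])]
    exact hυ

end
end LPKernel

namespace LPKernel
open Program
open Term (const reg cell const_eq cell_eq add_eq sub_eq mul_eq lt_eq eq_eq eval_reg)

/-! ### The depth-first search program -/

/-- One step of the depth-first search. -/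
def dfsStep : Program :=
  .ite (.op .lt (cell aPtr (reg rCur)) (cell aIn (cell aStart (reg rCur))))
    (.seq (.assign rV (cell aIn (cell aStart (reg rCur) + const 1 + cell aPtr (reg rCur))))
      (.seq (.store aPtr (reg rCur) (cell aPtr (reg rCur) + const 1))
        (.ite (cell aVis (reg rV)) .skip
          (.seq (.store aVis (reg rV) (const 1))
            (.seq (.store aPar (reg rV) (reg rCur)) (.assign rCur (reg rV)))))))
    (.assign rCur (cell aPar (reg rCur)))

/-- Depth-first search from the artificial vertex, until all its neighbours have been scanned and
the search has returned to it. -/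
def dfs : Program :=
  .loop (.op .lt (reg rCur) (reg rN) + .op .lt (cell aPtr (reg rN)) (reg rN)) dfsStep

theorem dfs_writesReg {r : ℕ} (h : dfs.WritesReg r) : r = rV ∨ r = rCur := by
  simp [dfs, dfsStep, WritesReg] at h
  omega

theorem dfs_writesMem {a : ℕ} (h : dfs.WritesMem a) : a = aVis ∨ a = aPtr ∨ a = aPar := by
  simp [dfs, dfsStep, WritesMem] at h
  omega

section
variable {w n : ℕ} {deg : ℕ → ℕ} {nb : ℕ → ℕ → ℕ} {Adj : ℕ → ℕ → Prop} {S : ℕ → Prop}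

/-- The state represents a search with the given measure of the remaining work. -/
def Searches (n : ℕ) (Adj : ℕ → ℕ → Prop) (S : ℕ → Prop) (nb : ℕ → ℕ → ℕ) (deg : ℕ → ℕ) (f : ℕ)
    (τ : State) : Prop :=
  ∃ dep, DfsInv n Adj S nb deg (τ.mem aPar) (τ.mem aVis) (τ.mem aPtr) (τ.reg rCur) dep ∧
    f = dfsFuel n deg (τ.mem aPtr) (τ.reg rCur) dep

theorem runs_dfsStep {σ : State} {f : ℕ} (hA : AdjLists n Adj nb deg)
    (hl : HoldsLists n w deg nb σ) (hw : 1 < 2 ^ w) (h : Searches n Adj S nb deg f σ)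
    (hne : σ.reg rCur < n ∨ σ.mem aPtr n < n) :
    Runs w dfsStep σ dfsStep.rate fun τ => ∃ f' < f, Searches n Adj S nb deg f' τ := by
  obtain ⟨dep, hD, rfl⟩ := h
  set cur := σ.reg rCur with hcur
  have hcn : cur ≤ n := hD.cur_le
  have eC : (reg rCur).eval w σ = cur := rfl
  have eS := cell_eq aStart eC
  have eD : (cell aIn (cell aStart (reg rCur))).eval w σ = deg cur := by
    rw [cell_eq _ eS, hl.deg_eq cur hcn]
  have eP := cell_eq aPtr eC
  have hlt := hl.lt cur hcn
  have hc := lt_eq eP eD hw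
  rw [← mul_one (Program.rate _)]
  refine Runs.ite_rate le_rfl (fun hne' => Runs.rate_mul le_rfl ?_)
    (fun he => Runs.rate_mul le_rfl ?_)
  · have hpd : σ.mem aPtr cur < deg cur := by
      by_contra hcon
      rw [hc, if_neg hcon] at hne'
      exact hne' rfl
    set v := nb cur (σ.mem aPtr cur) with hv
    have hvn : v < n := hA.nb_lt hcn hpd
    refine Runs.seq (Runs.assign (v := v) (Q := fun τ => τ = σ.setReg rV v) ?_ rfl)
      fun τ _ hτ => ?_
    · rw [cell_eq _ (add_eq (add_eq eS (const_eq hw) (by omega)) eP (by omega)),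
        hl.nb_eq cur hcn _ hpd]
    have τC : (reg rCur).eval w τ = cur := by rw [hτ, eval_reg, State.setReg_reg, if_neg (by decide)]
    have τV : (reg rV).eval w τ = v := by rw [hτ, eval_reg, State.setReg_reg, if_pos rfl]
    have τm : τ.mem = σ.mem := by rw [hτ, State.setReg_mem]
    have τr : τ.reg rCur = cur := τC
    clear_value v cur
    refine Runs.seq (Runs.store (u := cur) (v := σ.mem aPtr cur + 1)
      (Q := fun υ => υ = τ.setMem aPtr cur (σ.mem aPtr cur + 1)) τC
      (add_eq (by rw [cell_eq _ τC, τm]) (const_eq hw) (by omega)) rfl) fun υ _ hυ => ?_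
    have υC : (reg rCur).eval w υ = cur := by rw [hυ, eval_reg, State.setMem_reg]; exact τC
    have υV : (reg rV).eval w υ = v := by rw [hυ, eval_reg, State.setMem_reg]; exact τV
    have υptr : υ.mem aPtr = Function.update (σ.mem aPtr) cur (σ.mem aPtr cur + 1) := by
      rw [hυ, State.setMem_mem, if_pos rfl, τm]
    have υvis : υ.mem aVis = σ.mem aVis := by
      rw [hυ, State.setMem_mem, if_neg (by decide), τm]
    have υpar : υ.mem aPar = σ.mem aPar := by
      rw [hυ, State.setMem_mem, if_neg (by decide), τm]
    have hsum := sum_sub_update (deg := deg) hcn hpd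
    rw [← mul_one (Program.rate _)]
    refine Runs.ite_rate le_rfl (fun hvis => Runs.rate_mul le_rfl (Runs.skip ?_))
      (fun hvis => Runs.rate_mul le_rfl ?_)
    · rw [cell_eq _ υV, υvis] at hvis
      refine ⟨_, ?_, dep, ?_, rfl⟩
      · rw [υptr, show υ.reg rCur = cur from υC]
        unfold dfsFuel; omega
      · rw [υptr, υvis, υpar, show υ.reg rCur = cur from υC]
        exact hD.skip hpd (hv ▸ hvis)
    · rw [cell_eq _ υV, υvis] at hvis
      refine Runs.seq (Runs.store (u := v) (v := 1) (Q := fun ρ => ρ = υ.setMem aVis v 1) υV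
        (const_eq hw) rfl) fun ρ _ hρ => ?_
      have ρC : (reg rCur).eval w ρ = cur := by rw [hρ, eval_reg, State.setMem_reg]; exact υC
      have ρV : (reg rV).eval w ρ = v := by rw [hρ, eval_reg, State.setMem_reg]; exact υV
      refine Runs.seq (Runs.store (u := v) (v := cur) (Q := fun ξ => ξ = ρ.setMem aPar v cur) ρV
        ρC rfl) fun ξ _ hξ => ?_
      have ξV : (reg rV).eval w ξ = v := by rw [hξ, eval_reg, State.setMem_reg]; exact ρV
      have hpush := hD.push hA hpd hv.symm hvis
      have e1 : ξ.mem aPar = Function.update (σ.mem aPar) v cur := by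
        rw [hξ, State.setMem_mem, if_pos rfl, hρ, State.setMem_mem, if_neg (by decide), υpar]
      have e2 : ξ.mem aVis = Function.update (σ.mem aVis) v 1 := by
        rw [hξ, State.setMem_mem, if_neg (by decide), hρ, State.setMem_mem, if_pos rfl, υvis]
      have e3 : ξ.mem aPtr = Function.update (σ.mem aPtr) cur (σ.mem aPtr cur + 1) := by
        rw [hξ, State.setMem_mem, if_neg (by decide), hρ, State.setMem_mem, if_neg (by decide),
          υptr]
      refine Runs.assign ξV ⟨_, ?_, Function.update dep v (dep cur + 1), ?_, rfl⟩
      · rw [State.setReg_mem, State.setReg_reg, if_pos rfl, e3]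
        unfold dfsFuel
        rw [Function.update_self]
        omega
      · rw [State.setReg_mem, State.setReg_reg, if_pos rfl, e1, e2, e3]
        exact hpush
  · have hpd : ¬ σ.mem aPtr cur < deg cur := fun hcon => by
      rw [hc, if_pos hcon] at he
      exact one_ne_zero he
    have hclt : cur < n := by
      rcases hcn.lt_or_eq with h | h
      · exact h
      · rw [h, hA.deg_top] at hpd
        rw [h] at hne
        omega
    refine Runs.assign (cell_eq aPar eC) ⟨_, ?_, dep, ?_, rfl⟩
    · rw [State.setReg_mem, State.setReg_reg, if_pos rfl]
      exact hD.pop_fuel hclt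
    · rw [State.setReg_mem, State.setReg_reg, if_pos rfl]
      exact hD.pop hpd hclt

/-- The search halts when it is back at the artificial vertex `n`, all of whose neighbours have been
scanned; the number of rounds is bounded by the variant `dfsFuel`. -/
theorem runs_dfs {σ : State} {f : ℕ} (hA : AdjLists n Adj nb deg)
    (hl : HoldsLists n w deg nb σ) (hw : 2 < 2 ^ w) (h : Searches n Adj S nb deg f σ) :
    Runs w dfs σ (dfs.rate * (f + 1)) fun τ => ∃ dep,
      DfsInv n Adj S nb deg (τ.mem aPar) (τ.mem aVis) (τ.mem aPtr) n dep ∧ n ≤ τ.mem aPtr n := by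
  have hn : ∀ τ, Frame dfs σ τ → HoldsLists n w deg nb τ := fun τ hF =>
    hl.of_frame hF (fun h => by have := dfs_writesReg h; omega)
      (fun h => by have := dfs_writesMem h; omega) (fun h => by have := dfs_writesMem h; omega)
  have htest : ∀ τ, Frame dfs σ τ →
      (.op .lt (reg rCur) (reg rN) + .op .lt (cell aPtr (reg rN)) (reg rN) : Term).eval w τ =
      (if τ.reg rCur < n then 1 else 0) + if τ.mem aPtr n < n then 1 else 0 := by
    intro τ hF
    have h1 : (reg rN).eval w τ = n := (hn τ hF).reg_n
    refine add_eq (lt_eq rfl h1 (by omega)) (lt_eq (cell_eq _ h1) h1 (by omega)) ?_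
    split_ifs <;> omega
  refine (Runs.loop (T := dfsStep.rate) (Searches n Adj S nb deg) (fun f τ hF hI he => ?_)
    h).mono ?_ fun τ hF ⟨⟨f', _, dep, hD, _⟩, he⟩ => ⟨dep, ?_⟩
  · refine runs_dfsStep hA (hn τ hF) (by omega) hI ?_
    by_contra hcon
    rw [not_or] at hcon
    rw [htest τ hF, if_neg hcon.1, if_neg hcon.2] at he
    exact he rfl
  · rw [dfs, Program.rate, mul_comm _ (f + 1), add_one_mul f]
    omega
  · rw [htest τ hF] at he
    have hle := hD.cur_le
    have h1 : ¬ τ.reg rCur < n := fun h => by rw [if_pos h] at he; omega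
    have h2 : ¬ τ.mem aPtr n < n := fun h => by rw [if_pos h] at he; omega
    have h3 : τ.reg rCur = n := by omega
    rw [h3] at hD
    exact ⟨hD, by omega⟩

end
end LPKernel

namespace LPKernel
open Program
open Term (const reg cell const_eq cell_eq add_eq sub_eq mul_eq lt_eq eq_eq eval_reg)

/-! ### The program that writes the output -/

/-- The list `l` has been written to the output. -/
structure Emitted (l : List ℕ) (σ : State) : Prop where
  reg_out : σ.reg rOut = l.length
  out : σ.Outputs l

theorem Emitted.of_frame {l : List ℕ} {σ τ : State} {p : Program} (h : Emitted l σ)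
    (hF : Frame p σ τ) (hr : ¬ p.WritesReg rOut) (hm : ¬ p.WritesMem aOut) : Emitted l τ where
  reg_out := (hF.reg _ hr).trans h.reg_out
  out i hi := by rw [hF.mem _ hm]; exact h.out i hi

theorem Emitted.setReg {l : List ℕ} {σ : State} {r x : ℕ} (h : Emitted l σ) (hr : r ≠ rOut) :
    Emitted l (σ.setReg r x) where
  reg_out := by rw [State.setReg_reg, if_neg hr.symm]; exact h.reg_out
  out := h.out

/-- Append a word to the output. -/
def emit (e : Term) : Program :=
  .seq (.store aOut (reg rOut) e) (.assign rOut (reg rOut + const 1))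

section
variable {w : ℕ}

theorem runs_emit {l : List ℕ} {e : Term} {v : ℕ} {σ : State} (h : Emitted l σ)
    (he : e.eval w σ = v) (hl : l.length + 1 < 2 ^ w) :
    Runs w (emit e) σ (emit e).rate (Emitted (l ++ [v])) := by
  refine Runs.seq (Runs.store (u := l.length) (v := v)
    (Q := fun τ => τ = σ.setMem aOut l.length v) h.reg_out he rfl) fun τ _ hτ => ?_
  subst hτ
  refine Runs.assign (v := l.length + 1) (add_eq h.reg_out (const_eq (by omega)) hl)
    ⟨by simp, fun i hi => ?_⟩
  rw [State.setReg_mem, State.setMem_mem, if_pos rfl, Function.update_apply]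
  rw [List.length_append, List.length_singleton] at hi
  split_ifs with hil
  · subst hil; simp
  · rw [List.getElem_append_left (by omega)]
    exact h.out i (by omega)

/-- Append the given words to the output. -/
def emitConsts (l : List ℕ) : Program := .seqs (l.map fun c => emit (const c))

theorem runs_emitConsts {l l' : List ℕ} {σ : State} (h : Emitted l σ)
    (hl : l.length + l'.length + 1 < 2 ^ w) (hc : ∀ c ∈ l', c < 2 ^ w) :
    Runs w (emitConsts l') σ (emitConsts l').rate (Emitted (l ++ l')) := by
  induction l' generalizing l σ with
  | nil => exact Runs.skip (by simpa using h)
  | cons c l' ih =>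
    rw [List.length_cons] at hl
    refine Runs.seq (runs_emit h (const_eq (hc c (by simp))) (by omega)) fun τ _ hτ => ?_
    have := ih hτ (by rw [List.length_append, List.length_singleton]; omega)
      fun c hc' => hc c (List.mem_cons_of_mem _ hc')
    rwa [List.append_assoc, List.singleton_append] at this

/-- The degree of the vertex in the register `rU`. -/
def degTerm : Term := cell aIn (cell aStart (reg rU))

/-- The neighbour of the vertex in the register `rU` whose index is in the register `rJ`. -/
def nbTerm : Term := cell aIn (cell aStart (reg rU) + const 1 + reg rJ)

/-- Write the list of kept neighbours of the vertex in the register `rU`, preceded by its length. -/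
def emitRow : Program :=
  .seq (.assign rDeg (const 0))
    (.seq (forLoop rJ degTerm (.assign rDeg (reg rDeg + cell aKeep nbTerm)))
      (.seq (emit (reg rDeg))
        (forLoop rJ degTerm (.ite (cell aKeep nbTerm) (emit (cell aNew nbTerm)) .skip))))

/-- Write the lists of neighbours of all kept vertices. -/
def emitRows : Program := forLoop rU (reg rN) (.ite (cell aKeep (reg rU)) emitRow .skip)

/-- Number the kept vertices consecutively. -/
def setNew : Program :=
  .seq (.assign rCnt (const 0)) (forLoop rU (reg rN)
    (.seq (.store aNew (reg rU) (reg rCnt)) (.assign rCnt (reg rCnt + cell aKeep (reg rU)))))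

/-- The length of the path that is asked for in the kernel. -/
def lengthTerm : Term :=
  .op .lt (reg rCnt) (reg rL) * (reg rCnt + const 1) +
    (const 1 - .op .lt (reg rCnt) (reg rL)) * reg rL

/-- Write the graph that is induced by the kept vertices, all of which form the modulator. -/
def emitKernel : Program :=
  .seq setNew (.seq (emit (reg rCnt)) (.seq (emit (reg rCnt)) (.seq (emit lengthTerm)
    (.seq (forLoop rU (reg rCnt) (emit (reg rU))) emitRows))))

variable {n : ℕ} {deg : ℕ → ℕ} {nb : ℕ → ℕ → ℕ} {keep : ℕ → Prop}

variable (n w deg nb keep) in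
/-- The state holds the lists of neighbours and the kept vertices. -/
structure HoldsKept (σ : State) : Prop where
  lists : HoldsLists n w deg nb σ
  keep_eq : ∀ u < n, σ.mem aKeep u = bit (keep u)

theorem HoldsKept.of_frame {σ τ : State} {p : Program} (h : HoldsKept w n deg nb keep σ)
    (hF : Frame p σ τ) (hr : ¬ p.WritesReg rN) (hm : ¬ p.WritesMem aIn)
    (hs : ¬ p.WritesMem aStart) (hk : ¬ p.WritesMem aKeep) : HoldsKept w n deg nb keep τ where
  lists := h.lists.of_frame hF hr hm hs
  keep_eq u hu := by rw [hF.mem _ hk]; exact h.keep_eq u hu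

theorem HoldsKept.degTerm_eq {σ : State} (h : HoldsKept w n deg nb keep σ) {u : ℕ} (hu : u < n)
    (hr : σ.reg rU = u) : degTerm.eval w σ = deg u := by
  have hU : (reg rU).eval w σ = u := hr
  rw [degTerm, cell_eq _ (cell_eq _ hU), h.lists.deg_eq u hu.le]

theorem HoldsKept.nbTerm_eq {σ : State} (h : HoldsKept w n deg nb keep σ) {u j : ℕ} (hu : u < n)
    (hj : j < deg u) (hr : σ.reg rU = u) (hrj : σ.reg rJ = j) : nbTerm.eval w σ = nb u j := by
  have hU : (reg rU).eval w σ = u := hr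
  have := h.lists.lt u hu.le
  have h1 : (1 : ℕ) < 2 ^ w := by omega
  rw [nbTerm, cell_eq _ (add_eq (add_eq (cell_eq _ hU) (const_eq h1) (by omega))
    (show (reg rJ).eval w σ = j from hrj) (by omega)),
    h.lists.nb_eq u hu.le j hj]

variable [DecidablePred keep]

variable (deg nb keep) in
/-- The new numbers of the kept neighbours among the first `m` neighbours of `u`. -/
def keptNeighbors (u m : ℕ) : List ℕ :=
  ((List.range m).filter fun j => keep (nb u j)).map fun j => Nat.count keep (nb u j)

theorem keptNeighbors_succ (u m : ℕ) : keptNeighbors nb keep u (m + 1) =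
    keptNeighbors nb keep u m ++ if keep (nb u m) then [Nat.count keep (nb u m)] else [] := by
  unfold keptNeighbors
  rw [List.range_succ, List.filter_append, List.map_append]
  congr 1
  by_cases h : keep (nb u m) <;> simp [h]

theorem length_keptNeighbors_le (u m : ℕ) : (keptNeighbors nb keep u m).length ≤ m := by
  rw [keptNeighbors, List.length_map]
  exact (List.length_filter_le _ _).trans_eq List.length_range

variable (deg nb keep) in
/-- The part of the output that describes the neighbours of `u`. -/
def keptRow (u : ℕ) : List ℕ :=
  if keep u then (keptNeighbors nb keep u (deg u)).length :: keptNeighbors nb keep u (deg u) else []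

theorem length_keptRow_le (u : ℕ) : (keptRow deg nb keep u).length ≤ deg u + 1 := by
  unfold keptRow
  split
  · rw [List.length_cons]
    exact Nat.succ_le_succ (length_keptNeighbors_le _ _)
  · simp

theorem runs_emitRow {σ : State} {l : List ℕ} {u : ℕ} (h : HoldsKept w n deg nb keep σ)
    (hnew : ∀ u < n, σ.mem aNew u = Nat.count keep u) (hnb : ∀ j < deg u, nb u j < n)
    (hu : u < n) (hr : σ.reg rU = u) (hl : Emitted l σ) (hlen : l.length + deg u + 2 < 2 ^ w)
    (hk : keep u) :
    Runs w emitRow σ (emitRow.rate * (deg u + 2)) (Emitted (l ++ keptRow deg nb keep u)) := by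
  refine Runs.seq_rate (R := fun τ => τ.reg rDeg = 0) (Runs.rate_mul (by omega)
    (Runs.assign (v := 0) (const_eq (by omega)) (by simp))) fun τ hF hτ => ?_
  have h1 := h.of_frame hF (by simp [WritesReg]) (by simp [WritesMem]) (by simp [WritesMem])
    (by simp [WritesMem])
  have hr1 : τ.reg rU = u := (hF.reg _ (by simp [WritesReg])).trans hr
  refine Runs.seq_rate (Runs.forLoop_rate (m := deg u) (by omega)
    (fun j υ => υ.reg rDeg = (keptNeighbors nb keep u j).length) (by omega) (by omega)
    (by simp [WritesReg]) (by simpa [keptNeighbors] using hτ)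
    (fun i υ x h => by simpa using h) (fun υ hF' => ?_) fun j hj υ hF' hrj hI => ?_)
    fun υ hF' hυ => ?_
  · exact (h1.of_frame hF' (by simp [WritesReg]) (by simp [WritesMem]) (by simp [WritesMem])
      (by simp [WritesMem])).degTerm_eq hu ((hF'.reg _ (by simp [WritesReg])).trans hr1)
  · have h2 := h1.of_frame hF' (by simp [WritesReg]) (by simp [WritesMem]) (by simp [WritesMem])
      (by simp [WritesMem])
    have e1 := h2.nbTerm_eq hu hj ((hF'.reg _ (by simp [WritesReg])).trans hr1) hrj
    have e2 := cell_eq aKeep e1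
    rw [h2.keep_eq _ (hnb j hj)] at e2
    have b1 := bit_le_one (keep (nb u j))
    have b2 := length_keptNeighbors_le (nb := nb) (keep := keep) u j
    refine Runs.assign (add_eq hI e2 (by omega)) ?_
    rw [State.setReg_reg, if_pos rfl, keptNeighbors_succ, List.length_append, bit]
    split_ifs <;> rfl
  have h2 := h1.of_frame hF' (by simp [WritesReg]) (by simp [WritesMem]) (by simp [WritesMem])
    (by simp [WritesMem])
  have hr2 : υ.reg rU = u := (hF'.reg _ (by simp [WritesReg])).trans hr1
  have hl2 := (hl.of_frame hF (by simp [WritesReg]) (by simp [WritesMem])).of_frame hF'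
    (by simp [WritesReg]) (by simp [WritesMem])
  refine Runs.seq_rate (Runs.rate_mul (by omega) (runs_emit hl2 hυ (by omega))) fun ρ hF'' hρ => ?_
  have h3 := h2.of_frame hF'' (by simp [emit, WritesReg]) (by simp [emit, WritesMem])
    (by simp [emit, WritesMem]) (by simp [emit, WritesMem])
  have hr3 : ρ.reg rU = u := (hF''.reg _ (by simp [emit, WritesReg])).trans hr2
  have hnew3 : ρ.mem aNew = σ.mem aNew := by
    rw [hF''.mem _ (by simp [emit, WritesMem]), hF'.mem _ (by simp [WritesMem]),
      hF.mem _ (by simp [WritesMem])]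
  set c := (keptNeighbors nb keep u (deg u)).length with hc
  refine (Runs.forLoop_rate (m := deg u) (by omega)
    (fun j => Emitted (l ++ [c] ++ keptNeighbors nb keep u j)) (by omega) (by omega)
    (by simp [emit, WritesReg]) (by simpa [keptNeighbors] using hρ)
    (fun i υ x h => h.setReg (by decide)) (fun ξ hF3 => ?_) fun j hj ξ hF3 hrj hI => ?_).mono
    le_rfl fun ξ _ hξ => ?_
  · exact (h3.of_frame hF3 (by simp [emit, WritesReg]) (by simp [emit, WritesMem])
      (by simp [emit, WritesMem]) (by simp [emit, WritesMem])).degTerm_eq hu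
      ((hF3.reg _ (by simp [emit, WritesReg])).trans hr3)
  · have h4 := h3.of_frame hF3 (by simp [emit, WritesReg]) (by simp [emit, WritesMem])
      (by simp [emit, WritesMem]) (by simp [emit, WritesMem])
    have e1 := h4.nbTerm_eq hu hj ((hF3.reg _ (by simp [emit, WritesReg])).trans hr3) hrj
    have e2 := cell_eq aKeep e1
    have e3 := cell_eq aNew e1
    rw [h4.keep_eq _ (hnb j hj)] at e2
    rw [hF3.mem _ (by simp [emit, WritesMem]), hnew3, hnew _ (hnb j hj)] at e3
    have b2 := length_keptNeighbors_le (nb := nb) (keep := keep) u j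
    rw [← mul_one (Program.rate _)]
    refine Runs.ite_rate le_rfl (fun hne => Runs.rate_mul le_rfl ?_)
      (fun he => Runs.rate_mul le_rfl (Runs.skip ?_))
    · rw [e2] at hne
      have hkeep : keep (nb u j) := by
        by_contra hcon
        exact hne (by rw [bit, if_neg hcon])
      rw [keptNeighbors_succ, if_pos hkeep, ← List.append_assoc]
      refine runs_emit hI e3 ?_
      rw [List.length_append, List.length_append, List.length_singleton]
      omega
    · rw [e2] at he
      have hkeep : ¬ keep (nb u j) := fun hcon => by
        rw [bit, if_pos hcon] at he
        exact one_ne_zero he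
      rw [keptNeighbors_succ, if_neg hkeep, List.append_nil]
      exact hI
  · rw [keptRow, if_pos hk, ← hc]
    rwa [List.append_assoc, List.singleton_append] at hξ

theorem length_flatMap_keptRow_le (i : ℕ) : ((List.range i).flatMap (keptRow deg nb keep)).length ≤
    ∑ u ∈ Finset.range i, (deg u + 1) := by
  induction i with
  | zero => simp
  | succ i ih =>
    rw [List.range_succ, List.flatMap_append, List.length_append, Finset.sum_range_succ]
    refine Nat.add_le_add ih ?_
    simpa using length_keptRow_le i

theorem runs_emitRows {σ : State} {l : List ℕ} (h : HoldsKept w n deg nb keep σ)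
    (hnew : ∀ u < n, σ.mem aNew u = Nat.count keep u) (hnb : ∀ u < n, ∀ j < deg u, nb u j < n)
    (hl : Emitted l σ) (hlen : l.length + ∑ u ∈ Finset.range n, (deg u + 1) + n + 4 < 2 ^ w) {N : ℕ}
    (hN : ∑ u ∈ Finset.range n, (deg u + 2) + 1 ≤ N) :
    Runs w emitRows σ (emitRows.rate * N)
      (Emitted (l ++ (List.range n).flatMap (keptRow deg nb keep))) := by
  refine Runs.forLoop_sum (m := n) hN
    (fun i => Emitted (l ++ (List.range i).flatMap (keptRow deg nb keep))) (by omega) (by omega)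
    (by simp [emitRow, emit, WritesReg]) (by simpa using hl) (fun i υ x h => h.setReg (by decide))
    (fun τ hF => ?_) (fun i hi τ hF hri hI => ?_) (by omega)
  · exact (hF.reg _ (by simp [emitRow, emit, WritesReg])).trans h.lists.reg_n
  · have h1 := h.of_frame hF (by simp [emitRow, emit, WritesReg]) (by simp [emitRow, emit, WritesMem])
      (by simp [emitRow, emit, WritesMem]) (by simp [emitRow, emit, WritesMem])
    have e1 := cell_eq (w := w) (i := reg rU) aKeep hri
    rw [h1.keep_eq i hi] at e1
    rw [List.range_succ, List.flatMap_append, List.flatMap_singleton, ← List.append_assoc]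
    have b1 := length_flatMap_keptRow_le (deg := deg) (nb := nb) (keep := keep) i
    have b2 : ∑ u ∈ Finset.range i, (deg u + 1) + (deg i + 1) ≤
        ∑ u ∈ Finset.range n, (deg u + 1) := by
      rw [← Finset.sum_range_succ]
      exact Finset.sum_le_sum_of_subset (Finset.range_mono hi)
    refine Runs.ite_rate (by omega) (fun hne => ?_)
      (fun he => Runs.rate_mul (by omega) (Runs.skip ?_))
    · rw [e1] at hne
      have hkeep : keep i := by
        by_contra hcon
        exact hne (by rw [bit, if_neg hcon])
      refine runs_emitRow h1 (fun u hu => ?_) (hnb i hi) hi hri hI ?_ hkeep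
      · rw [hF.mem _ (by simp [emitRow, emit, WritesMem]), hnew u hu]
      · rw [List.length_append]; omega
    · rw [e1] at he
      have hkeep : ¬ keep i := fun hcon => by
        rw [bit, if_pos hcon] at he
        exact one_ne_zero he
      rw [keptRow, if_neg hkeep, List.append_nil]
      exact hI

theorem runs_setNew {σ : State} (h : HoldsKept w n deg nb keep σ) (hw : n + 16 < 2 ^ w) :
    Runs w setNew σ (setNew.rate * (n + 1)) fun τ => τ.reg rCnt = Nat.count keep n ∧
      ∀ u < n, τ.mem aNew u = Nat.count keep u := by
  refine Runs.seq_rate (R := fun τ => τ.reg rCnt = 0) (Runs.rate_mul (by omega)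
    (Runs.assign (v := 0) (const_eq (by omega)) (by simp))) fun τ hF hτ => ?_
  have h1 := h.of_frame hF (by simp [WritesReg]) (by simp [WritesMem]) (by simp [WritesMem])
    (by simp [WritesMem])
  refine Runs.forLoop_rate (m := n) le_rfl (fun i υ => υ.reg rCnt = Nat.count keep i ∧
    ∀ u < i, υ.mem aNew u = Nat.count keep u) (by omega) (by omega) (by simp [WritesReg])
    ⟨by simpa using hτ, by simp⟩ (fun i υ x h => ⟨by simpa using h.1, h.2⟩) (fun υ hF' => ?_)
    fun i hi υ hF' hri hI => ?_
  · exact (hF'.reg _ (by simp [WritesReg])).trans h1.lists.reg_n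
  · have h2 := h1.of_frame hF' (by simp [WritesReg]) (by simp [WritesMem]) (by simp [WritesMem])
      (by simp [WritesMem])
    refine Runs.seq (Runs.store (u := i) (v := Nat.count keep i)
      (Q := fun ρ => ρ = υ.setMem aNew i (Nat.count keep i)) hri hI.1 rfl) fun ρ _ hρ => ?_
    have e1 := cell_eq (w := w) (σ := ρ) (i := reg rU) (j := i) aKeep (by rw [hρ]; exact hri)
    have e2 : ρ.mem aKeep i = bit (keep i) := by
      rw [hρ, State.setMem_mem, if_neg (by decide), h2.keep_eq i hi]
    rw [e2] at e1
    have b1 := Nat.count_le (p := keep) (n := i)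
    have b2 := bit_le_one (keep i)
    refine Runs.assign (v := Nat.count keep (i + 1)) ?_ ⟨by simp, fun u hu => ?_⟩
    · rw [Nat.count_succ, show (if keep i then 1 else 0) = bit (keep i) from ite_eq_bit _]
      refine add_eq ?_ e1 (by omega)
      rw [hρ]; exact hI.1
    · rw [State.setReg_mem, hρ, State.setMem_mem, if_pos rfl, Function.update_apply]
      split_ifs with hui
      · rw [hui]
      · exact hI.2 u (by omega)

variable (n deg nb keep) in
/-- The output: the graph induced by the kept vertices, with all vertices as the modulator. -/
def kernelWords (ℓ : ℕ) : List ℕ :=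
  [Nat.count keep n, Nat.count keep n, if Nat.count keep n < ℓ then Nat.count keep n + 1 else ℓ] ++
    List.range (Nat.count keep n) ++ (List.range n).flatMap (keptRow deg nb keep)

theorem runs_emitKernel {σ : State} {ℓ : ℕ} (h : HoldsKept w n deg nb keep σ)
    (hL : σ.reg rL = ℓ) (hℓ : ℓ < 2 ^ w) (hnb : ∀ u < n, ∀ j < deg u, nb u j < n)
    (hout : σ.reg rOut = 0) (hlen : ∑ u ∈ Finset.range n, (deg u + 1) + 2 * n + 16 < 2 ^ w) {N : ℕ}
    (hN : ∑ u ∈ Finset.range n, (deg u + 2) + 1 ≤ N) :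
    Runs w emitKernel σ (emitKernel.rate * N)
      fun τ => τ.Outputs (kernelWords n deg nb keep ℓ) := by
  have hnN : n + 1 ≤ N := by
    refine le_trans ?_ hN
    have : ∑ u ∈ Finset.range n, 1 ≤ ∑ u ∈ Finset.range n, (deg u + 2) :=
      Finset.sum_le_sum fun _ _ => by omega
    simp only [Finset.sum_const, Finset.card_range, smul_eq_mul, mul_one] at this
    omega
  refine Runs.seq_rate ((runs_setNew h (by omega)).mono (Nat.mul_le_mul_left _ hnN)
    fun _ _ h => h) fun τ hF hτ => ?_
  have h1 := h.of_frame hF (by simp [setNew, WritesReg]) (by simp [setNew, WritesMem])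
    (by simp [setNew, WritesMem]) (by simp [setNew, WritesMem])
  have hL1 : τ.reg rL = ℓ := (hF.reg _ (by simp [setNew, WritesReg])).trans hL
  have hE1 : Emitted [] τ := ⟨(hF.reg _ (by simp [setNew, WritesReg])).trans hout, by
    intro i hi; simp at hi⟩
  have hcle := Nat.count_le (p := keep) (n := n)
  set c := Nat.count keep n with hc
  refine Runs.seq_rate (Runs.rate_mul (by omega) (runs_emit hE1 hτ.1
    (by rw [List.length_nil]; omega)))
    fun υ hF1 hE2 => ?_
  have h2 := h1.of_frame hF1 (by simp [emit, WritesReg]) (by simp [emit, WritesMem])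
    (by simp [emit, WritesMem]) (by simp [emit, WritesMem])
  have hL2 : υ.reg rL = ℓ := (hF1.reg _ (by simp [emit, WritesReg])).trans hL1
  have hC2 : υ.reg rCnt = c := (hF1.reg _ (by simp [emit, WritesReg])).trans hτ.1
  refine Runs.seq_rate (Runs.rate_mul (by omega) (runs_emit hE2 hC2 (by simp; omega)))
    fun ρ hF2 hE3 => ?_
  have h3 := h2.of_frame hF2 (by simp [emit, WritesReg]) (by simp [emit, WritesMem])
    (by simp [emit, WritesMem]) (by simp [emit, WritesMem])
  have hL3 : (reg rL).eval w ρ = ℓ := (hF2.reg _ (by simp [emit, WritesReg])).trans hL2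
  have hC3 : (reg rCnt).eval w ρ = c := (hF2.reg _ (by simp [emit, WritesReg])).trans hC2
  have hlt := lt_eq hC3 hL3 (by omega)
  have hterm : lengthTerm.eval w ρ = if c < ℓ then c + 1 else ℓ := by
    refine (add_eq (mul_eq hlt (add_eq hC3 (const_eq (c := 1) (by omega)) (by omega)) ?_)
      (mul_eq (sub_eq (const_eq (c := 1) (by omega)) hlt (by omega)) hL3 ?_) ?_).trans ?_
    · split_ifs <;> omega
    · split_ifs <;> omega
    · split_ifs <;> omega
    · split_ifs <;> omega
  refine Runs.seq_rate (Runs.rate_mul (by omega) (runs_emit hE3 hterm (by simp; omega)))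
    fun ξ hF3 hE4 => ?_
  have h4 := h3.of_frame hF3 (by simp [emit, WritesReg]) (by simp [emit, WritesMem])
    (by simp [emit, WritesMem]) (by simp [emit, WritesMem])
  have hC4 : ξ.reg rCnt = c := (hF3.reg _ (by simp [emit, WritesReg])).trans hC3
  have hnew4 : ξ.mem aNew = τ.mem aNew := by
    rw [hF3.mem _ (by simp [emit, WritesMem]), hF2.mem _ (by simp [emit, WritesMem]),
      hF1.mem _ (by simp [emit, WritesMem])]
  set l := [c, c, if c < ℓ then c + 1 else ℓ] with hl
  have hE4 : Emitted l ξ := hE4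
  refine Runs.seq_rate (Runs.forLoop_rate (m := c) (by omega)
    (fun i => Emitted (l ++ List.range i)) (by omega) (by omega) (by simp [emit, WritesReg])
    (by simpa using hE4) (fun i υ x h => h.setReg (by decide)) (fun ζ hF4 => ?_)
    fun i hi ζ hF4 hri hI => ?_) fun ζ hF4 hE5 => ?_
  · exact (hF4.reg _ (by simp [emit, WritesReg])).trans hC4
  · rw [List.range_succ, ← List.append_assoc]
    exact runs_emit hI hri (by simp [hl]; omega)
  · have h5 := h4.of_frame hF4 (by simp [emit, WritesReg]) (by simp [emit, WritesMem])
      (by simp [emit, WritesMem]) (by simp [emit, WritesMem])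
    refine (runs_emitRows h5 (fun u hu => ?_) hnb hE5 ?_ hN).mono le_rfl fun _ _ h => h.out
    · rw [hF4.mem _ (by simp [emit, WritesMem]), hnew4, hτ.2 u hu]
    · rw [List.length_append, List.length_range]
      simp only [hl, List.length_cons, List.length_nil]
      omega

end
end LPKernel

namespace LPKernel
open Program
open Term (const reg cell const_eq cell_eq add_eq sub_eq mul_eq lt_eq eq_eq eval_reg)

/-! ### Instances with few modulator vertices -/

section
variable {H : ℕ} {F : Forested H}

variable (F) in
/-- The root of the tree of `u`. -/
def Forested.root (u : ℕ) : ℕ := F.par^[F.dep u - 1] u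

theorem Forested.root_spec {u : ℕ} (hu : F.W u) : F.W (F.root u) ∧ F.par (F.root u) = F.n := by
  have h0 := Forested.dep_pos hu
  obtain ⟨h1, h2⟩ := Forested.iterate_W hu (r := F.dep u - 1) (by omega)
  refine ⟨h1, (F.par_W h1).resolve_left fun h3 => ?_⟩
  have h4 := F.dep_W h1
  have h5 := Forested.dep_pos h3
  omega

theorem Forested.root_iterate {u v r : ℕ} (hu : F.W u) (hv : F.W v) (h : F.par^[r] u = v) :
    F.root u = F.root v := by
  have h1 := Forested.dep_of_iterate hu hv h
  have h2 := Forested.dep_pos hv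
  unfold Forested.root
  rw [← h, ← Function.iterate_add_apply]
  congr 1
  rw [h]; omega

theorem Forested.root_of_adj {u v : ℕ} (hu : F.W u) (hv : F.W v) (h : F.Adj u v) :
    F.root u = F.root v := by
  rcases F.comp hu hv h with ⟨r, hr⟩ | ⟨r, hr⟩
  · exact Forested.root_iterate hu hv hr
  · exact (Forested.root_iterate hv hu hr).symm

theorem Forested.root_of_chain {u : ℕ} {L : List ℕ} (hW : ∀ z ∈ u :: L, F.W z)
    (h : (u :: L).IsChain F.Adj) : ∀ z ∈ u :: L, F.root z = F.root u := by
  induction L generalizing u with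
  | nil => simp
  | cons v L ih =>
    rw [List.isChain_cons_cons] at h
    have h1 := Forested.root_of_adj (hW u (by simp)) (hW v (by simp)) h.1
    intro z hz
    rcases List.mem_cons.1 hz with rfl | hz
    · rfl
    · rw [h1]
      exact ih (fun z hz => hW z (List.mem_cons_of_mem _ hz)) h.2 z hz

variable (F) in
/-- The final colour of `u` if all vertices have the same label. -/
noncomputable def Forested.plainColor (u : ℕ) : ℕ := F.color (fun _ => 1) (fun _ => 1) H u

/-- If the forest spans the graph, a longest path lies in one tree. -/
theorem Forested.exists_path_iff (hW : ∀ u < F.n, F.W u)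
    (hH : ∀ P, F.IsPathList P → P.length ≤ H) (ℓ : ℕ) :
    (∃ P, F.IsPathList P ∧ ℓ + 1 ≤ P.length) ↔
      ∃ u < F.n, F.par u = F.n ∧ ℓ < Forested.segLen H (F.plainColor u) := by
  constructor
  · rintro ⟨P, hP, hlen⟩
    cases P with
    | nil => simp at hlen
    | cons u L =>
      have hWP : ∀ z ∈ u :: L, F.W z := fun z hz => hW z (hP.lt z hz)
      have hr := Forested.root_spec (hWP u (by simp))
      refine ⟨F.root u, F.W_lt hr.1, hr.2, lt_of_lt_of_le hlen ?_⟩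
      refine Forested.IsSeg.length_le_segLen (fun _ => le_rfl) (fun _ => le_rfl) hr.1
        ⟨by simp, hP.nodup, hP.chain, fun z hz => ⟨hWP z hz, F.dep z - 1, ?_⟩,
          fun _ _ => rfl, fun _ _ => rfl⟩ (hH _ hP)
      exact Forested.root_of_chain hWP hP.chain z hz
  · rintro ⟨u, hu, _, hseg⟩
    obtain ⟨L, h1, h2⟩ := Forested.exists_isSeg (fun _ => le_rfl) (fun _ => le_rfl) (hW u hu)
      (show 1 ≤ Forested.segLen H (F.plainColor u) by omega)
    refine ⟨L, ⟨h2.nodup, h2.chain, fun z hz => F.W_lt (h2.below z hz).1⟩, ?_⟩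
    rw [h1]; exact hseg

end

/-- Whether the vertex in the register `rU` is the root of a tree with a path that is long
enough. -/
noncomputable def witnessTerm (H : ℕ) : Term :=
  .op .eq (cell aPar (reg rU)) (reg rN) *
    .op .lt (reg rL) (Term.lookup (numColors H H) (Forested.segLen H) (cell aCol (reg rU)))

/-- An instance with the answer yes: one edge, and both its ends in the modulator. -/
def yesWords : List ℕ := [2, 2, 1, 0, 1, 1, 1, 1, 0]

/-- An instance with the answer no: the empty graph. -/
def noWords : List ℕ := [0, 0, 1]

/-- Solve the instance, and write an instance with the same answer. -/
noncomputable def solveDirectly (H : ℕ) : Program :=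
  .seq (forLoop rU (reg rN) (.seq (.store aX (reg rU) (const 1)) (.store aY (reg rU) (const 1))))
    (.seq (colorAll H) (.seq (.assign rAns (const 0))
      (.seq (forLoop rU (reg rN) (.assign rAns (reg rAns + witnessTerm H)))
        (.ite (reg rAns) (emitConsts yesWords) (emitConsts noWords)))))

section
variable {H w : ℕ} {F : Forested H}

open Classical in
theorem runs_solveDirectly {σ : State} {ℓ : ℕ} (h : HoldsForest F σ) (hf : Fits H F.n w)
    (hH : H < 2 ^ w) (hL : σ.reg rL = ℓ) (hout : σ.reg rOut = 0) :
    Runs w (solveDirectly H) σ ((solveDirectly H).rate * (F.n + 2)) fun τ => τ.Outputs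
      (if ∃ u < F.n, F.par u = F.n ∧ ℓ < Forested.segLen H (F.plainColor u) then yesWords
        else noWords) := by
  have hsmall := hf.small
  have hone := hf.one
  refine Runs.seq_rate (Runs.forLoop_rate (m := F.n) (by omega) (fun i τ => ∀ u < i,
    τ.mem aX u = 1 ∧ τ.mem aY u = 1) (by omega) hone (by simp [WritesReg]) (by simp)
    (fun _ _ _ h => h) (fun τ hF => ?_) fun i hi τ hF hri hI => ?_) fun τ hF hτ => ?_
  · exact (hF.reg _ (by simp [WritesReg])).trans h.n
  · refine Runs.seq (Runs.store (u := i) (v := 1) (Q := fun υ => υ = τ.setMem aX i 1) hri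
      (const_eq hone) rfl) fun υ _ hυ => ?_
    subst hυ
    refine Runs.store (u := i) (v := 1) hri (const_eq hone) fun u hu => ?_
    simp only [State.setMem_mem, if_true, Function.update_apply]
    by_cases hui : u = i
    · simp [hui]
    · have := hI u (by omega)
      simp [hui, this]
  have h1 := h.of_frame hF (by simp [WritesReg]) (by simp [WritesMem]) (by simp [WritesMem])
  have hcr : ∀ r, r ≠ rU → ¬ (colorAll H).WritesReg r := fun r hr h => hr (colorAll_writesReg h)
  have hcm : ∀ a, a < aCol → ¬ (colorAll H).WritesMem a := fun a ha h => by
    have := colorAll_writesMem h; omega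
  refine Runs.seq_rate (runs_colorAll (lx := fun _ => 1) (ly := fun _ => 1) hf (fun _ => le_rfl)
    (fun _ => le_rfl) h1 hτ) fun υ hF1 hυ => ?_
  have h2 := h1.of_frame hF1 (hcr _ (by decide)) (hcm _ (by decide)) (hcm _ (by decide))
  have hL2 : υ.reg rL = ℓ :=
    (hF1.reg _ (hcr _ (by decide))).trans ((hF.reg _ (by simp [WritesReg])).trans hL)
  have hO2 : υ.reg rOut = 0 :=
    (hF1.reg _ (hcr _ (by decide))).trans ((hF.reg _ (by simp [WritesReg])).trans hout)
  refine Runs.seq_rate (R := fun τ => τ.reg rAns = 0) (Runs.rate_mul (by omega)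
    (Runs.assign (v := 0) (const_eq (by omega)) (by simp))) fun ρ hF2 hρ => ?_
  have h3 := h2.of_frame hF2 (by simp [WritesReg]) (by simp [WritesMem]) (by simp [WritesMem])
  have hL3 : ρ.reg rL = ℓ := (hF2.reg _ (by simp [WritesReg])).trans hL2
  have hO3 : ρ.reg rOut = 0 := (hF2.reg _ (by simp [WritesReg])).trans hO2
  have hcol3 : ∀ u < F.n, ρ.mem aCol u = F.plainColor u := fun u hu => by
    rw [hF2.mem _ (by simp [WritesMem])]; exact hυ u hu
  refine Runs.seq_rate (Runs.forLoop_rate (m := F.n) (by omega) (fun i ξ => ξ.reg rAns ≤ i ∧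
    (ξ.reg rAns ≠ 0 ↔ ∃ u < i, F.par u = F.n ∧ ℓ < Forested.segLen H (F.plainColor u)))
    (by omega) hone (by simp [WritesReg]) (by simp [hρ]) (fun i ξ x h => by simpa using h)
    (fun ξ hF3 => ?_) fun i hi ξ hF3 hri hI => ?_) fun ξ hF3 hξ => ?_
  · exact (hF3.reg _ (by simp [WritesReg])).trans h3.n
  · have h4 := h3.of_frame hF3 (by simp [WritesReg]) (by simp [WritesMem]) (by simp [WritesMem])
    have hU : (reg rU).eval w ξ = i := hri
    have hc := cell_eq aCol hU
    rw [hF3.mem _ (by simp [WritesMem]), hcol3 i hi] at hc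
    have hcl : F.plainColor i < numColors H H :=
      Forested.color_lt (fun _ => le_rfl) (fun _ => le_rfl) _ _
    have hlk : (Term.lookup (numColors H H) (Forested.segLen H) (cell aCol (reg rU))).eval w ξ =
        Forested.segLen H (F.plainColor i) := by
      have h1 := hf.col H le_rfl
      have h2 : numColors H H ≤ (F.n + 1) * numColors H H := Nat.le_mul_of_pos_left _ (by omega)
      rw [Term.eval_lookup (by omega) (fun κ _ => (Forested.segLen_le H κ).trans_lt hH) hone
        (by rw [hc]; exact hcl), hc]
    have e1 : (witnessTerm H).eval w ξ =
        bit (F.par i = F.n ∧ ℓ < Forested.segLen H (F.plainColor i)) := by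
      rw [← bit_mul_bit]
      refine mul_eq ?_ ?_ (by rw [bit_mul_bit]; exact (bit_le_one _).trans_lt hone)
      · rw [eq_eq (cell_eq aPar hU) (by rw [eval_reg, h4.n]) hone, h4.par, ite_eq_bit]
      · rw [lt_eq (by rw [eval_reg, hF3.reg _ (by simp [WritesReg]), hL3]) hlk hone, ite_eq_bit]
    have b1 := bit_le_one (F.par i = F.n ∧ ℓ < Forested.segLen H (F.plainColor i))
    refine Runs.assign (add_eq rfl e1 (by rw [eval_reg]; omega)) ?_
    rw [State.setReg_reg, if_pos rfl, eval_reg]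
    refine ⟨by omega, ?_⟩
    constructor
    · intro hne
      by_cases h0 : ξ.reg rAns = 0
      · refine ⟨i, by omega, ?_⟩
        by_contra hcon
        rw [h0, bit, if_neg hcon] at hne
        exact hne rfl
      · obtain ⟨u, hu, h⟩ := hI.2.1 h0
        exact ⟨u, by omega, h⟩
    · rintro ⟨u, hu, h⟩
      rcases Nat.lt_succ_iff_lt_or_eq.1 hu with hu | rfl
      · have := hI.2.2 ⟨u, hu, h⟩
        omega
      · rw [bit, if_pos h]; omega
  · have hO4 : Emitted [] ξ := ⟨(hF3.reg _ (by simp [WritesReg])).trans hO3, by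
      intro i hi; simp at hi⟩
    refine Runs.ite_rate (by omega) (fun hne => ?_) fun he => ?_
    · rw [if_pos (hξ.2.1 hne)]
      refine Runs.rate_mul (by omega) ((runs_emitConsts hO4 ?_ ?_).mono le_rfl fun _ _ h => h.out)
      · simp only [yesWords, List.length_cons, List.length_nil]; omega
      · simp only [yesWords, List.forall_mem_cons]
        refine ⟨?_, ?_, ?_, ?_, ?_, ?_, ?_, ?_, ?_, by simp⟩ <;> omega
    · rw [if_neg fun h => hξ.2.2 h he]
      refine Runs.rate_mul (by omega) ((runs_emitConsts hO4 ?_ ?_).mono le_rfl fun _ _ h => h.out)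
      · simp only [noWords, List.length_cons, List.length_nil]; omega
      · simp only [noWords, List.forall_mem_cons]
        refine ⟨?_, ?_, ?_, by simp⟩ <;> omega

end
end LPKernel

namespace LPKernel
open Program
open Term (const reg cell const_eq cell_eq add_eq sub_eq mul_eq lt_eq eq_eq eval_reg)

/-! ### The kernelization program -/

/-- The kernelization. Instances with fewer than `K` modulator vertices are solved directly. The
paths that avoid the modulator have at most `H` vertices, and all paths have at most `H'` vertices if
the modulator has fewer than `K` vertices. -/
noncomputable def kernelize (K H H' : ℕ) : Program :=
  .seq (readInput K) (.seq dfs (.ite (.op .lt (reg rKraw) (const K)) (solveDirectly H')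
    (.seq (computeKept H) emitKernel)))

/-- Words are long enough for the numbers that occur in the kernelization. -/
structure AllFit (K H H' n k ℓ s w : ℕ) : Prop where
  K_lt : K < 2 ^ w
  l_lt : ℓ < 2 ^ w
  input : s + 2 * n + 16 < 2 ^ w
  large : Fits H n w
  k_lt : k + H + 16 < 2 ^ w
  small : Fits H' n w
  small_lt : H' < 2 ^ w

open Classical in
/-- The possible results of the kernelization. -/
def Result (K H H' n k ℓ : ℕ) (mods deg : ℕ → ℕ) (nb : ℕ → ℕ → ℕ) (Adj : ℕ → ℕ → Prop)
    (y : List ℕ) : Prop :=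
  (k < K ∧ ∃ F : Forested H', F.n = n ∧ F.Adj = Adj ∧ (∀ u < F.n, F.W u) ∧
    y = if ∃ u < F.n, F.par u = F.n ∧ ℓ < Forested.segLen H' (F.plainColor u) then yesWords
      else noWords) ∨
  (K ≤ k ∧ ∃ F : Forested H, F.n = n ∧ F.Adj = Adj ∧
    F.W = (fun u => u < n ∧ ¬ ∃ i < k, mods i = u) ∧ ∃ Mk : Finset ℕ,
      (∀ v, F.markedChildren Mk v ≤ markBound H k) ∧ F.Selects k mods Mk ∧
      y = kernelWords n deg nb (F.Kept Mk) ℓ)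

/-- The bounds `H` and `H'` for the lengths of paths enter only as bounds for the heights of the
search forests, in the two cases. The running time is proportional to the length of the input plus
`n` for each pair of attachments. -/
theorem runs_kernelize {K H H' n k ℓ w : ℕ} {mods start deg : ℕ → ℕ} {nb : ℕ → ℕ → ℕ}
    {Adj : ℕ → ℕ → Prop} {σ : State} (h : Source n k ℓ mods start deg nb (σ.mem aIn))
    (hA : AdjLists n Adj nb deg) (hmods : ∀ i < k, mods i < n)
    (hw : AllFit K H H' n k ℓ (start n) w) (hreg : σ.reg rOut = 0)
    (hzero : ∀ a, a ≠ aIn → ∀ i, σ.mem a i = 0)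
    (hH : ∀ L : List ℕ, L.Nodup → L.IsChain Adj → (∀ z ∈ L, z < n ∧ ¬ ∃ i < k, mods i = z) →
      L.length ≤ H)
    (hH' : k < K → ∀ L : List ℕ, L.Nodup → L.IsChain Adj → (∀ z ∈ L, z < n) → L.length ≤ H') :
    Runs w (kernelize K H H') σ ((kernelize K H H').rate *
      ((start n + n) * 2 + (n + 2) * (k + H + 2) * (k + H + 2)))
      fun τ => ∃ y, Result K H H' n k ℓ mods deg nb Adj y ∧ τ.Outputs y := by
  classical
  have hin := hw.input
  have hs := h.start_eq
  have hsq : n + 2 ≤ (n + 2) * (k + H + 2) * (k + H + 2) := by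
    rw [mul_assoc]
    exact Nat.le_mul_of_pos_right _ (Nat.mul_pos (by omega) (by omega))
  have hrr : ∀ r, rCur < r → ¬ (readInput K).WritesReg r := fun r hr h => by
    have := readInput_writesReg h; omega
  have hrm : ∀ a, aPar < a ∨ a = aPtr → ¬ (readInput K).WritesMem a := fun a ha h => by
    have := readInput_writesMem h; omega
  refine Runs.seq_rate ((runs_readInput h hA (by omega) hw.large.mat hw.K_lt hzero).mono
    (Nat.mul_le_mul_left _ (by omega)) fun _ _ h => h) fun τ hF hτ => ?_
  have hsearch : Searches n Adj (fun u => ∃ i < effective K k, mods i = u) nb deg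
      (2 * ∑ z ∈ Finset.range (n + 1), deg z) τ := by
    have hptr : ∀ u, τ.mem aPtr u = 0 := fun u => by
      rw [hF.mem _ (hrm _ (Or.inr rfl))]; exact hzero _ (by decide) u
    refine ⟨fun _ => 0, ?_, ?_⟩
    · rw [hτ.cur]
      exact DfsInv.init (fun u _ => hτ.vis u) hτ.par fun u _ => hptr u
    · simp only [dfsFuel, hptr, Nat.sub_zero, add_zero]
  have hdr : ∀ r, r < rCur ∨ rV < r → ¬ dfs.WritesReg r := fun r hr h => by
    have := dfs_writesReg h; omega
  have hdm : ∀ a, a < aVis ∨ aPar < a → ¬ dfs.WritesMem a := fun a ha h => by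
    have := dfs_writesMem h; omega
  have hfuel : 2 * ∑ z ∈ Finset.range (n + 1), deg z + 1 ≤ start n * 2 := by
    rw [Finset.sum_range_succ, hA.deg_top]
    rw [Finset.sum_add_distrib] at hs
    simp only [Finset.sum_const, Finset.card_range, smul_eq_mul, mul_one] at hs
    omega
  refine Runs.seq_rate ((runs_dfs hA hτ.lists (by omega) hsearch).mono
    (Nat.mul_le_mul_left _ (by omega)) fun _ _ h => h) fun υ hF1 ⟨dep, hD, hptr⟩ => ?_
  have hh := hτ.toHoldsHeader.of_frame hF1 fun r hr => hdr r (Or.inl (by omega))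
  have hlists := hτ.lists.of_frame hF1 (hdr _ (by decide)) (hdm _ (by decide)) (hdm _ (by decide))
  have hmat : ∀ u < n, ∀ v ≤ n, υ.mem aMat (u * (n + 1) + v) = bit (Adj u v) := fun u hu v hv => by
    rw [hF1.mem _ (hdm _ (by decide))]; exact hτ.mat u hu v hv
  have hO : υ.reg rOut = 0 := by
    rw [hF1.reg _ (hdr _ (by decide)), hF.reg _ (hrr _ (by decide)), hreg]
  have htest : (.op .lt (reg rKraw) (const K) : Term).eval w υ = if k < K then 1 else 0 :=
    lt_eq hh.reg_kraw (const_eq hw.K_lt) (by omega)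
  refine Runs.ite_rate (by omega) (fun hne => ?_) fun he => ?_
  · have hk : k < K := by
      by_contra hcon
      rw [htest, if_neg hcon] at hne
      exact hne rfl
    have hk0 : effective K k = 0 := if_pos hk
    rw [hk0] at hD
    obtain ⟨F, hn, hadj, hFW, hpar⟩ := hD.exists_forested hA hptr (H := H')
      fun L h1 h2 h3 => hH' hk L h1 h2 fun z hz => (h3 z hz).1
    refine (runs_solveDirectly (F := F) (H := H') (ℓ := ℓ) ⟨?_, hpar.symm, ?_⟩ (hn ▸ hw.small)
      hw.small_lt hh.reg_l hO).mono (Nat.mul_le_mul_left _ (by omega)) fun ρ _ hρ =>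
        ⟨_, Or.inl ⟨hk, F, hn, hadj, fun u hu => ?_, rfl⟩, hρ⟩
    · rw [hn]; exact hh.reg_n
    · rw [hn, hadj]; exact hmat
    · rw [hFW]
      exact ⟨hn ▸ hu, by simp⟩
  · have hk : K ≤ k := by
      by_contra hcon
      rw [htest, if_pos (by omega)] at he
      exact one_ne_zero he
    have hk0 : effective K k = k := if_neg (by omega)
    rw [hk0] at hD
    obtain ⟨F, hn, hadj, hFW, hpar⟩ := hD.exists_forested hA hptr hH
    have hcr : ∀ r, r ≤ rJ ∧ r ≠ rU ∨ rB < r → ¬ (computeKept H).WritesReg r := fun r hr h => by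
      have := computeKept_writesReg h; omega
    have hcm : ∀ a, a < aDep ∨ aKeep < a → ¬ (computeKept H).WritesMem a := fun a ha h => by
      have := computeKept_writesMem h; omega
    refine Runs.seq_rate ((runs_computeKept (F := F) (k := k) (mods := mods)
      ⟨?_, hpar.symm, ?_⟩ ?_ (fun i hi => ?_) (hn ▸ hw.large) hw.k_lt (hn ▸ hmods) fun z => ?_).mono
      (Nat.mul_le_mul_left _ (by rw [hn]; omega)) fun _ _ h => h)
      fun ρ hF2 ⟨Mk, hkeep, hbound, hsel⟩ => ?_
    · rw [hn]; exact hh.reg_n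
    · rw [hn, hadj]; exact hmat
    · rw [hh.reg_k, hk0]
    · rw [hF1.mem _ (hdm _ (by decide)), hτ.mods_eq i hi]
    · rw [hF1.mem _ (hdm _ (by decide)), hF.mem _ (hrm _ (Or.inl (by decide)))]
      exact hzero _ (by decide) z
    · refine (runs_emitKernel (n := n) (deg := deg) (nb := nb) (keep := F.Kept Mk) (ℓ := ℓ)
        ⟨hlists.of_frame hF2 (hcr _ (by decide)) (hcm _ (by decide)) (hcm _ (by decide)),
          hn ▸ hkeep⟩ ?_ hw.l_lt (fun u hu j hj => hA.nb_lt hu.le hj) ?_ ?_ ?_).mono le_rfl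
          fun ξ _ hξ => ⟨_, Or.inr ⟨hk, F, hn, hadj, hFW, Mk, hbound, hsel, ?_⟩, hξ⟩
      · rw [hF2.reg _ (hcr _ (by decide)), hh.reg_l]
      · rw [hF2.reg _ (hcr _ (by decide)), hO]
      · omega
      · have hsum : ∑ u ∈ Finset.range n, (deg u + 2) =
            ∑ u ∈ Finset.range n, (deg u + 1) + n := by
          simp only [Finset.sum_add_distrib, Finset.sum_const, Finset.card_range, smul_eq_mul]
          ring
        omega
      · congr
end LPKernel

namespace LPKernel

/-! ### Instances and their encodings -/

/-- Adjacency, as a relation on numbers. -/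
def natAdj {n : ℕ} (G : SimpleGraph (Fin n)) (u v : ℕ) : Prop :=
  ∃ (hu : u < n) (hv : v < n), G.Adj ⟨u, hu⟩ ⟨v, hv⟩

theorem natAdj_val {n : ℕ} {G : SimpleGraph (Fin n)} {u v : Fin n} :
    natAdj G u v ↔ G.Adj u v := ⟨fun ⟨_, _, h⟩ => h, fun h => ⟨u.2, v.2, h⟩⟩

/-- Lists of vertices of a graph on `Fin n` correspond to lists of numbers below `n`. -/
theorem exists_fin_list {n : ℕ} {L : List ℕ} (h : ∀ z ∈ L, z < n) :
    ∃ L' : List (Fin n), L'.map Fin.val = L :=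
  ⟨L.pmap Fin.mk h, by rw [List.map_pmap]; simp⟩

theorem isChain_natAdj {n : ℕ} {G : SimpleGraph (Fin n)} {L : List (Fin n)} :
    (L.map Fin.val).IsChain (natAdj G) ↔ L.IsChain G.Adj := by
  rw [List.isChain_map]
  exact ⟨fun h => h.imp fun _ _ => natAdj_val.1, fun h => h.imp fun _ _ => natAdj_val.2⟩

theorem Instance.yes_iff_natAdj {d : ℕ} (I : Instance d) : I.Yes ↔ ∃ L : List ℕ, L.Nodup ∧
    L.IsChain (natAdj I.G) ∧ (∀ z ∈ L, z < I.n) ∧ I.ℓ + 1 ≤ L.length := by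
  rw [I.yes_iff]
  constructor
  · rintro ⟨L, h1, h2, h3⟩
    refine ⟨L.map Fin.val, h1.map Fin.val_injective, isChain_natAdj.2 h2, ?_, by simpa using h3⟩
    simp
  · rintro ⟨L, h1, h2, h3, h4⟩
    obtain ⟨L, rfl⟩ := exists_fin_list h3
    exact ⟨L, h1.of_map, isChain_natAdj.1 h2, by simpa using h4⟩

/-- The part of an encoding that describes the neighbours of `u`. -/
def listRow (deg : ℕ → ℕ) (nb : ℕ → ℕ → ℕ) (u : ℕ) : List ℕ :=
  deg u :: (List.range (deg u)).map (nb u)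

theorem length_flatMap_listRow (deg : ℕ → ℕ) (nb : ℕ → ℕ → ℕ) (m : ℕ) :
    ((List.range m).flatMap (listRow deg nb)).length = ∑ u ∈ Finset.range m, (deg u + 1) := by
  induction m with
  | zero => simp
  | succ m ih =>
    rw [List.range_succ, List.flatMap_append, List.length_append, ih, Finset.sum_range_succ]
    simp [listRow]

theorem source_of_eq {n k ℓ : ℕ} {mods deg : ℕ → ℕ} {nb : ℕ → ℕ → ℕ} {x : List ℕ}
    (hx : x = [n, k, ℓ] ++ (List.range k).map mods ++ (List.range n).flatMap (listRow deg nb)) :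
    Source n k ℓ mods (fun u => 3 + k + ∑ v ∈ Finset.range u, (deg v + 1)) deg nb
      fun i => x.getD i 0 := by
  have hrow : ∀ u < n, ∀ i, i < deg u + 1 →
      x.getD (3 + k + ∑ v ∈ Finset.range u, (deg v + 1) + i) 0 = (listRow deg nb u).getD i 0 := by
    intro u hu i hi
    obtain ⟨r, rfl⟩ := Nat.exists_eq_add_of_lt hu
    have h1 : x = ([u + r + 1, k, ℓ] ++ (List.range k).map mods ++
        (List.range u).flatMap (listRow deg nb)) ++ (listRow deg nb u ++
          (List.range r).flatMap fun i => listRow deg nb (u + (i + 1))) := by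
      rw [hx, add_assoc u, List.range_add, List.flatMap_append, List.range_succ_eq_map]
      simp [List.flatMap_map]
    have h2 : ([u + r + 1, k, ℓ] ++ (List.range k).map mods ++
        (List.range u).flatMap (listRow deg nb)).length =
        3 + k + ∑ v ∈ Finset.range u, (deg v + 1) := by
      rw [List.length_append, length_flatMap_listRow]
      simp; ring
    rw [h1, List.getD_append_right _ _ _ _ (by omega), h2, Nat.add_sub_cancel_left,
      List.getD_append _ _ _ _ (by simpa [listRow] using hi)]
  refine ⟨by simp [hx], by simp [hx], by simp [hx], fun i hi => ?_, by simp, fun u _ => ?_,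
    fun u hu => ?_, fun u hu j hj => ?_⟩
  · rw [hx, List.append_assoc, List.getD_append_right _ _ _ _ (by simp),
      List.getD_append _ _ _ _ (by simpa using hi)]
    simp [hi]
  · rw [Finset.sum_range_succ]; ring
  · have := hrow u hu 0 (by omega)
    simpa [listRow] using this
  · have := hrow u hu (j + 1) (by omega)
    rw [add_comm j, ← add_assoc] at this
    rw [this, add_comm 1]
    simp [listRow, hj]

theorem map_range_getD (l : List ℕ) : (List.range l.length).map (fun j => l.getD j 0) = l := by
  refine List.ext_getElem (by simp) fun i h1 h2 => ?_
  simp [h2]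

theorem flatMap_finRange {n : ℕ} {α : Type} (f : ℕ → List α) :
    (List.finRange n).flatMap (fun u : Fin n => f u.val) = (List.range n).flatMap f := by
  rw [← List.map_coe_finRange_eq_range, List.flatMap_map]

/-- The data of an encoded instance. -/
structure Decoded {d : ℕ} (I : Instance d) (mods deg : ℕ → ℕ) (nb : ℕ → ℕ → ℕ) : Prop where
  lists : AdjLists I.n (natAdj I.G) nb deg
  mods_lt : ∀ i < I.k, mods i < I.n
  mem_iff : ∀ v : Fin I.n, v ∈ I.S ↔ ∃ i < I.k, mods i = v
  nb_inj : ∀ u < I.n, ∀ i < deg u, ∀ j < deg u, nb u i = nb u j → i = j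

theorem Instance.EncodedBy.decode {d : ℕ} {I : Instance d} {x : List ℕ} (h : I.EncodedBy x) :
    ∃ (mods start deg : ℕ → ℕ) (nb : ℕ → ℕ → ℕ),
      Source I.n I.k I.ℓ mods start deg nb (fun i => x.getD i 0) ∧ Decoded I mods deg nb := by
  obtain ⟨M, adj, ⟨hM1, hM2⟩, hadj, hx⟩ := h
  have hMlen : M.length = I.k := by
    rw [← List.toFinset_card_of_nodup hM1, Instance.k]
    congr 1
    ext v; simp [hM2]
  let A : ℕ → List ℕ := fun u => if h : u < I.n then (adj ⟨u, h⟩).map Fin.val else List.range I.n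
  have hA : ∀ u : Fin I.n, A u = (adj u).map Fin.val := fun u => dif_pos u.2
  have hAtop : A I.n = List.range I.n := dif_neg (lt_irrefl _)
  refine ⟨fun i => (M.map Fin.val).getD i 0, _, fun u => (A u).length, fun u j => (A u).getD j 0,
    source_of_eq ?_, ?_⟩
  · rw [hx, ← flatMap_finRange, ← hMlen, ← List.length_map (f := Fin.val) (as := M), map_range_getD]
    congr 1
    refine congrArg List.flatten (List.map_congr_left fun u _ => ?_)
    rw [listRow, map_range_getD, hA u, List.length_map]
  · have hmem : ∀ u v : ℕ, u < I.n → (v ∈ A u ↔ natAdj I.G u v) := by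
      intro u v hu
      rw [hA ⟨u, hu⟩, List.mem_map]
      constructor
      · rintro ⟨v, hv, rfl⟩
        exact ⟨hu, v.2, ((hadj ⟨u, hu⟩).2 v).1 hv⟩
      · rintro ⟨_, hv, h⟩
        exact ⟨⟨v, hv⟩, ((hadj ⟨u, hu⟩).2 _).2 h, rfl⟩
    have hget : ∀ (l : List ℕ) (v : ℕ), v ∈ l ↔ ∃ j < l.length, l.getD j 0 = v := by
      intro l v
      rw [List.mem_iff_getElem]
      refine exists_congr fun j => ⟨fun ⟨h1, h2⟩ => ⟨h1, by simpa [h1] using h2⟩,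
        fun ⟨h1, h2⟩ => ⟨h1, by simpa [h1] using h2⟩⟩
    refine ⟨⟨?_, ?_, ?_, ?_, ?_, ?_⟩, ?_, ?_, ?_⟩
    · rintro u v ⟨h1, h2, h3⟩; exact ⟨h2, h1, h3.symm⟩
    · rintro u ⟨_, _, h⟩; exact I.G.irrefl h
    · rintro u v ⟨h1, _⟩; exact h1
    · intro u v hu
      rw [← hmem u v hu]
      exact hget _ _
    · simp only [hAtop, List.length_range]
    · intro j hj
      simp only [hAtop]
      simp [hj]
    · intro i hi
      have h1 : i < M.length := by omega
      simp [h1]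
    · intro v
      rw [← hM2, ← hMlen, ← List.length_map (f := Fin.val) (as := M), ← hget]
      simp [Fin.val_inj]
    · intro u hu i hi j hj he
      have hnd : (A u).Nodup := by
        rw [hA ⟨u, hu⟩]
        exact (hadj _).1.map Fin.val_injective
      change i < (A u).length at hi
      change j < (A u).length at hj
      change (A u).getD i 0 = (A u).getD j 0 at he
      rw [List.getD_eq_getElem _ _ hi, List.getD_eq_getElem _ _ hj] at he
      exact (hnd.getElem_inj_iff).1 he

theorem isModulator_univ {n : ℕ} (G : SimpleGraph (Fin n)) (d : ℕ) :
    IsModulator G Finset.univ d := by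
  have hempty : IsEmpty {v : Fin n | v ∉ Finset.univ} := ⟨fun v => v.2 (Finset.mem_univ _)⟩
  refine (Nat.sInf_le (m := 0) ?_).trans (Nat.zero_le d)
  exact ⟨⟨fun _ => none, ⟨fun v => hempty.elim v⟩⟩, fun x => hempty.elim x, fun v => hempty.elim v⟩

/-- The instance with the answer yes. -/
def yesInstance (d : ℕ) : Instance d where
  n := 2
  G := ⊤
  S := Finset.univ
  ℓ := 1
  ℓ_pos := one_pos
  modulator := isModulator_univ _ d

/-- The instance with the answer no. -/
def noInstance (d : ℕ) : Instance d where
  n := 0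
  G := ⊥
  S := Finset.univ
  ℓ := 1
  ℓ_pos := one_pos
  modulator := isModulator_univ _ d

theorem yesInstance_yes (d : ℕ) : (yesInstance d).Yes := by
  have hadj : (⊤ : SimpleGraph (Fin 2)).Adj 0 1 := by simp
  have hp : (SimpleGraph.Walk.cons hadj SimpleGraph.Walk.nil).IsPath := by
    simp [SimpleGraph.Walk.isPath_def]
  exact ⟨_, _, _, hp, le_rfl⟩

theorem noInstance_not_yes (d : ℕ) : ¬ (noInstance d).Yes := fun ⟨u, _⟩ => Fin.elim0 u

theorem yesInstance_encodedBy (d : ℕ) : (yesInstance d).EncodedBy yesWords := by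
  refine ⟨(List.finRange 2 : List (Fin 2)), fun u : Fin 2 => ([1 - u] : List (Fin 2)),
    ⟨List.nodup_finRange 2, fun v => ?_⟩, fun u => ⟨List.nodup_singleton _, fun v => ?_⟩, ?_⟩
  · exact iff_of_true (List.mem_finRange v) (Finset.mem_univ v)
  · refine List.mem_singleton.trans (Iff.trans ?_ (SimpleGraph.top_adj u v).symm)
    revert u v
    change ∀ u v : Fin 2, v = 1 - u ↔ u ≠ v
    decide
  · rfl

theorem noInstance_encodedBy (d : ℕ) : (noInstance d).EncodedBy noWords :=
  ⟨[], fun u => Fin.elim0 u, ⟨List.nodup_nil, fun v => Fin.elim0 v⟩, fun u => Fin.elim0 u, rfl⟩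

end LPKernel

namespace LPKernel

/-! ### The kernel -/

section
variable {keep : ℕ → Prop} [DecidablePred keep]

/-- The inverse of the numbering of the elements below `n` that are kept. -/
theorem exists_count_eq (n : ℕ) : ∃ e : ℕ → ℕ, ∀ i < Nat.count keep n,
    e i < n ∧ keep (e i) ∧ Nat.count keep (e i) = i := by
  have : ∀ i, ∃ m, i < Nat.count keep n → m < n ∧ keep m ∧ Nat.count keep m = i := by
    intro i
    by_cases hi : i < Nat.count keep n
    · induction n with
      | zero => simp at hi
      | succ n ih =>
        by_cases h : i < Nat.count keep n
        · obtain ⟨m, hm⟩ := ih h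
          exact ⟨m, fun _ => ⟨by have := (hm h).1; omega, (hm h).2⟩⟩
        · rw [Nat.count_succ] at hi
          split_ifs at hi with hn
          · exact ⟨n, fun _ => ⟨by omega, hn, by omega⟩⟩
          · omega
    · exact ⟨0, fun h => absurd h hi⟩
  choose e he using this
  exact ⟨e, he⟩

theorem flatMap_kept {n : ℕ} {e : ℕ → ℕ} {f : ℕ → List ℕ}
    (he : ∀ i < Nat.count keep n, e i < n ∧ keep (e i) ∧ Nat.count keep (e i) = i)
    (hf : ∀ u, ¬ keep u → f u = []) {m : ℕ} (hm : m ≤ n) :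
    (List.range m).flatMap f = (List.range (Nat.count keep m)).flatMap fun i => f (e i) := by
  induction m with
  | zero => simp
  | succ m ih =>
    rw [List.range_succ, List.flatMap_append, ih (by omega), Nat.count_succ]
    split_ifs with h
    · have h1 := Nat.count_strict_mono h (show m < n by omega)
      have h2 := he _ h1
      rw [List.range_succ, List.flatMap_append, List.flatMap_singleton, List.flatMap_singleton,
        Nat.count_injective h2.2.1 h h2.2.2]
    · rw [List.flatMap_singleton, hf m h, List.append_nil, add_zero]

variable {d : ℕ} {I : Instance d} {mods deg : ℕ → ℕ} {nb : ℕ → ℕ → ℕ}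

/-- The subgraph of the instance that is induced by the vertices `e 0, …, e (N - 1)`. All its
vertices form the modulator. -/
def inducedInstance (I : Instance d) (e : ℕ → ℕ) (N : ℕ) : Instance d where
  n := N
  G := SimpleGraph.fromRel fun i j : Fin N => natAdj I.G (e i) (e j)
  S := Finset.univ
  ℓ := if N < I.ℓ then N + 1 else I.ℓ
  ℓ_pos := by
    have := I.ℓ_pos
    split_ifs <;> omega
  modulator := isModulator_univ _ d

theorem natAdj_symm {n : ℕ} {G : SimpleGraph (Fin n)} {u v : ℕ} (h : natAdj G u v) :
    natAdj G v u := by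
  obtain ⟨h1, h2, h3⟩ := h
  exact ⟨h2, h1, h3.symm⟩

theorem inducedInstance_adj {e : ℕ → ℕ} {N : ℕ} {i j : Fin N} :
    (inducedInstance I e N).G.Adj i j ↔ natAdj I.G (e i) (e j) := by
  refine (SimpleGraph.fromRel_adj _ _ _).trans
    ⟨fun h => h.2.elim id natAdj_symm, fun h => ⟨?_, Or.inl h⟩⟩
  rintro rfl
  obtain ⟨_, _, h⟩ := h
  exact I.G.irrefl h

theorem inducedInstance_natAdj {e : ℕ → ℕ} {N i j : ℕ} :
    natAdj (inducedInstance I e N).G i j ↔ i < N ∧ j < N ∧ natAdj I.G (e i) (e j) :=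
  ⟨fun ⟨h1, h2, h3⟩ => ⟨h1, h2, inducedInstance_adj.1 h3⟩,
    fun ⟨h1, h2, h3⟩ => ⟨h1, h2, inducedInstance_adj.2 h3⟩⟩

theorem kernelWords_encodes {e : ℕ → ℕ} (hD : Decoded I mods deg nb)
    (he : ∀ i < Nat.count keep I.n, e i < I.n ∧ keep (e i) ∧ Nat.count keep (e i) = i) :
    (inducedInstance I e (Nat.count keep I.n)).EncodedBy (kernelWords I.n deg nb keep I.ℓ) := by
  set N := Nat.count keep I.n with hN
  have hnb : ∀ u < I.n, ∀ j < deg u, nb u j < I.n := fun u hu j hj => hD.lists.nb_lt hu.le hj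
  have hlt : ∀ i : Fin N, ∀ z ∈ keptNeighbors nb keep (e i) (deg (e i)), z < N := by
    intro i z hz
    simp only [keptNeighbors, List.mem_map, List.mem_filter, List.mem_range,
      decide_eq_true_eq] at hz
    obtain ⟨j, ⟨hj, hk⟩, rfl⟩ := hz
    exact Nat.count_strict_mono hk (hnb _ (he i i.2).1 j hj)
  have hex : ∀ i : Fin N, ∃ L : List (Fin N),
      L.map Fin.val = keptNeighbors nb keep (e i) (deg (e i)) := fun i => exists_fin_list (hlt i)
  choose adj hadj using hex
  refine ⟨List.finRange N, adj, ⟨List.nodup_finRange N, fun v => ?_⟩, fun i => ⟨?_, fun v => ?_⟩, ?_⟩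
  · exact iff_of_true (List.mem_finRange v) (Finset.mem_univ v)
  · refine List.Nodup.of_map Fin.val ?_
    rw [hadj i]
    refine List.Nodup.map_on (fun j hj j' hj' heq => ?_) (List.nodup_range.filter _)
    simp only [List.mem_filter, List.mem_range, decide_eq_true_eq] at hj hj'
    exact hD.nb_inj _ (he i i.2).1 _ hj.1 _ hj'.1 (Nat.count_injective hj.2 hj'.2 heq)
  · refine Iff.trans ?_ inducedInstance_adj.symm
    have h1 : v ∈ adj i ↔ v.val ∈ (adj i).map Fin.val :=
      ⟨fun h => List.mem_map_of_mem h, fun h => by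
        obtain ⟨z, hz, h⟩ := List.mem_map.1 h
        exact Fin.ext h ▸ hz⟩
    refine h1.trans ?_
    rw [hadj i, hD.lists.adj_iff (he i i.2).1]
    have hv := he v v.2
    simp only [keptNeighbors, List.mem_map, List.mem_filter, List.mem_range, decide_eq_true_eq]
    constructor
    · rintro ⟨j, ⟨hj, hk⟩, h⟩
      exact ⟨j, hj, Nat.count_injective hk hv.2.1 (h.trans hv.2.2.symm)⟩
    · rintro ⟨j, hj, h⟩
      exact ⟨j, ⟨hj, h ▸ hv.2.1⟩, by rw [h, hv.2.2]⟩
  · have hk : (inducedInstance I e N).k = N := (Finset.card_univ).trans (Fintype.card_fin N)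
    have h2 : (List.finRange N).map Fin.val = List.range N := by
      rw [List.map_coe_finRange_eq_range]
    have h3 : ∀ i : Fin N, keptRow deg nb keep (e i) =
        (adj i).length :: (adj i).map Fin.val := by
      intro i
      rw [keptRow, if_pos (he i i.2).2.1, ← hadj i, List.length_map]
    have h4 : kernelWords I.n deg nb keep I.ℓ = [N, N, if N < I.ℓ then N + 1 else I.ℓ] ++
        (List.finRange N).map Fin.val ++
        (List.finRange N).flatMap fun i => (adj i).length :: (adj i).map Fin.val := by
      rw [kernelWords, ← hN, flatMap_kept (f := keptRow deg nb keep) he (fun u hu => if_neg hu)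
        le_rfl, ← hN, ← flatMap_finRange, h2]
      simp only [h3]
    refine h4.trans ?_
    exact congrArg (fun m => [N, m, if N < I.ℓ then N + 1 else I.ℓ] ++
      (List.finRange N).map Fin.val ++
      (List.finRange N).flatMap fun i => (adj i).length :: (adj i).map Fin.val) hk.symm

/-- A path in the kernel is a path of the graph, and conversely any path can be moved into the kernel
by hypothesis. The kernel has `N` vertices, so no path in it has length `N + 1`; this is used when
the required length is lowered to `N + 1`. -/
theorem inducedInstance_yes {e : ℕ → ℕ}
    (he : ∀ i < Nat.count keep I.n, e i < I.n ∧ keep (e i) ∧ Nat.count keep (e i) = i)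
    (hkept : ∀ L : List ℕ, L.Nodup → L.IsChain (natAdj I.G) → (∀ z ∈ L, z < I.n) →
      ∃ L' : List ℕ, L'.Nodup ∧ L'.IsChain (natAdj I.G) ∧ (∀ z ∈ L', z < I.n ∧ keep z) ∧
        L.length ≤ L'.length) :
    I.Yes ↔ (inducedInstance I e (Nat.count keep I.n)).Yes := by
  set N := Nat.count keep I.n with hN
  have hℓ : (inducedInstance I e N).ℓ = if N < I.ℓ then N + 1 else I.ℓ := rfl
  rw [Instance.yes_iff_natAdj, Instance.yes_iff_natAdj]
  constructor
  · rintro ⟨L, h1, h2, h3, h4⟩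
    obtain ⟨L', g1, g2, g3, g4⟩ := hkept L h1 h2 h3
    have hNd : (L'.map (Nat.count keep)).Nodup :=
      g1.map_on fun x hx y hy h => Nat.count_injective (g3 x hx).2 (g3 y hy).2 h
    have hlt : ∀ z ∈ L'.map (Nat.count keep), z < N := by
      intro z hz
      obtain ⟨y, hy, rfl⟩ := List.mem_map.1 hz
      exact Nat.count_strict_mono (g3 y hy).2 (g3 y hy).1
    have hle : L'.length ≤ N := by
      rw [← List.length_map (Nat.count keep), ← List.toFinset_card_of_nodup hNd,
        ← Finset.card_range N]
      exact Finset.card_le_card fun z hz => Finset.mem_range.2 (hlt z (List.mem_toFinset.1 hz))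
    refine ⟨_, hNd, ?_, hlt, ?_⟩
    · rw [List.isChain_map]
      refine List.IsChain.imp_of_mem_imp (fun x y hx hy hxy => ?_) g2
      have hcx := Nat.count_strict_mono (g3 x hx).2 (g3 x hx).1
      have hcy := Nat.count_strict_mono (g3 y hy).2 (g3 y hy).1
      rw [inducedInstance_natAdj]
      refine ⟨hcx, hcy, ?_⟩
      rwa [Nat.count_injective (he _ hcx).2.1 (g3 x hx).2 (he _ hcx).2.2,
        Nat.count_injective (he _ hcy).2.1 (g3 y hy).2 (he _ hcy).2.2]
    · rw [hℓ, List.length_map]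
      split_ifs <;> omega
  · rintro ⟨L, h1, h2, h3, h4⟩
    have hle : L.length ≤ N := by
      rw [← List.toFinset_card_of_nodup h1, ← Finset.card_range N]
      exact Finset.card_le_card fun z hz => Finset.mem_range.2 (h3 z (List.mem_toFinset.1 hz))
    refine ⟨L.map e, h1.map_on fun x hx y hy h => ?_, ?_, ?_, ?_⟩
    · rw [← (he x (h3 x hx)).2.2, h, (he y (h3 y hy)).2.2]
    · rw [List.isChain_map]
      exact h2.imp fun x y hxy => (inducedInstance_natAdj.1 hxy).2.2
    · intro z hz
      obtain ⟨y, hy, rfl⟩ := List.mem_map.1 hz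
      exact (he y (h3 y hy)).1
    · rw [hℓ] at h4
      rw [List.length_map]
      split_ifs at h4 <;> omega

end

end LPKernel

namespace LPKernel

/-! ### Numerical bounds -/

theorem le_g (d k : ℕ) : k ^ 3 ^ d ≤ g d k := by
  induction d generalizing k with
  | zero => simp [g]
  | succ d ih =>
    refine le_trans ?_ (ih _)
    rw [← pow_mul, pow_succ' 3 d]
    exact Nat.pow_le_pow_left (by omega) _

theorem exists_g_le (d : ℕ) : ∃ c, ∀ k, 1 ≤ k → g d k ≤ c * k ^ 3 ^ d := by
  induction d with
  | zero => exact ⟨1, fun k _ => by simp [g]⟩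
  | succ d ih =>
    obtain ⟨c, hc⟩ := ih
    refine ⟨c * 2 ^ 3 ^ (d + 1), fun k hk => ?_⟩
    calc g d ((k + 1) ^ 3) ≤ c * ((k + 1) ^ 3) ^ 3 ^ d := hc _ (Nat.one_le_pow _ _ (by omega))
      _ = c * (k + 1) ^ 3 ^ (d + 1) := by rw [← pow_mul, ← pow_succ' 3 d]
      _ ≤ c * (2 * k) ^ 3 ^ (d + 1) :=
        Nat.mul_le_mul_left _ (Nat.pow_le_pow_left (by omega) _)
      _ = c * 2 ^ 3 ^ (d + 1) * k ^ 3 ^ (d + 1) := by rw [mul_pow]; ring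

theorem isBigO_g (d : ℕ) :
    (fun k : ℕ => (g d k : ℝ)) =O[Filter.atTop] fun k : ℕ => (k : ℝ) ^ (3 ^ d) := by
  obtain ⟨c, hc⟩ := exists_g_le d
  refine Asymptotics.IsBigO.of_bound c ?_
  filter_upwards [Filter.eventually_ge_atTop 1] with k hk
  rw [Real.norm_of_nonneg (by positivity), Real.norm_of_nonneg (by positivity)]
  exact_mod_cast hc k hk

theorem markBound_le {H k : ℕ} (hk : 20 * (H + 2) ≤ k) : 3 * markBound H k ≤ 2 * k ^ 3 := by
  have h1 : 2 * ∑ b ∈ Finset.range (k + H + 1), (b + 1) = (k + H + 1) * (k + H + 2) := by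
    have : ∀ m, 2 * ∑ b ∈ Finset.range m, (b + 1) = m * (m + 1) := by
      intro m
      induction m with
      | zero => rfl
      | succ m ih => rw [Finset.sum_range_succ, mul_add, ih]; ring
    exact this _
  have h2 : 2 * markBound H k ≤ (k + H + 2) ^ 3 := by
    calc 2 * markBound H k = (k + H) * (2 * ∑ b ∈ Finset.range (k + H + 1), (b + 1)) := by
          rw [markBound]; ring
      _ = (k + H) * ((k + H + 1) * (k + H + 2)) := by rw [h1]
      _ ≤ (k + H + 2) * ((k + H + 2) * (k + H + 2)) :=
        Nat.mul_le_mul (by omega) (Nat.mul_le_mul_right _ (by omega))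
      _ = (k + H + 2) ^ 3 := by ring
  have h3 : (20 * (k + H + 2)) ^ 3 ≤ (21 * k) ^ 3 := Nat.pow_le_pow_left (by omega) 3
  rw [mul_pow, mul_pow] at h3
  omega

theorem add_sum_pow_le {q k : ℕ} (hq : 3 * q ≤ 2 * k ^ 3) (hk : 3 ≤ k) (m : ℕ) :
    k + ∑ i ∈ Finset.range (m + 1), q ^ (i + 1) ≤ k ^ (3 * (m + 1)) := by
  have hk2 : 9 ≤ k * k := Nat.mul_le_mul hk hk
  have hk3 : k ^ 3 = k * (k * k) := by ring
  have h3 : 3 * k ≤ k ^ 3 := by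
    rw [hk3, mul_comm]
    exact Nat.mul_le_mul_left _ (by omega)
  induction m with
  | zero =>
    rw [Finset.sum_range_one, zero_add, pow_one, mul_one]
    omega
  | succ m ih =>
    rw [Finset.sum_range_succ, ← add_assoc]
    have e1 : k ^ (3 * (m + 1 + 1)) = k ^ 3 * k ^ (3 * (m + 1)) := by rw [← pow_add]; ring_nf
    have e2 : 3 * q ^ (m + 1 + 1) ≤ 2 * k ^ (3 * (m + 1 + 1)) := by
      calc 3 * q ^ (m + 1 + 1) = 3 * q * q ^ (m + 1) := by ring
        _ ≤ 2 * k ^ 3 * (k ^ 3) ^ (m + 1) :=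
          Nat.mul_le_mul hq (Nat.pow_le_pow_left (by omega) _)
        _ = 2 * k ^ (3 * (m + 1 + 1)) := by rw [e1, pow_mul]; ring
    have e3 : 3 * k ^ (3 * (m + 1)) ≤ k ^ (3 * (m + 1 + 1)) := by
      rw [e1]
      exact Nat.mul_le_mul_right _ (by omega)
    omega

theorem three_mul_two_pow_le {d : ℕ} (hd : 1 ≤ d) : 3 * (2 ^ d - 1) ≤ 3 ^ d := by
  suffices h : 3 * 2 ^ d ≤ 3 ^ d + 3 by
    have := Nat.one_le_two_pow (n := d)
    omega
  induction d, hd using Nat.le_induction with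
  | base => norm_num
  | succ d hd ih =>
    have : 3 ^ 1 ≤ 3 ^ d := Nat.pow_le_pow_right (by omega) hd
    rw [pow_succ, pow_succ]
    omega

/-- The number of kept vertices is at most the size bound of the kernel. -/
theorem add_sum_markBound_le {d k : ℕ} (hk : 20 * (2 ^ d - 1 + 2) ≤ k) :
    k + ∑ i ∈ Finset.range (2 ^ d - 1), markBound (2 ^ d - 1) k ^ (i + 1) ≤ g d k := by
  rcases Nat.eq_zero_or_pos d with rfl | hd
  · simp [g]
  · have h1 : 2 ^ 1 ≤ 2 ^ d := Nat.pow_le_pow_right (by omega) hd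
    obtain ⟨m, hm⟩ : ∃ m, 2 ^ d - 1 = m + 1 := ⟨2 ^ d - 2, by omega⟩
    have h2 := add_sum_pow_le (markBound_le hk) (by omega) m
    have h3 := three_mul_two_pow_le hd
    rw [← hm] at h2
    exact h2.trans ((Nat.pow_le_pow_right (by omega) h3).trans (le_g d k))

/-- An instance with the answer yes leaves room for a kernel with two vertices. -/
theorem Instance.Yes.two_le {d : ℕ} {I : Instance d} (h : I.Yes) : 2 ≤ g d I.k := by
  obtain ⟨L, h1, h2, h3⟩ := I.yes_iff.1 h
  have hℓ := I.ℓ_pos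
  have hm := I.modulator
  rcases d with _ | _ | d
  · have hall : ∀ v : Fin I.n, v ∈ I.S := by
      intro v
      by_contra hv
      have := hm.length_lt (L := [v]) (List.nodup_singleton v) (List.isChain_singleton v)
        (by simpa using hv)
      simp at this
    have : L.length ≤ I.S.card := by
      rw [← List.toFinset_card_of_nodup h1]
      exact Finset.card_le_card fun v _ => hall v
    change 2 ≤ I.S.card
    omega
  · change 2 ≤ (I.k + 1) ^ 3
    rcases Nat.eq_zero_or_pos I.k with hk | hk
    · have hS : I.S = ∅ := Finset.card_eq_zero.1 hk
      have := hm.length_lt h1 h2 (by simp [hS])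
      omega
    · calc 2 ≤ I.k + 1 := by omega
        _ ≤ (I.k + 1) ^ 3 := Nat.le_self_pow (by omega) _
  · change 2 ≤ g d (((I.k + 1) ^ 3 + 1) ^ 3)
    have h4 := Nat.one_le_pow 3 (I.k + 1) (by omega)
    calc 2 ≤ (I.k + 1) ^ 3 + 1 := by omega
      _ ≤ ((I.k + 1) ^ 3 + 1) ^ 3 := Nat.le_self_pow (by omega) _
      _ ≤ (((I.k + 1) ^ 3 + 1) ^ 3) ^ 3 ^ d := Nat.le_self_pow (by positivity) _
      _ ≤ _ := le_g _ _

end LPKernel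

namespace LPKernel

/-! ### The parameters, and the proof of the theorem -/

/-- The largest number of vertices of a path that avoids the modulator. -/
def pathBound (d : ℕ) : ℕ := 2 ^ d - 1

/-- Instances with fewer modulator vertices are solved directly. -/
def threshold (d : ℕ) : ℕ := 20 * (pathBound d + 2)

/-- A bound for the number of vertices of the paths in the instances that are solved directly. -/
def directBound (d : ℕ) : ℕ := 2 ^ d * 2 ^ threshold d

section
variable {d : ℕ} {I : Instance d} {mods deg : ℕ → ℕ} {nb : ℕ → ℕ → ℕ}

theorem Decoded.length_le (hD : Decoded I mods deg nb) {L : List ℕ} (h1 : L.Nodup)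
    (h2 : L.IsChain (natAdj I.G)) (h3 : ∀ z ∈ L, z < I.n ∧ ¬ ∃ i < I.k, mods i = z) :
    L.length ≤ pathBound d := by
  obtain ⟨L, rfl⟩ := exists_fin_list fun z hz => (h3 z hz).1
  have := I.modulator.length_lt h1.of_map (isChain_natAdj.1 h2) fun v hv hvS =>
    (h3 v (List.mem_map_of_mem hv)).2 ((hD.mem_iff v).1 hvS)
  rw [List.length_map, pathBound]
  omega

theorem Instance.length_le_directBound (I : Instance d) (hk : I.k < threshold d) {L : List ℕ}
    (h1 : L.Nodup) (h2 : L.IsChain (natAdj I.G)) (h3 : ∀ z ∈ L, z < I.n) :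
    L.length ≤ directBound d := by
  obtain ⟨L, rfl⟩ := exists_fin_list h3
  have := length_lt_of_avoiding (R := I.G.Adj) (B := 2 ^ d) I.S ∅
    (fun L h1 h2 h3 => I.modulator.length_lt h1 h2 fun v hv => (h3 v hv).2) L h1.of_map
    (isChain_natAdj.1 h2) (by simp)
  rw [List.length_map]
  exact this.le.trans (Nat.mul_le_mul_left _ (Nat.pow_le_pow_right (by omega) hk.le))

theorem Decoded.sum_deg_le (hD : Decoded I mods deg nb) :
    ∑ u ∈ Finset.range I.n, deg u ≤ 2 * (d + I.k) * I.n := by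
  classical
  refine le_trans ?_ (I.modulator.sum_degree_le)
  rw [Finset.sum_range]
  refine Finset.sum_le_sum fun u _ => ?_
  have hadj : ∀ j : Fin (deg u), natAdj I.G u (nb u j) := fun j =>
    (hD.lists.adj_iff u.2).2 ⟨j, j.2, rfl⟩
  have hlt : ∀ j : Fin (deg u), nb u j < I.n := fun j => (hadj j).2.1
  rw [← Fintype.card_fin (deg u), ← Finset.card_univ]
  refine Finset.card_le_card_of_injOn (fun j => ⟨nb u j, hlt j⟩) (fun j _ => ?_)
    fun i _ j _ h => Fin.ext (hD.nb_inj u u.2 i i.2 j j.2 (Fin.mk.inj h))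
  rw [Finset.mem_coe, Finset.mem_filter]
  obtain ⟨_, _, h⟩ := hadj j
  exact ⟨Finset.mem_univ _, h⟩

/-- The result of the kernelization encodes a small equivalent instance. -/
theorem Result.exists_instance {y : List ℕ} (hD : Decoded I mods deg nb)
    (h : Result (threshold d) (pathBound d) (directBound d) I.n I.k I.ℓ mods deg nb (natAdj I.G) y) :
    ∃ J : Instance d, J.EncodedBy y ∧ (I.Yes ↔ J.Yes) ∧ J.n ≤ g d I.k ∧ J.ℓ ≤ J.n + 1 := by
  classical
  rcases h with ⟨hk, F, hn, hadj, hW, rfl⟩ | ⟨hk, F, hn, hadj, hW, Mk, hbound, hsel, rfl⟩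
  · have hyes : I.Yes ↔ ∃ u < F.n, F.par u = F.n ∧
        I.ℓ < Forested.segLen (directBound d) (F.plainColor u) := by
      rw [I.yes_iff_natAdj, ← Forested.exists_path_iff hW (fun P hP =>
        I.length_le_directBound hk hP.nodup (hadj ▸ hP.chain) fun z hz => hn ▸ hP.lt z hz)]
      refine exists_congr fun L => ?_
      rw [← hadj, ← hn]
      exact ⟨fun ⟨h1, h2, h3, h4⟩ => ⟨⟨h1, h2, h3⟩, h4⟩, fun ⟨⟨h1, h2, h3⟩, h4⟩ => ⟨h1, h2, h3, h4⟩⟩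
    by_cases hI : I.Yes
    · refine ⟨yesInstance d, ?_, iff_of_true hI (yesInstance_yes d), hI.two_le, by
        simp [yesInstance]⟩
      rw [if_pos (hyes.1 hI)]
      exact yesInstance_encodedBy d
    · refine ⟨noInstance d, ?_, iff_of_false hI (noInstance_not_yes d), Nat.zero_le _, by
        simp [noInstance]⟩
      rw [if_neg (mt hyes.2 hI)]
      exact noInstance_encodedBy d
  · have henum : F.Enum I.k mods := by
      refine ⟨fun s hs hsW => ?_, fun i hi => ⟨?_, fun hi' => ?_⟩⟩
      · by_contra hcon
        rw [hW] at hsW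
        exact hsW ⟨hn ▸ hs, hcon⟩
      · rw [hn]; exact hD.mods_lt i hi
      · rw [hW] at hi'
        exact hi'.2 ⟨i, hi, rfl⟩
    have hpath : ∀ P, F.IsPathList P → (∀ z ∈ P, F.W z) → P.length ≤ pathBound d := by
      intro P hP hPW
      rw [hW] at hPW
      exact hD.length_le hP.nodup (hadj ▸ hP.chain) hPW
    obtain ⟨e, he⟩ := exists_count_eq (keep := F.Kept Mk) I.n
    refine ⟨inducedInstance I e (Nat.count (F.Kept Mk) I.n), ?_, inducedInstance_yes he ?_, ?_, ?_⟩
    · convert kernelWords_encodes hD he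
    · intro L h1 h2 h3
      obtain ⟨P, hP, hlen, hkept⟩ := Forested.exists_kept_path henum hpath hsel
        (P := L) ⟨h1, hadj ▸ h2, hn ▸ h3⟩
      exact ⟨P, hP.nodup, hadj ▸ hP.chain, fun z hz => ⟨hn ▸ hP.lt z hz, hkept z hz⟩, hlen⟩
    · change Nat.count (F.Kept Mk) I.n ≤ g d I.k
      rw [Nat.count_eq_card_filter_range]
      refine (Forested.card_kept_le henum hbound _ fun z hz => ?_).trans (add_sum_markBound_le hk)
      rw [Finset.mem_filter, Finset.mem_range] at hz
      exact ⟨hn ▸ hz.1, hz.2⟩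
    · change (if Nat.count (F.Kept Mk) I.n < I.ℓ then Nat.count (F.Kept Mk) I.n + 1 else I.ℓ) ≤
        Nat.count (F.Kept Mk) I.n + 1
      split_ifs <;> omega

/-- A number that exceeds all constants in the conditions on the word length. -/
def wordConst (d K H H' : ℕ) : ℕ :=
  K + (25 + 2 * d) + (20 + cap H) + (∑ h ∈ Finset.range (H + 1), numColors H h) + (17 + H) +
    (20 + cap H') + (∑ h ∈ Finset.range (H' + 1), numColors H' h) + H'

theorem fits_of_le {H n w D m : ℕ} (hn : n + 3 ≤ m) (hw : D * m ^ 2 < 2 ^ w)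
    (h1 : 20 + cap H ≤ D) (h2 : ∑ h ∈ Finset.range (H + 1), numColors H h ≤ D) : Fits H n w := by
  have hm1 : 1 ≤ m ^ 2 := Nat.one_le_pow _ _ (by omega)
  have hm2 : m ≤ m ^ 2 := Nat.le_self_pow (by omega) _
  refine ⟨?_, ?_, fun h hh => ?_⟩
  · have h3 := Nat.mul_le_mul h1 hm2
    have h4 := Nat.mul_le_mul_left (20 + cap H) (show 1 ≤ m by omega)
    have h5 : (20 + cap H) * m = 20 * m + cap H * m := by ring
    have h6 := Nat.le_mul_of_pos_right (cap H) (show 0 < m by omega)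
    omega
  · have h3 : (n + 1) * (n + 1) ≤ m ^ 2 := by
      rw [pow_two]; exact Nat.mul_le_mul (by omega) (by omega)
    have h4 := Nat.le_mul_of_pos_left (m ^ 2) (show 0 < D by omega)
    omega
  · have h3 : numColors H h ≤ D := (Finset.single_le_sum (f := numColors H) (fun _ _ => Nat.zero_le _)
      (Finset.mem_range.2 (Nat.lt_succ_of_le hh))).trans h2
    have h4 : (n + 1) * numColors H h ≤ m ^ 2 * D := Nat.mul_le_mul (by omega) h3
    rw [mul_comm] at hw
    omega

/-- All conditions on the word length hold if `2 ^ w` is at least a constant power of the size of the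
instance. The constant factors are absorbed by a power, as the base is at least `2`. -/
theorem Decoded.allFit {w s : ℕ} (K H H' : ℕ) (hD : Decoded I mods deg nb)
    (hs : s = 3 + I.k + ∑ u ∈ Finset.range I.n, (deg u + 1))
    (hw : (I.n + I.ℓ + 2) ^ (wordConst d K H H' + 2) ≤ 2 ^ w) :
    AllFit K H H' I.n I.k I.ℓ s w := by
  have hℓ := I.ℓ_pos
  obtain ⟨m, hm⟩ : ∃ m, m = I.n + I.ℓ + 2 := ⟨_, rfl⟩
  obtain ⟨D, hDc⟩ : ∃ D, D = wordConst d K H H' := ⟨_, rfl⟩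
  rw [← hm, ← hDc] at hw
  have hkn : I.k ≤ I.n := (Finset.card_le_univ _).trans_eq (Fintype.card_fin _)
  have hw2 : D * m ^ 2 < 2 ^ w := by
    refine lt_of_lt_of_le ?_ hw
    rw [pow_add]
    exact Nat.mul_lt_mul_of_pos_right (Nat.lt_pow_self (by omega)) (Nat.pow_pos (by omega))
  have hm1 : 1 ≤ m ^ 2 := Nat.one_le_pow _ _ (by omega)
  have hm2 : m ≤ m ^ 2 := Nat.le_self_pow (by omega) _
  have hle : ∀ {a b : ℕ}, a ≤ D → b ≤ m ^ 2 → a * b < 2 ^ w := fun h1 h2 =>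
    (Nat.mul_le_mul h1 h2).trans_lt hw2
  unfold wordConst at hDc
  refine ⟨?_, ?_, ?_, fits_of_le (by omega) hw2 (by omega) (by omega), ?_,
    fits_of_le (by omega) hw2 (by omega) (by omega), ?_⟩
  · have := hle (a := K) (by omega) hm1
    omega
  · have := hle (a := 1) (by omega) hm2
    omega
  · have h1 := hD.sum_deg_le
    have h2 := hle (a := 25 + 2 * d) (by omega) le_rfl
    have h3 : 2 * (d + I.k) * I.n ≤ 2 * d * m ^ 2 + 2 * m ^ 2 := by
      have h4 : I.n * I.n ≤ m ^ 2 := by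
        rw [pow_two]; exact Nat.mul_le_mul (by omega) (by omega)
      have h5 : I.k * I.n ≤ I.n * I.n := Nat.mul_le_mul_right _ hkn
      have h6 : d * I.n ≤ d * m ^ 2 := Nat.mul_le_mul_left _ (by omega)
      calc 2 * (d + I.k) * I.n = 2 * (d * I.n) + 2 * (I.k * I.n) := by ring
        _ ≤ 2 * (d * m ^ 2) + 2 * m ^ 2 := by omega
        _ = _ := by ring
    have h7 : (25 + 2 * d) * m ^ 2 = 25 * m ^ 2 + 2 * d * m ^ 2 := by ring
    have h8 : ∑ u ∈ Finset.range I.n, (deg u + 1) = ∑ u ∈ Finset.range I.n, deg u + I.n := by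
      simp [Finset.sum_add_distrib]
    omega
  · have h1 := hle (a := 17 + H) (by omega) hm2
    have h2 : (17 + H) * m = 17 * m + H * m := by ring
    have h3 := Nat.le_mul_of_pos_right (H) (show 0 < m by omega)
    omega
  · have := hle (a := H') (by omega) hm1
    omega

/-- The running time is linear in the number of vertices and quadratic in the parameter. -/
theorem Decoded.time_le {s : ℕ} (H : ℕ) (hD : Decoded I mods deg nb)
    (hs : s = 3 + I.k + ∑ u ∈ Finset.range I.n, (deg u + 1)) :
    (s + I.n) * 2 + (I.n + 2) * (I.k + H + 2) * (I.k + H + 2) ≤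
      (2 * (2 * d + 8) + 3 * (H + 3) ^ 2) * (max I.k 1) ^ 2 * max I.n 1 := by
  have h1 := hD.sum_deg_le
  have h2 : ∑ u ∈ Finset.range I.n, (deg u + 1) = ∑ u ∈ Finset.range I.n, deg u + I.n := by
    simp [Finset.sum_add_distrib]
  obtain ⟨a, ha⟩ : ∃ a, a = max I.k 1 := ⟨_, rfl⟩
  obtain ⟨b, hb⟩ : ∃ b, b = max I.n 1 := ⟨_, rfl⟩
  rw [← ha, ← hb]
  have ha1 : 1 ≤ a := ha ▸ le_max_right _ _
  have hb1 : 1 ≤ b := hb ▸ le_max_right _ _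
  have hka : I.k ≤ a := ha ▸ le_max_left _ _
  have hnb : I.n ≤ b := hb ▸ le_max_left _ _
  have haa : a ≤ a ^ 2 := Nat.le_self_pow (by omega) _
  have h3 : a ≤ a ^ 2 * b := haa.trans (Nat.le_mul_of_pos_right _ hb1)
  have h4 : b ≤ a ^ 2 * b := Nat.le_mul_of_pos_left _ (by positivity)
  have h5 : 2 * (d + I.k) * I.n ≤ (2 * d + 2) * (a ^ 2 * b) := by
    have : 2 * (d + I.k) ≤ (2 * d + 2) * a ^ 2 := by
      have := Nat.le_mul_of_pos_right d (show 0 < a ^ 2 by positivity)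
      calc 2 * (d + I.k) ≤ 2 * (d * a ^ 2) + 2 * a ^ 2 := by omega
        _ = _ := by ring
    calc 2 * (d + I.k) * I.n ≤ (2 * d + 2) * a ^ 2 * b := Nat.mul_le_mul this hnb
      _ = _ := by ring
  have h6 : s + I.n ≤ (2 * d + 8) * (a ^ 2 * b) := by
    have : (2 * d + 8) * (a ^ 2 * b) = (2 * d + 2) * (a ^ 2 * b) + 6 * (a ^ 2 * b) := by ring
    omega
  have h7 : I.k + H + 2 ≤ (H + 3) * a := by
    have := Nat.le_mul_of_pos_right H (show 0 < a by omega)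
    calc I.k + H + 2 ≤ H * a + 3 * a := by omega
      _ = _ := by ring
  calc _ ≤ (2 * d + 8) * (a ^ 2 * b) * 2 + 3 * b * ((H + 3) * a) * ((H + 3) * a) := by
        refine Nat.add_le_add (Nat.mul_le_mul_right _ h6) ?_
        exact Nat.mul_le_mul (Nat.mul_le_mul (by omega) h7) h7
    _ = _ := by ring

end

end LPKernel

theorem mainTheorem4 (d : ℕ) :
    ((fun k : ℕ => (LPKernel.g d k : ℝ)) =O[Filter.atTop] fun k : ℕ => (k : ℝ) ^ (3 ^ d)) ∧
    ∃ (P : LPKernel.Program) (c C : ℕ),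
      ∀ (I : LPKernel.Instance d) (x : List ℕ), I.EncodedBy x →
      ∀ w : ℕ, (I.n + I.ℓ + 2) ^ c ≤ 2 ^ w →
      ∃ (τ : LPKernel.State) (t : ℕ),
        LPKernel.Exec w P (LPKernel.State.init x) τ t ∧
        t ≤ C * (max I.k 1) ^ 2 * max I.n 1 ∧
        ∃ (J : LPKernel.Instance d) (y : List ℕ),
          J.EncodedBy y ∧ τ.Outputs y ∧
          (I.Yes ↔ J.Yes) ∧ J.n ≤ LPKernel.g d I.k ∧ J.ℓ ≤ J.n + 1 := by
  open LPKernel in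
  refine ⟨isBigO_g d, kernelize (threshold d) (pathBound d) (directBound d),
    wordConst d (threshold d) (pathBound d) (directBound d) + 2,
    (kernelize (threshold d) (pathBound d) (directBound d)).rate *
      (2 * (2 * d + 8) + 3 * (pathBound d + 3) ^ 2), fun I x hx w hw => ?_⟩
  obtain ⟨mods, start, deg, nb, hS, hD⟩ := hx.decode
  have hin : (State.init x).mem 0 = fun i => x.getD i 0 := by
    funext i
    change (if 0 = 0 then x.getD i 0 else 0) = _
    rw [if_pos rfl]
  obtain ⟨τ, t, h1, h2, y, h3, h4⟩ := runs_kernelize (σ := State.init x) (hin ▸ hS) hD.lists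
    hD.mods_lt (hD.allFit _ _ _ hS.start_eq hw) rfl (fun a ha i => if_neg ha)
    (fun L => hD.length_le) (fun hk L => I.length_le_directBound hk)
  obtain ⟨J, h5, h6⟩ := h3.exists_instance hD
  refine ⟨τ, t, h1, h2.trans ?_, J, y, h5, h4, h6⟩
  have := Nat.mul_le_mul_left (kernelize (threshold d) (pathBound d) (directBound d)).rate
    (hD.time_le (pathBound d) hS.start_eq)
  exact this.trans_eq (by ring)
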